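/- Setting. For a matrix $A\in\mathbb{R}^{n\times d}$ and $b\in\mathbb{R}^n$ put $f(x)=\|Ax-b\|_2^2$ for $x\in\mathbb{R}^d$, and let $x_*$ be a minimizer of $f$ over $\mathbb{R}^d$. For a random matrix $\Phi\in\mathbb{R}^{m\times n}$ put $g(x)=\|\Phi Ax-\Phi b\|_2^2$. Let $r(A)$ be the rank of $A$ and $\mu(A)=\max_{1\le j\le n}\|P_{\mathrm{Col}(A)}e_j\|_2$ its largest leverage score, where $P_{\mathrm{Col}(A)}$ is the orthogonal projection onto the column space of $A$. $\Phi$ is a sparse Johnson--Lindenstrauss transform (SJLT) with column sparsity $s\ge 1$ if $\Phi_{ij}=s^{-1/2}\sigma_{ij}\delta_{ij}$, where the $\sigma_{ij}$ are independent Rademacher ($\pm1$) variables; the family $(\delta_{ij})$ is independent of $(\sigma_{ij})$ and takes values in $\{0,1\}$; $\sum_{i=1}^m\delta_{ij}=s$ for every $j$; $\mathbb{E}\delta_{ij}=s/m$ and $\mathbb{E}\prod_{i\in I}\delta_{ij}\le (s/m)^{|I|}$ for every $j$ and every $I\subseteq\{1,\dots,m\}$; and the columns $(\delta_{ij})_{i=1}^m$,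 $1\le j\le n$, are independent. $\Phi$ is a full random sign matrix if $\Phi_{ij}=m^{-1/2}\sigma_{ij}$ with independent Rademacher $\sigma_{ij}$. Theorem. There is a universal constant $C>0$ such that the following hold for all $m,n,d$, $A$, $b$, $x_*$ as above and all $\varepsilon\in(0,1)$. (1) Let $\Phi$ be an SJLT with column sparsity $s$, let $0<\eta\le\frac12$ and $\eta\le\frac1m$, and suppose that $$m\ \ge\ C\,\varepsilon^{-1}\Big((\log \eta^{-1})(r(A)+\log m)(\log m)^2+(\log\eta^{-1})^2\,r(A)\Big)$$ and $$s\ \ge\ C\Big(\varepsilon^{-1}\mu(A)^2\big((\log\eta^{-1})^2+(\log\eta^{-1})(\log m)^3\big)+\varepsilon^{-1/2}\mu(A)\big((\log\eta^{-1})^{3/2}+(\log\eta^{-1})(\log m)^{3/2}\big)\Big).$$ Then, with probability at least $1-\eta$, every minimizer $\hat x$ of $g$ over $\mathbb{R}^d$ satisfies $f(\hat x)\le(1-\varepsilon)^{-2}f(x_*)$. (2) Let $\Phi$ be a full random sign matrix, let $0<\eta<1$, and suppose that $m\ge C\varepsilon^{-1}(r(A)+\log(\eta^{-1}))$. Then,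 with probability at least $1-\eta$, every minimizer $\hat x$ of $g$ over $\mathbb{R}^d$ satisfies $f(\hat x)\le(1-\varepsilon)^{-2}f(x_*)$. -/

import Mathlib

open MeasureTheory ProbabilityTheory Matrix

/-- A matrix of independent Rademacher (uniform `±1`) random variables. -/
structure IsRademacherMatrix {Ω : Type*} [MeasurableSpace Ω] (P : Measure Ω) {m n : ℕ}
    (σ : Fin m → Fin n → Ω → ℝ) : Prop where
  measurable : ∀ i j, Measurable (σ i j)
  prob_one : ∀ i j, P {ω | σ i j ω = 1} = 1 / 2
  prob_neg_one : ∀ i j, P {ω | σ i j ω = -1} = 1 / 2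
  indep : iIndepFun (fun (q : Fin m × Fin n) => σ q.1 q.2) P

/-- Random `0/1` selectors `δ i j` with exactly `s` ones in each column `j`, with mean `s / m`,
negatively correlated within each column, and with independent columns. -/
structure IsSparseSelector {Ω : Type*} [MeasurableSpace Ω] (P : Measure Ω) {m n : ℕ} (s : ℕ)
    (δ : Fin m → Fin n → Ω → ℝ) : Prop where
  measurable : ∀ i j, Measurable (δ i j)
  zero_or_one : ∀ᵐ ω ∂P, ∀ i j, δ i j ω = 0 ∨ δ i j ω = 1
  col_sum : ∀ᵐ ω ∂P, ∀ j, ∑ i, δ i j ω = (s : ℝ)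
  mean : ∀ i j, ∫ ω, δ i j ω ∂P = (s : ℝ) / (m : ℝ)
  neg_correlated : ∀ (j : Fin n) (I : Finset (Fin m)),
    ∫ ω, ∏ i ∈ I, δ i j ω ∂P ≤ ∏ i ∈ I, ∫ ω, δ i j ω ∂P
  indep_columns : iIndepFun (fun (j : Fin n) (ω : Ω) (i : Fin m) => δ i j ω) P

/-- The random matrix `Φ` is a sparse Johnson–Lindenstrauss transform with column sparsity
`s ≥ 1`: `Φ i j = σ i j * δ i j / √s`, where the signs `σ` and the selectors `δ` are
independent of each other. -/
def IsSJLT {Ω : Type*} [MeasurableSpace Ω] (P : Measure Ω) {m n : ℕ} (s : ℕ)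
    (Φ : Ω → Matrix (Fin m) (Fin n) ℝ) : Prop :=
  1 ≤ s ∧ ∃ σ δ : Fin m → Fin n → Ω → ℝ,
    IsRademacherMatrix P σ ∧ IsSparseSelector P s δ ∧
    IndepFun (fun (ω : Ω) (i : Fin m) (j : Fin n) => σ i j ω)
      (fun (ω : Ω) (i : Fin m) (j : Fin n) => δ i j ω) P ∧
    ∀ ω i j, Φ ω i j = 1 / Real.sqrt (s : ℝ) * (σ i j ω * δ i j ω)

/-- The random matrix `Φ` is a full (dense) random sign matrix: `Φ i j = σ i j / √m`. -/
def IsSignMatrix {Ω : Type*} [MeasurableSpace Ω] (P : Measure Ω) {m n : ℕ}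
    (Φ : Ω → Matrix (Fin m) (Fin n) ℝ) : Prop :=
  ∃ σ : Fin m → Fin n → Ω → ℝ, IsRademacherMatrix P σ ∧
    ∀ ω i j, Φ ω i j = 1 / Real.sqrt (m : ℝ) * σ i j ω

/-- The least squares objective `x ↦ ‖M x - c‖₂²` (Euclidean norm). -/
noncomputable def lsObjective {k d : ℕ} (M : Matrix (Fin k) (Fin d) ℝ) (c : Fin k → ℝ)
    (x : Fin d → ℝ) : ℝ :=
  ‖(WithLp.toLp 2 (M *ᵥ x - c) : EuclideanSpace ℝ (Fin k))‖ ^ 2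

/-- The sketched least squares objective `x ↦ ‖S A x - S b‖₂²`. -/
noncomputable def sketchedObjective {m n d : ℕ} (S : Matrix (Fin m) (Fin n) ℝ)
    (A : Matrix (Fin n) (Fin d) ℝ) (b : Fin n → ℝ) (x : Fin d → ℝ) : ℝ :=
  lsObjective (S * A) (S *ᵥ b) x

/-- The column space of `A`, as a subspace of Euclidean space. -/
def colSpace {n d : ℕ} (A : Matrix (Fin n) (Fin d) ℝ) : Submodule ℝ (EuclideanSpace ℝ (Fin n)) :=
  Submodule.span ℝ (Set.range fun k : Fin d => WithLp.toLp 2 (fun j : Fin n => A j k))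

/-- The largest leverage score: the maximum over `j` of `‖P_{Col(A)} e_j‖₂`. -/
noncomputable def maxLeverage {n d : ℕ} (A : Matrix (Fin n) (Fin d) ℝ) : ℝ :=
  ⨆ j : Fin n, ‖(colSpace A).starProjection (EuclideanSpace.single j (1 : ℝ))‖

/-! Let z = b - A x_* be the residual, y = A(x̂ - x_*), and S the sketch. Since z is orthogonal to
Col(A), f(x̂) = ‖y‖² + ‖z‖², so the goal is ‖y‖² ≤ ε‖z‖². Comparing x̂ with x_* in g gives ‖Sy‖² ≤
2⟨Sy, Sz⟩. Hence it is enough that S distorts Col(A) by a constant factor only, ‖Sy‖² ≥ ‖y‖²/2, and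
that ⟨Sy, Sz⟩ ≤ (√ε/4)‖z‖‖y‖ (`lsObjective_le_of_sketch`). The precision √ε is demanded of the
single vector z against Col(A); this is why ε⁻¹, and not ε⁻², appears in the dimension.

The vectors u_j = P e_j form a Parseval frame of Col(A). With v_i = ∑_j (signed entry i, j) u_j, the
first condition concerns the operator X = s⁻¹ ∑ v_i ⊗ v_i - 1, and the second the vector w = s⁻¹ ∑
(row i of z) v_i, whose centring term ∑ z_j u_j = Pz is zero. Fix the sparsity pattern. As every
column has exactly s entries, the diagonal terms cancel and X and w are homogeneous Rademacher
chaoses of degree two. So the sum over all single sign flips e of X - X∘e is 4X. The method of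
exchangeable pairs turns this identity into recursions for the trace moments of X and the norm
moments of w (`sum_trace_pow_chaos_le`, `sum_norm_pow_chaos_le`). The squared increments in them
split into a part dominated by the weight of a row times 1 + X, and a part which is the square of a
Hilbert-space valued Rademacher sum, with moments governed by the overlaps of the columns. Young's
inequality absorbs the unknown moment into the left-hand side (`sum_trace_sketchOp_pow_le`,
`sum_norm_sketchChaos_pow_le`).

For a random pattern, negative correlation gives Poisson-type exponential moments of the row weights
and overlaps (`IsPatternLaw.sum_mul_exp_card_inter_le`), so all but a proportion (m + 2)4⁻ᵖ of the
patterns are good. Markov's inequality with p about 10 log(1/η) then proves the sparse case.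

The dense matrix is the full pattern with s = m. Against a fixed vector the chaos is a mean of m
independent centred subexponential variables; a Bernstein bound and a union over a 1/2-net of the
unit ball, with at most 5^r points, finish that case. -/

set_option linter.unusedSectionVars false

/-! ### Averages over the sign cube -/

/-- The real number `±1` given by a sign. -/
def signVal (u : ℤˣ) : ℝ := ((u : ℤ) : ℝ)

lemma signVal_eq_one_or (u : ℤˣ) : signVal u = 1 ∨ signVal u = -1 := by
  rcases Int.units_eq_one_or u with rfl | rfl <;> simp [signVal]

@[simp] lemma signVal_neg (u : ℤˣ) : signVal (-u) = -signVal u := by simp [signVal]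

@[simp] lemma signVal_mul_self (u : ℤˣ) : signVal u * signVal u = 1 := by
  rcases signVal_eq_one_or u with h | h <;> simp [h]

lemma signVal_sq (u : ℤˣ) : signVal u ^ 2 = 1 := by rw [sq, signVal_mul_self]

/-- Flip the sign at the coordinate `e`. -/
def flipAt {ι : Type*} [DecidableEq ι] (e : ι) (τ : ι → ℤˣ) : ι → ℤˣ :=
  Function.update τ e (-τ e)

section Flip

variable {ι : Type*} [DecidableEq ι]

lemma flipAt_same (e : ι) (τ : ι → ℤˣ) : flipAt e τ e = -τ e := by simp [flipAt]

lemma flipAt_of_ne {e f : ι} (h : f ≠ e) (τ : ι → ℤˣ) : flipAt e τ f = τ f := by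
  simp [flipAt, h]

lemma flipAt_flipAt (e : ι) (τ : ι → ℤˣ) : flipAt e (flipAt e τ) = τ := by
  simp [flipAt]

lemma sum_flipAt [Fintype ι] {M : Type*} [AddCommMonoid M] (e : ι) (F : (ι → ℤˣ) → M) :
    ∑ τ, F (flipAt e τ) = ∑ τ, F τ :=
  Equiv.sum_comp (Function.Involutive.toPerm (flipAt e) (flipAt_flipAt e)) F

/-- A uniform sign vector and its flip at one coordinate form an exchangeable pair; this
symmetrization drives both moment recursions. -/
lemma sum_eq_half_sum_add_flipAt [Fintype ι] (e : ι) (F : (ι → ℤˣ) → ℝ) :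
    ∑ τ, F τ = ∑ τ, (F τ + F (flipAt e τ)) / 2 := by
  rw [← Finset.sum_div, Finset.sum_add_distrib, sum_flipAt]
  ring

end Flip

/-! ### Square-exponential moments and power moments of Rademacher sums in Hilbert space. -/

section HilbertSum

variable {ι : Type*} [Fintype ι] [DecidableEq ι]
  {H : Type*} [NormedAddCommGroup H] [InnerProductSpace ℝ H]

/-- Averaging over the sign of `x` leaves a hyperbolic cosine of the cross term, and cosh t ≤
exp(t²/2) turns it into a smaller denominator for ‖b‖². A Rademacher sum is thereby stripped of its
signs one at a time, each costing 2‖x‖² of `K`. -/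
lemma half_exp_norm_add_sub_le (b x : H) {K : ℝ} (hK : 2 * ‖x‖ ^ 2 < K) :
    (Real.exp (‖b + x‖ ^ 2 / K) + Real.exp (‖b - x‖ ^ 2 / K)) / 2
      ≤ Real.exp (‖x‖ ^ 2 / K) * Real.exp (‖b‖ ^ 2 / (K - 2 * ‖x‖ ^ 2)) := by
  have hK0 : 0 < K := lt_of_le_of_lt (by positivity) hK
  have h1 : Real.exp (‖b + x‖ ^ 2 / K) = Real.exp ((‖b‖ ^ 2 + ‖x‖ ^ 2) / K)
      * Real.exp (2 * inner ℝ b x / K) := by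
    rw [← Real.exp_add, norm_add_sq_real]; congr 1; ring
  have h2 : Real.exp (‖b - x‖ ^ 2 / K) = Real.exp ((‖b‖ ^ 2 + ‖x‖ ^ 2) / K)
      * Real.exp (-(2 * inner ℝ b x / K)) := by
    rw [← Real.exp_add, norm_sub_sq_real]; congr 1; ring
  have h3 : (Real.exp (‖b + x‖ ^ 2 / K) + Real.exp (‖b - x‖ ^ 2 / K)) / 2
      = Real.exp ((‖b‖ ^ 2 + ‖x‖ ^ 2) / K) * Real.cosh (2 * inner ℝ b x / K) := by
    rw [h1, h2, Real.cosh_eq]; ring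
  rw [h3]
  calc _ ≤ Real.exp ((‖b‖ ^ 2 + ‖x‖ ^ 2) / K) * Real.exp ((2 * inner ℝ b x / K) ^ 2 / 2) := by
        gcongr; exact Real.cosh_le_exp_half_sq _
    _ ≤ _ := by
        rw [← Real.exp_add, ← Real.exp_add]
        apply Real.exp_le_exp.2
        have hin : (inner ℝ b x) ^ 2 ≤ ‖b‖ ^ 2 * ‖x‖ ^ 2 := by
          rw [← mul_pow, ← sq_abs]
          exact pow_le_pow_left₀ (abs_nonneg _) (abs_real_inner_le_norm b x) 2
        have h4 : ‖b‖ ^ 2 / K + 2 * (‖b‖ ^ 2 * ‖x‖ ^ 2) / K ^ 2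
            ≤ ‖b‖ ^ 2 / (K - 2 * ‖x‖ ^ 2) := by
          rw [le_div_iff₀ (by linarith)]
          have : (‖b‖ ^ 2 / K + 2 * (‖b‖ ^ 2 * ‖x‖ ^ 2) / K ^ 2) * (K - 2 * ‖x‖ ^ 2)
            = ‖b‖ ^ 2 - 4 * ‖b‖ ^ 2 * ‖x‖ ^ 4 / K ^ 2 := by field_simp; ring
          rw [this]
          have : 0 ≤ 4 * ‖b‖ ^ 2 * ‖x‖ ^ 4 / K ^ 2 := by positivity
          linarith
        have h5 : (2 * inner ℝ b x / K) ^ 2 / 2 ≤ 2 * (‖b‖ ^ 2 * ‖x‖ ^ 2) / K ^ 2 := by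
          rw [div_pow, div_div, mul_comm (K ^ 2) 2, ← div_div]
          gcongr
          nlinarith
        have h6 : (‖b‖ ^ 2 + ‖x‖ ^ 2) / K = ‖b‖ ^ 2 / K + ‖x‖ ^ 2 / K := add_div _ _ _
        linarith

lemma norm_signVal_smul (u : ℤˣ) (x : H) : ‖signVal u • x‖ = ‖x‖ := by
  rcases signVal_eq_one_or u with h | h <;> simp [h]

/-- Square-exponential moment of a Hilbert-space valued Rademacher sum. -/
lemma sum_exp_norm_sq_rademacher_le (c : H) (a : ι → H) (s : Finset ι) {K : ℝ}
    (hK : 2 * ∑ e ∈ s, ‖a e‖ ^ 2 < K) :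
    ∑ τ : ι → ℤˣ, Real.exp (‖c + ∑ e ∈ s, signVal (τ e) • a e‖ ^ 2 / K)
      ≤ Fintype.card (ι → ℤˣ)
        * Real.exp ((‖c‖ ^ 2 + ∑ e ∈ s, ‖a e‖ ^ 2) / (K - 2 * ∑ e ∈ s, ‖a e‖ ^ 2)) := by
  induction s using Finset.induction_on generalizing K with
  | empty => simp
  | insert e s he ih =>
    rw [Finset.sum_insert he] at hK
    have hS : 0 ≤ ∑ e ∈ s, ‖a e‖ ^ 2 := Finset.sum_nonneg fun _ _ => by positivity
    have hx : 0 ≤ ‖a e‖ ^ 2 := by positivity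
    have hK0 : 0 < K := by linarith
    rw [sum_eq_half_sum_add_flipAt e]
    have step : ∀ τ : ι → ℤˣ,
        (Real.exp (‖c + ∑ f ∈ insert e s, signVal (τ f) • a f‖ ^ 2 / K)
          + Real.exp (‖c + ∑ f ∈ insert e s, signVal (flipAt e τ f) • a f‖ ^ 2 / K)) / 2
        ≤ Real.exp (‖a e‖ ^ 2 / K)
          * Real.exp (‖c + ∑ f ∈ s, signVal (τ f) • a f‖ ^ 2 / (K - 2 * ‖a e‖ ^ 2)) := by
      intro τ
      have h1 : ∑ f ∈ s, signVal (flipAt e τ f) • a f = ∑ f ∈ s, signVal (τ f) • a f :=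
        Finset.sum_congr rfl fun f hf => by
          rw [flipAt_of_ne (ne_of_mem_of_not_mem hf he)]
      rw [Finset.sum_insert he, Finset.sum_insert he, h1, flipAt_same, signVal_neg]
      have h2 := half_exp_norm_add_sub_le (c + ∑ f ∈ s, signVal (τ f) • a f)
        (signVal (τ e) • a e) (K := K) (by rw [norm_signVal_smul]; linarith)
      rw [norm_signVal_smul] at h2
      convert! h2 using 6
      · congr 1; abel
      · congr 1; rw [neg_smul]; abel
    refine (Finset.sum_le_sum fun τ _ => step τ).trans ?_
    rw [← Finset.mul_sum]
    refine (mul_le_mul_of_nonneg_left (ih (K := K - 2 * ‖a e‖ ^ 2) (by linarith))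
      (Real.exp_pos _).le).trans ?_
    rw [mul_left_comm, ← Real.exp_add, Finset.sum_insert he]
    gcongr
    have hd : 0 < K - 2 * (‖a e‖ ^ 2 + ∑ e ∈ s, ‖a e‖ ^ 2) := by linarith
    have e1 : K - 2 * ‖a e‖ ^ 2 - 2 * ∑ e ∈ s, ‖a e‖ ^ 2
      = K - 2 * (‖a e‖ ^ 2 + ∑ e ∈ s, ‖a e‖ ^ 2) := by ring
    rw [e1]
    have e2 : ‖a e‖ ^ 2 / K ≤ ‖a e‖ ^ 2 / (K - 2 * (‖a e‖ ^ 2 + ∑ e ∈ s, ‖a e‖ ^ 2)) := by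
      gcongr; linarith
    refine (add_le_add_left e2 _).trans (le_of_eq ?_)
    rw [← add_div]; ring_nf

/-- The same for sums with values in a finite family of Hilbert spaces. -/
lemma sum_exp_sum_norm_sq_rademacher_le {β : Type*} [Fintype β] (a : ι → β → H) {S : ℝ}
    (hS : 0 < S) (ha : ∑ e, ∑ b, ‖a e b‖ ^ 2 ≤ S) :
    ∑ τ : ι → ℤˣ, Real.exp ((∑ b, ‖∑ e, signVal (τ e) • a e b‖ ^ 2) / (4 * S))
      ≤ 2 * Fintype.card (ι → ℤˣ) := by
  have hn : ∀ e, ‖(WithLp.toLp 2 (a e) : PiLp 2 fun _ : β => H)‖ ^ 2 = ∑ b, ‖a e b‖ ^ 2 :=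
    fun e => PiLp.norm_sq_eq_of_L2 _ _
  -- The family is one vector of the ℓ² product. With K = 4S the exponent is at most S / (4S - 2S) =
  -- 1/2, and exp(1/2) ≤ 2.
  have h := sum_exp_norm_sq_rademacher_le (0 : PiLp 2 fun _ : β => H)
    (fun e => WithLp.toLp 2 (a e)) Finset.univ (K := 4 * S) (by simp only [hn]; linarith)
  have h0 : 0 ≤ ∑ e, ∑ b, ‖a e b‖ ^ 2 := by positivity
  refine ((le_of_eq ?_).trans h).trans ?_
  · refine Finset.sum_congr rfl fun τ _ => ?_
    congr 2
    rw [zero_add, PiLp.norm_sq_eq_of_L2]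
    refine Finset.sum_congr rfl fun b _ => ?_
    congr 2
    simp [WithLp.ofLp_sum]
  · simp only [hn]
    rw [mul_comm (2 : ℝ) (Fintype.card (ι → ℤˣ) : ℝ)]
    gcongr
    have : (‖(0 : PiLp 2 fun _ : β => H)‖ ^ 2 + ∑ e, ∑ b, ‖a e b‖ ^ 2)
        / (4 * S - 2 * ∑ e, ∑ b, ‖a e b‖ ^ 2) ≤ 1 / 2 := by
      rw [norm_zero, div_le_iff₀ (by linarith)]; linarith
    refine (Real.exp_le_exp.2 this).trans ?_
    have h2 : Real.exp (1 / 2) ^ 2 ≤ 2 ^ 2 := by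
      rw [← Real.exp_nat_mul]
      have := Real.exp_one_lt_d9
      norm_num at this ⊢; linarith
    exact (pow_le_pow_iff_left₀ (Real.exp_pos _).le (by norm_num) (by norm_num)).1 h2

/-- This is the p-th power of y ≤ exp y at y = x / (p l); it converts exponential moments into power
moments. -/
lemma pow_le_mul_exp_div {x l : ℝ} (hx : 0 ≤ x) (hl : 0 < l) (p : ℕ) :
    x ^ p ≤ (p * l) ^ p * Real.exp (x / l) := by
  rcases Nat.eq_zero_or_pos p with rfl | hp
  · simpa using Real.one_le_exp (by positivity)
  have hp' : (0 : ℝ) < p := by exact_mod_cast hp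
  have h1 : x / (p * l) ≤ Real.exp (x / (p * l)) := by
    have := Real.add_one_le_exp (x / (p * l)); linarith
  have h2 := pow_le_pow_left₀ (by positivity) h1 p
  rw [div_pow, div_le_iff₀ (by positivity), ← Real.exp_nat_mul] at h2
  refine h2.trans (le_of_eq ?_)
  rw [mul_comm]; congr 2; field_simp

/-- Moments of the squared norm of a Hilbert-space valued Rademacher sum. -/
lemma sum_pow_sum_norm_sq_rademacher_le {β : Type*} [Fintype β] (a : ι → β → H) {S : ℝ}
    (ha : ∑ e, ∑ b, ‖a e b‖ ^ 2 ≤ S) {p : ℕ} (hp : p ≠ 0) :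
    ∑ τ : ι → ℤˣ, (∑ b, ‖∑ e, signVal (τ e) • a e b‖ ^ 2) ^ p
      ≤ 2 * Fintype.card (ι → ℤˣ) * (4 * p * S) ^ p := by
  have h0 : 0 ≤ ∑ e, ∑ b, ‖a e b‖ ^ 2 := by positivity
  rcases (h0.trans ha).eq_or_lt with hS | hS
  · have hz : ∑ e, ∑ b, ‖a e b‖ ^ 2 = 0 := le_antisymm (ha.trans_eq hS.symm) h0
    have hz' : ∀ e b, a e b = 0 := by
      intro e b
      rw [Finset.sum_eq_zero_iff_of_nonneg (fun _ _ => by positivity)] at hz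
      have h1 := hz e (Finset.mem_univ _)
      rw [Finset.sum_eq_zero_iff_of_nonneg (fun _ _ => by positivity)] at h1
      simpa using h1 b (Finset.mem_univ _)
    rw [← hS]
    simp [hz', hp]
  · calc _ ≤ ∑ τ : ι → ℤˣ, (p * (4 * S)) ^ p
          * Real.exp ((∑ b, ‖∑ e, signVal (τ e) • a e b‖ ^ 2) / (4 * S)) :=
        Finset.sum_le_sum fun τ _ => pow_le_mul_exp_div (by positivity) (by positivity) p
      _ ≤ _ := by
        rw [← Finset.mul_sum]
        refine (mul_le_mul_of_nonneg_left (sum_exp_sum_norm_sq_rademacher_le a hS ha)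
          (by positivity)).trans (le_of_eq ?_)
        ring

end HilbertSum

/-! ### Trace inequalities for symmetric operators -/

/-- Factor a - b out of the difference of powers: each of the 2q + 1 remaining monomials has even
total degree 2q and is at most max(|a|, |b|)^(2q). -/
lemma sub_mul_odd_pow_sub_le (a b : ℝ) (q : ℕ) :
    (a - b) * (a ^ (2 * q + 1) - b ^ (2 * q + 1))
      ≤ (2 * q + 1) * ((a - b) ^ 2 * (a ^ (2 * q) + b ^ (2 * q))) := by
  have h1 : a ^ (2 * q + 1) - b ^ (2 * q + 1)
      = (a - b) * ∑ i ∈ Finset.range (2 * q + 1), a ^ i * b ^ (2 * q - i) := by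
    rw [mul_comm (a - b), ← (Commute.all a b).geom_sum₂_mul]
    rfl
  have h2 : ∑ i ∈ Finset.range (2 * q + 1), a ^ i * b ^ (2 * q - i)
      ≤ ∑ i ∈ Finset.range (2 * q + 1), (a ^ (2 * q) + b ^ (2 * q)) := by
    refine Finset.sum_le_sum fun i hi => ?_
    have hi' : i + (2 * q - i) = 2 * q := by
      have := Finset.mem_range.1 hi; omega
    have hev : Even (2 * q) := even_two_mul q
    calc a ^ i * b ^ (2 * q - i) ≤ |a| ^ i * |b| ^ (2 * q - i) := by
          rw [← abs_pow, ← abs_pow, ← abs_mul]; exact le_abs_self _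
      _ ≤ max |a| |b| ^ i * max |a| |b| ^ (2 * q - i) := by
          gcongr
          · exact le_max_left _ _
          · exact le_max_right _ _
      _ = max |a| |b| ^ (2 * q) := by rw [← pow_add, hi']
      _ ≤ |a| ^ (2 * q) + |b| ^ (2 * q) := by
          rcases max_cases |a| |b| with h | h <;> rw [h.1]
          · have : 0 ≤ |b| ^ (2 * q) := by positivity
            linarith
          · have : 0 ≤ |a| ^ (2 * q) := by positivity
            linarith
      _ = _ := by rw [hev.pow_abs, hev.pow_abs]
  rw [h1, ← mul_assoc, ← sq]
  calc _ ≤ (a - b) ^ 2 * ∑ i ∈ Finset.range (2 * q + 1), (a ^ (2 * q) + b ^ (2 * q)) := by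
        gcongr
    _ = _ := by
        rw [Finset.sum_const, Finset.card_range, nsmul_eq_mul]; push_cast; ring

section Trace

variable {H : Type*} [NormedAddCommGroup H] [InnerProductSpace ℝ H] [FiniteDimensional ℝ H]
  {X Y D : Module.End ℝ H}

lemma LinearMap.IsSymmetric.pow_apply_eigenvectorBasis (hX : X.IsSymmetric) (k : ℕ)
    (i : Fin (Module.finrank ℝ H)) :
    (X ^ k) (hX.eigenvectorBasis rfl i)
      = hX.eigenvalues rfl i ^ k • hX.eigenvectorBasis rfl i := by
  induction k with
  | zero => simp
  | succ k ih =>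
    rw [pow_succ', Module.End.mul_apply, ih, map_smul, hX.apply_eigenvectorBasis, smul_smul,
      pow_succ]
    simp

lemma LinearMap.IsSymmetric.inner_pow_apply_self (hX : X.IsSymmetric) (k : ℕ) (x : H) :
    inner ℝ x ((X ^ k) x)
      = ∑ i, hX.eigenvalues rfl i ^ k * inner ℝ (hX.eigenvectorBasis rfl i) x ^ 2 := by
  rw [← (hX.eigenvectorBasis rfl).sum_inner_mul_inner x]
  refine Finset.sum_congr rfl fun i _ => ?_
  rw [← (hX.pow k) (hX.eigenvectorBasis rfl i) x, hX.pow_apply_eigenvectorBasis,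
    real_inner_smul_left, real_inner_comm]
  ring

lemma LinearMap.IsSymmetric.trace_pow_mul (hX : X.IsSymmetric) (k : ℕ) (T : Module.End ℝ H) :
    LinearMap.trace ℝ H (X ^ k * T)
      = ∑ i, hX.eigenvalues rfl i ^ k
        * inner ℝ (hX.eigenvectorBasis rfl i) (T (hX.eigenvectorBasis rfl i)) := by
  rw [LinearMap.trace_eq_sum_inner _ (hX.eigenvectorBasis rfl)]
  refine Finset.sum_congr rfl fun i _ => ?_
  rw [Module.End.mul_apply, ← (hX.pow k), hX.pow_apply_eigenvectorBasis, real_inner_smul_left]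

lemma LinearMap.IsSymmetric.trace_pow (hX : X.IsSymmetric) (k : ℕ) :
    LinearMap.trace ℝ H (X ^ k) = ∑ i, hX.eigenvalues rfl i ^ k := by
  have h := hX.trace_pow_mul k 1
  rw [mul_one] at h
  simpa using h

/-- The weights ⟨f_j, e_i⟩² are nonnegative and independent of the exponents. Polynomial trace
inequalities for two noncommuting operators, in which the powers can be separated, therefore follow
from scalar inequalities at pairs of eigenvalues. -/
lemma LinearMap.IsSymmetric.trace_pow_mul_pow (hX : X.IsSymmetric) (hY : Y.IsSymmetric)
    (k l : ℕ) :
    LinearMap.trace ℝ H (X ^ k * Y ^ l)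
      = ∑ i, ∑ j, hX.eigenvalues rfl i ^ k * hY.eigenvalues rfl j ^ l
        * inner ℝ (hY.eigenvectorBasis rfl j) (hX.eigenvectorBasis rfl i) ^ 2 := by
  rw [hX.trace_pow_mul]
  refine Finset.sum_congr rfl fun i _ => ?_
  rw [hY.inner_pow_apply_self, Finset.mul_sum]
  exact Finset.sum_congr rfl fun j _ => by ring

lemma LinearMap.IsSymmetric.trace_sq_mul_pow (hX : X.IsSymmetric) (hD : D.IsSymmetric) (k : ℕ) :
    LinearMap.trace ℝ H (D ^ 2 * X ^ k)
      = ∑ i, hX.eigenvalues rfl i ^ k * ‖D (hX.eigenvectorBasis rfl i)‖ ^ 2 := by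
  rw [LinearMap.trace_mul_comm, hX.trace_pow_mul]
  refine Finset.sum_congr rfl fun i _ => ?_
  rw [sq, Module.End.mul_apply, ← hD, real_inner_self_eq_norm_sq]

/-- A mean value inequality for odd powers under the trace. -/
lemma trace_sub_mul_odd_pow_sub_le (hX : X.IsSymmetric) (hY : Y.IsSymmetric) (q : ℕ) :
    LinearMap.trace ℝ H ((X - Y) * (X ^ (2 * q + 1) - Y ^ (2 * q + 1)))
      ≤ (2 * q + 1) * (LinearMap.trace ℝ H ((X - Y) ^ 2 * X ^ (2 * q))
        + LinearMap.trace ℝ H ((X - Y) ^ 2 * Y ^ (2 * q))) := by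
  have p1 : ∀ Z : Module.End ℝ H, Z ^ (2 * q + 1) = Z * Z ^ (2 * q) := fun Z => pow_succ' _ _
  have p2 : ∀ Z : Module.End ℝ H, Z ^ (2 * q + 2) = Z * (Z * Z ^ (2 * q)) := fun Z => by
    rw [← p1, ← pow_succ']
  have hc := fun S T : Module.End ℝ H => LinearMap.trace_mul_comm ℝ S T
  have e1 : LinearMap.trace ℝ H ((X - Y) * (X ^ (2 * q + 1) - Y ^ (2 * q + 1)))
      = LinearMap.trace ℝ H (X ^ (2 * q + 2) * Y ^ 0) - LinearMap.trace ℝ H (X ^ 1 * Y ^ (2 * q + 1))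
        - LinearMap.trace ℝ H (X ^ (2 * q + 1) * Y ^ 1)
        + LinearMap.trace ℝ H (X ^ 0 * Y ^ (2 * q + 2)) := by
    rw [hc (X ^ (2 * q + 1)) (Y ^ 1), ← map_sub, ← map_sub, ← map_add]
    congr 1
    rw [p1, p1, p2, p2]
    generalize X ^ (2 * q) = U
    generalize Y ^ (2 * q) = V
    noncomm_ring
  have e2 : LinearMap.trace ℝ H ((X - Y) ^ 2 * X ^ (2 * q))
      = LinearMap.trace ℝ H (X ^ (2 * q + 2) * Y ^ 0)
        - 2 * LinearMap.trace ℝ H (X ^ (2 * q + 1) * Y ^ 1)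
        + LinearMap.trace ℝ H (X ^ (2 * q) * Y ^ 2) := by
    have a1 : (X - Y) ^ 2 * X ^ (2 * q) = X ^ (2 * q + 2) * Y ^ 0 - X * (Y * X ^ (2 * q))
        - Y ^ 1 * X ^ (2 * q + 1) + Y ^ 2 * X ^ (2 * q) := by
      rw [p1, p2]
      generalize X ^ (2 * q) = U
      noncomm_ring
    have a2 : LinearMap.trace ℝ H (X * (Y * X ^ (2 * q)))
        = LinearMap.trace ℝ H (Y ^ 1 * X ^ (2 * q + 1)) := by
      rw [hc, mul_assoc, ← pow_succ, pow_one]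
    rw [a1, map_add, map_sub, map_sub, a2, hc (Y ^ 1), hc (Y ^ 2)]
    ring
  have e3 : LinearMap.trace ℝ H ((X - Y) ^ 2 * Y ^ (2 * q))
      = LinearMap.trace ℝ H (X ^ 2 * Y ^ (2 * q))
        - 2 * LinearMap.trace ℝ H (X ^ 1 * Y ^ (2 * q + 1))
        + LinearMap.trace ℝ H (X ^ 0 * Y ^ (2 * q + 2)) := by
    have a1 : (X - Y) ^ 2 * Y ^ (2 * q) = X ^ 2 * Y ^ (2 * q) - X ^ 1 * Y ^ (2 * q + 1)
        - Y * (X * Y ^ (2 * q)) + X ^ 0 * Y ^ (2 * q + 2) := by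
      rw [p1, p2]
      generalize Y ^ (2 * q) = U
      noncomm_ring
    have a2 : LinearMap.trace ℝ H (Y * (X * Y ^ (2 * q)))
        = LinearMap.trace ℝ H (X ^ 1 * Y ^ (2 * q + 1)) := by
      rw [hc, mul_assoc, ← pow_succ, pow_one]
    rw [a1, map_add, map_sub, map_sub, a2]
    ring
  rw [e1, e2, e3]
  -- By cyclicity all traces are now combinations of tr(X^k Y^l), so the scalar inequality applies
  -- to each pair of eigenvalues.
  simp only [hX.trace_pow_mul_pow hY, Finset.mul_sum, ← Finset.sum_add_distrib,
    ← Finset.sum_sub_distrib]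
  refine Finset.sum_le_sum fun i _ => Finset.sum_le_sum fun j _ => ?_
  have h := mul_le_mul_of_nonneg_right
    (sub_mul_odd_pow_sub_le (hX.eigenvalues rfl i) (hY.eigenvalues rfl j) q)
    (sq_nonneg (inner ℝ (hY.eigenvectorBasis rfl j) (hX.eigenvectorBasis rfl i)))
  refine (le_of_eq ?_).trans (h.trans (le_of_eq ?_)) <;> ring

variable {ι : Type*} [Fintype ι] [DecidableEq ι]

/-- The first argument is odd under the flip, so only the odd half of `G` survives the average. -/
lemma sum_sub_flipAt_mul {M : Type*} [AddCommGroup M] (B : M → M → ℝ)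
    (hl : ∀ a b c, B (a - b) c = B a c - B b c) (hr : ∀ a b c, B a (b - c) = B a b - B a c)
    (e : ι) (F G : (ι → ℤˣ) → M) :
    ∑ τ, B (F τ - F (flipAt e τ)) (G τ)
      = ∑ τ, B (F τ - F (flipAt e τ)) (G τ - G (flipAt e τ)) / 2 := by
  rw [sum_eq_half_sum_add_flipAt e]
  refine Finset.sum_congr rfl fun τ _ => ?_
  rw [flipAt_flipAt]
  simp only [hl, hr]
  ring

/-- Moment recursion for an operator-valued Rademacher chaos of order two. -/
lemma sum_trace_pow_chaos_le (X : (ι → ℤˣ) → Module.End ℝ H) (hX : ∀ τ, (X τ).IsSymmetric)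
    (hhom : ∀ τ, (4 : ℝ) • X τ = ∑ e, (X τ - X (flipAt e τ))) (q : ℕ) :
    ∑ τ, LinearMap.trace ℝ H (X τ ^ (2 * q + 2))
      ≤ (2 * q + 1) / 4 * ∑ τ, ∑ i, (hX τ).eigenvalues rfl i ^ (2 * q)
        * ∑ e, ‖(X τ - X (flipAt e τ)) ((hX τ).eigenvectorBasis rfl i)‖ ^ 2 := by
  -- Homogeneity of degree two replaces one factor X by a quarter of the sum of its increments.
  have h1 : ∀ τ, LinearMap.trace ℝ H (X τ ^ (2 * q + 2))
      = 1 / 4 * ∑ e, LinearMap.trace ℝ H ((X τ - X (flipAt e τ)) * X τ ^ (2 * q + 1)) := by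
    intro τ
    rw [← map_sum, ← Finset.sum_mul, ← hhom, smul_mul_assoc, map_smul, ← pow_succ', smul_eq_mul]
    ring
  have h2 : ∀ e, ∑ τ, LinearMap.trace ℝ H ((X τ - X (flipAt e τ)) * X τ ^ (2 * q + 1))
      ≤ ∑ τ, (2 * q + 1) * LinearMap.trace ℝ H ((X τ - X (flipAt e τ)) ^ 2 * X τ ^ (2 * q)) := by
    intro e
    rw [sum_sub_flipAt_mul (fun S T => LinearMap.trace ℝ H (S * T))
      (fun a b c => by simp [sub_mul]) (fun a b c => by simp [mul_sub]) e X
      (fun τ => X τ ^ (2 * q + 1))]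
    -- The right side is symmetrized too, because the mean value inequality produces one term at τ
    -- and one at its flip.
    rw [sum_eq_half_sum_add_flipAt e (fun τ =>
      (2 * q + 1) * LinearMap.trace ℝ H ((X τ - X (flipAt e τ)) ^ 2 * X τ ^ (2 * q)))]
    refine Finset.sum_le_sum fun τ _ => ?_
    have h := trace_sub_mul_odd_pow_sub_le (hX τ) (hX (flipAt e τ)) q
    have h3 : (X (flipAt e τ) - X τ) ^ 2 = (X τ - X (flipAt e τ)) ^ 2 := by
      rw [← neg_sub, neg_sq]
    rw [flipAt_flipAt, h3]
    linarith
  have h3 : ∀ τ, ∑ i, (hX τ).eigenvalues rfl i ^ (2 * q)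
        * ∑ e, ‖(X τ - X (flipAt e τ)) ((hX τ).eigenvectorBasis rfl i)‖ ^ 2
      = ∑ e, LinearMap.trace ℝ H ((X τ - X (flipAt e τ)) ^ 2 * X τ ^ (2 * q)) := by
    intro τ
    simp only [Finset.mul_sum]
    rw [Finset.sum_comm]
    refine Finset.sum_congr rfl fun e _ => ?_
    rw [(hX τ).trace_sq_mul_pow ((hX τ).sub (hX _))]
  simp only [h1, h3]
  rw [← Finset.mul_sum, Finset.sum_comm]
  calc _ ≤ 1 / 4 * ∑ e, ∑ τ, (2 * q + 1)
        * LinearMap.trace ℝ H ((X τ - X (flipAt e τ)) ^ 2 * X τ ^ (2 * q)) := by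
        exact mul_le_mul_of_nonneg_left (Finset.sum_le_sum fun e _ => h2 e) (by norm_num)
    _ = _ := by
        rw [Finset.sum_comm]
        simp only [← Finset.mul_sum]
        ring

end Trace

/-! ### The moment recursion for vectors. -/

section Vector

variable {H : Type*} [NormedAddCommGroup H] [InnerProductSpace ℝ H]
  {ι : Type*} [Fintype ι] [DecidableEq ι]

/-- Beyond the scalar inequality for the norms there is only the Cauchy–Schwarz defect ‖a‖‖b‖ - ⟨a,
b⟩ ≥ 0. It occurs once on the left, and 2(2q + 1) times on the right. -/
lemma inner_sub_norm_pow_smul_sub_le (a b : H) (q : ℕ) :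
    inner ℝ (a - b) (‖a‖ ^ (2 * q) • a - ‖b‖ ^ (2 * q) • b)
      ≤ (2 * q + 1) * (‖a - b‖ ^ 2 * (‖a‖ ^ (2 * q) + ‖b‖ ^ (2 * q))) := by
  have h := sub_mul_odd_pow_sub_le ‖a‖ ‖b‖ q
  have e1 : inner ℝ (a - b) (‖a‖ ^ (2 * q) • a - ‖b‖ ^ (2 * q) • b)
      = (‖a‖ - ‖b‖) * (‖a‖ ^ (2 * q + 1) - ‖b‖ ^ (2 * q + 1))
        + (‖a‖ * ‖b‖ - inner ℝ a b) * (‖a‖ ^ (2 * q) + ‖b‖ ^ (2 * q)) := by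
    simp only [inner_sub_left, inner_sub_right, real_inner_smul_right, real_inner_self_eq_norm_sq,
      real_inner_comm a b]
    ring
  have e2 : ‖a - b‖ ^ 2 = (‖a‖ - ‖b‖) ^ 2 + 2 * (‖a‖ * ‖b‖ - inner ℝ a b) := by
    rw [norm_sub_sq_real]; ring
  have h0 : 0 ≤ ‖a‖ * ‖b‖ - inner ℝ a b := by linarith [real_inner_le_norm a b]
  have h1 : 0 ≤ ‖a‖ ^ (2 * q) + ‖b‖ ^ (2 * q) := by positivity
  have h2 : 0 ≤ (‖a‖ * ‖b‖ - inner ℝ a b) * (‖a‖ ^ (2 * q) + ‖b‖ ^ (2 * q)) := mul_nonneg h0 h1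
  have h3 : 0 ≤ (q : ℝ) * ((‖a‖ * ‖b‖ - inner ℝ a b) * (‖a‖ ^ (2 * q) + ‖b‖ ^ (2 * q))) := by
    positivity
  rw [e1, e2]
  linarith

/-- Moment recursion for a vector-valued Rademacher chaos of order two. -/
lemma sum_norm_pow_chaos_le (w : (ι → ℤˣ) → H)
    (hhom : ∀ τ, (4 : ℝ) • w τ = ∑ e, (w τ - w (flipAt e τ))) (q : ℕ) :
    ∑ τ, ‖w τ‖ ^ (2 * q + 2)
      ≤ (2 * q + 1) / 4 * ∑ τ, ‖w τ‖ ^ (2 * q) * ∑ e, ‖w τ - w (flipAt e τ)‖ ^ 2 := by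
  have h1 : ∀ τ, ‖w τ‖ ^ (2 * q + 2)
      = 1 / 4 * ∑ e, inner ℝ (w τ - w (flipAt e τ)) (‖w τ‖ ^ (2 * q) • w τ) := by
    intro τ
    rw [← sum_inner, ← hhom, real_inner_smul_left, real_inner_smul_right,
      real_inner_self_eq_norm_sq]
    ring
  have h2 : ∀ e, ∑ τ, inner ℝ (w τ - w (flipAt e τ)) (‖w τ‖ ^ (2 * q) • w τ)
      ≤ ∑ τ, (2 * q + 1) * (‖w τ - w (flipAt e τ)‖ ^ 2 * ‖w τ‖ ^ (2 * q)) := by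
    intro e
    rw [sum_sub_flipAt_mul (fun S T : H => inner ℝ S T)
      (fun a b c => inner_sub_left _ _ _) (fun a b c => inner_sub_right _ _ _) e w
      (fun τ => ‖w τ‖ ^ (2 * q) • w τ)]
    rw [sum_eq_half_sum_add_flipAt e (fun τ =>
      (2 * q + 1) * (‖w τ - w (flipAt e τ)‖ ^ 2 * ‖w τ‖ ^ (2 * q)))]
    refine Finset.sum_le_sum fun τ _ => ?_
    have h := inner_sub_norm_pow_smul_sub_le (w τ) (w (flipAt e τ)) q
    rw [flipAt_flipAt, norm_sub_rev (w (flipAt e τ)) (w τ)]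
    linarith
  simp only [h1]
  rw [← Finset.mul_sum, Finset.sum_comm]
  calc _ ≤ 1 / 4 * ∑ e, ∑ τ, (2 * q + 1) * (‖w τ - w (flipAt e τ)‖ ^ 2 * ‖w τ‖ ^ (2 * q)) := by
        exact mul_le_mul_of_nonneg_left (Finset.sum_le_sum fun e _ => h2 e) (by norm_num)
    _ = _ := by
        rw [Finset.sum_comm]
        simp only [← Finset.mul_sum, mul_comm (‖w _‖ ^ (2 * q)), Finset.sum_mul]
        ring

end Vector

/-! ### The sparse sign chaos for a fixed sparsity pattern -/


section Pattern

variable {I J : Type*} [Fintype I] [Fintype J] [DecidableEq I] [DecidableEq J]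
  {K : Type*} [NormedAddCommGroup K] [InnerProductSpace ℝ K]

/-- The signed entries of a `0/1` pattern whose `j`-th column has support `d j`. -/
def signEntry (d : J → Finset I) (τ : I × J → ℤˣ) (i : I) (j : J) : ℝ :=
  if i ∈ d j then signVal (τ (i, j)) else 0

/-- The `i`-th row of the signed pattern, applied to the vectors `a`. -/
def signRow (d : J → Finset I) (τ : I × J → ℤˣ) (a : J → K) (i : I) : K :=
  ∑ j, signEntry d τ i j • a j

/-- The `i`-th row of the signed pattern without its `j`-th entry, applied to `a`. -/
def signRowErase (d : J → Finset I) (τ : I × J → ℤˣ) (a : J → K) (i : I) (j : J) : K :=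
  signRow d τ a i - signEntry d τ i j • a j

lemma signEntry_sq (d : J → Finset I) (τ : I × J → ℤˣ) (i : I) (j : J) :
    signEntry d τ i j ^ 2 = if i ∈ d j then 1 else 0 := by
  unfold signEntry; split_ifs <;> simp [signVal_sq]

lemma signRow_flipAt (d : J → Finset I) (τ : I × J → ℤˣ) (a : J → K) (i i' : I) (j : J) :
    signRow d (flipAt (i, j) τ) a i'
      = signRow d τ a i' - if i' = i then (2 * signEntry d τ i j) • a j else 0 := by
  unfold signRow
  rw [eq_sub_iff_add_eq]
  have : (if i' = i then (2 * signEntry d τ i j) • a j else 0)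
      = ∑ k, if k = j then (if i' = i then (2 * signEntry d τ i j) • a j else 0) else 0 := by
    simp
  rw [this, ← Finset.sum_add_distrib]
  refine Finset.sum_congr rfl fun k _ => ?_
  by_cases hi : i' = i
  · by_cases hk : k = j
    · subst hi hk
      simp only [signEntry, flipAt_same, signVal_neg, if_true]
      rw [← add_smul]
      congr 1
      split_ifs <;> ring
    · have : ((i', k) : I × J) ≠ (i, j) := fun h => hk (Prod.ext_iff.1 h).2
      simp [signEntry, flipAt_of_ne this, hk]
  · have : ((i', k) : I × J) ≠ (i, j) := fun h => hi (Prod.ext_iff.1 h).1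
    simp [signEntry, flipAt_of_ne this, hi]

lemma inner_signRow (d : J → Finset I) (τ : I × J → ℤˣ) (a : J → K) (i : I) (x : K) :
    inner ℝ (signRow d τ a i) x = signRow d τ (fun j => inner ℝ (a j) x) i := by
  simp [signRow, sum_inner, real_inner_smul_left]

/-- The weighted overlap of column `j` with the other columns. -/
def overlap (d : J → Finset I) (a : J → K) (j : J) : ℝ :=
  ∑ k, if k = j then 0 else ‖a k‖ ^ 2 * (d j ∩ d k).card

lemma overlap_nonneg (d : J → Finset I) (a : J → K) (j : J) : 0 ≤ overlap d a j :=
  Finset.sum_nonneg fun k _ => by split_ifs <;> positivity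

/-- The intersection sizes are symmetric in the two columns. This lets both halves of the squared
increments be measured by the same overlap sum. -/
lemma sum_mul_overlap_comm {K' : Type*} [NormedAddCommGroup K'] [InnerProductSpace ℝ K']
    (d : J → Finset I) (a : J → K) (b : J → K') :
    ∑ j, ‖b j‖ ^ 2 * overlap d a j = ∑ j, ‖a j‖ ^ 2 * overlap d b j := by
  simp only [overlap, Finset.mul_sum]
  rw [Finset.sum_comm]
  refine Finset.sum_congr rfl fun j _ => Finset.sum_congr rfl fun k _ => ?_
  by_cases h : j = k
  · simp [h]
  · rw [if_neg h, if_neg (fun h' => h h'.symm), Finset.inter_comm]; ring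

/-- The inner quantity is the squared ℓ² norm of a single Rademacher sum, with one component for
each position (i, j) of the pattern. Erasing the entry j from row i removes the diagonal, so its
variance is exactly the overlap sum. -/
lemma sum_pow_signRowErase_le (d : J → Finset I) (a : J → K) (c : J → ℝ) {p : ℕ} (hp : p ≠ 0) :
    ∑ τ : I × J → ℤˣ, (∑ j, ∑ i, if i ∈ d j then c j ^ 2 * ‖signRowErase d τ a i j‖ ^ 2 else 0) ^ p
      ≤ 2 * Fintype.card (I × J → ℤˣ) * (4 * p * ∑ j, c j ^ 2 * overlap d a j) ^ p := by
  -- The sign at e = (i, k) acts on the component b = (i, j) when k ≠ j and both entries lie in the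
  -- pattern.
  let A : I × J → I × J → K := fun e b =>
    if e.1 = b.1 ∧ e.2 ≠ b.2 ∧ b.1 ∈ d b.2 ∧ b.1 ∈ d e.2 then c b.2 • a e.2 else 0
  have hA : ∑ e, ∑ b, ‖A e b‖ ^ 2 = ∑ j, c j ^ 2 * overlap d a j := by
    rw [Finset.sum_comm, Fintype.sum_prod_type, Finset.sum_comm]
    refine Finset.sum_congr rfl fun j _ => ?_
    unfold overlap
    rw [Finset.mul_sum]
    simp only [Fintype.sum_prod_type]
    have h1 : ∀ i, ∑ i', ∑ k, ‖A (i', k) (i, j)‖ ^ 2 = ∑ k, ‖A (i, k) (i, j)‖ ^ 2 := by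
      intro i
      rw [Finset.sum_eq_single i]
      · intro i' _ hi'
        simp [A, hi']
      · simp
    simp only [h1]
    rw [Finset.sum_comm]
    refine Finset.sum_congr rfl fun k _ => ?_
    by_cases hk : k = j
    · simp [A, hk]
    · have h2 : ∀ i, ‖A (i, k) (i, j)‖ ^ 2
          = if i ∈ d j ∩ d k then c j ^ 2 * ‖a k‖ ^ 2 else 0 := by
        intro i
        by_cases h : i ∈ d j ∧ i ∈ d k
        · simp [A, hk, h, norm_smul, mul_pow]
        · simp only [A, ne_eq, hk, not_false_eq_true, true_and, h, Finset.mem_inter, if_false]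
          simp
      simp only [h2, if_neg hk]
      rw [Finset.sum_ite_mem, Finset.univ_inter, Finset.sum_const, nsmul_eq_mul]
      ring
  rw [← hA]
  refine (le_of_eq ?_).trans (sum_pow_sum_norm_sq_rademacher_le A le_rfl hp)
  refine Finset.sum_congr rfl fun τ _ => ?_
  congr 1
  rw [Fintype.sum_prod_type, Finset.sum_comm]
  refine Finset.sum_congr rfl fun i _ => Finset.sum_congr rfl fun j _ => ?_
  rw [Fintype.sum_prod_type, Finset.sum_eq_single i]
  · by_cases hj : i ∈ d j
    · have h3 : ∑ k, signVal (τ (i, k)) • A (i, k) (i, j) = c j • signRowErase d τ a i j := by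
        unfold signRowErase signRow
        rw [sub_eq_add_neg, smul_add, Finset.smul_sum, ← sub_eq_zero, ← sub_sub,
          ← Finset.sum_sub_distrib, Finset.sum_eq_single j]
        · simp [A, smul_smul]
        · intro k _ hk
          by_cases hik : i ∈ d k
          · simp [A, hk, hik, hj, signEntry, smul_smul, mul_comm]
          · simp [A, hik, signEntry]
        · simp
      rw [if_pos hj, h3, norm_smul, mul_pow]
      simp
    · simp [A, hj]
  · intro i' _ hi'
    simp [A, hi']
  · simp

/-- The centred bilinear chaos `s⁻¹ ∑ᵢ (row i of α) (row i of u) - ∑ⱼ αⱼ uⱼ`. -/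
noncomputable def sketchChaos (d : J → Finset I) (s : ℝ) (α : J → ℝ) (u : J → K)
    (τ : I × J → ℤˣ) : K :=
  s⁻¹ • ∑ i, signRow d τ α i • signRow d τ u i - ∑ j, α j • u j

lemma sketchChaos_sub_flipAt (d : J → Finset I) (s : ℝ) (α : J → ℝ) (u : J → K)
    (τ : I × J → ℤˣ) (i : I) (j : J) :
    sketchChaos d s α u τ - sketchChaos d s α u (flipAt (i, j) τ)
      = (2 * s⁻¹ * signEntry d τ i j)
        • (α j • signRowErase d τ u i j + signRowErase d τ α i j • u j) := by
  unfold sketchChaos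
  rw [sub_sub_sub_cancel_right, ← smul_sub, ← Finset.sum_sub_distrib, Finset.sum_eq_single i]
  · simp only [signRow_flipAt, if_true, signRowErase, smul_eq_mul]
    module
  · intro i' _ hi'
    simp [signRow_flipAt, hi']
  · simp

/-- The exact column sum `s` makes the diagonal part of the quadratic form equal to its centring.
Each remaining monomial contains two distinct signs, and flipping either of them changes it by twice
itself: 2 · 2 = 4. -/
lemma four_smul_sketchChaos (d : J → Finset I) {s : ℕ} (hs : s ≠ 0) (hd : ∀ j, (d j).card = s)
    (α : J → ℝ) (u : J → K) (τ : I × J → ℤˣ) :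
    (4 : ℝ) • sketchChaos d s α u τ
      = ∑ e, (sketchChaos d s α u τ - sketchChaos d s α u (flipAt e τ)) := by
  have hs' : (s : ℝ) ≠ 0 := by exact_mod_cast hs
  have h1 : ∀ i j, sketchChaos d s α u τ - sketchChaos d s α u (flipAt (i, j) τ)
      = ((2 * (s : ℝ)⁻¹) • ((signEntry d τ i j • α j) • signRow d τ u i
          + signRow d τ α i • signEntry d τ i j • u j))
        - (4 * (s : ℝ)⁻¹) • (if i ∈ d j then α j • u j else 0) := by
    intro i j
    rw [sketchChaos_sub_flipAt]
    have h2 : (if i ∈ d j then α j • u j else 0) = (signEntry d τ i j ^ 2) • α j • u j := by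
      rw [signEntry_sq]; split_ifs <;> simp
    rw [h2]
    simp only [signRowErase, smul_eq_mul]
    module
  have h3 : ∑ i, ∑ j, (if i ∈ d j then α j • u j else 0) = (s : ℝ) • ∑ j, α j • u j := by
    rw [Finset.sum_comm, Finset.smul_sum]
    refine Finset.sum_congr rfl fun j _ => ?_
    rw [Finset.sum_ite_mem, Finset.univ_inter, Finset.sum_const, hd, Nat.cast_smul_eq_nsmul]
  rw [Fintype.sum_prod_type]
  simp only [h1, Finset.sum_sub_distrib, ← Finset.smul_sum, h3, Finset.sum_add_distrib,
    ← Finset.sum_smul]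
  change _ = (2 * (s : ℝ)⁻¹) • (∑ i, signRow d τ α i • signRow d τ u i
    + ∑ i, signRow d τ α i • signRow d τ u i) - _
  unfold sketchChaos
  rw [smul_smul, mul_assoc, inv_mul_cancel₀ hs', mul_one]
  module

lemma norm_sketchChaos_sub_flipAt_sq_le (d : J → Finset I) (s : ℝ) (α : J → ℝ) (u : J → K)
    (τ : I × J → ℤˣ) (i : I) (j : J) :
    ‖sketchChaos d s α u τ - sketchChaos d s α u (flipAt (i, j) τ)‖ ^ 2
      ≤ 8 / s ^ 2 * ((if i ∈ d j then α j ^ 2 * ‖signRowErase d τ u i j‖ ^ 2 else 0)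
        + (if i ∈ d j then ‖u j‖ ^ 2 * ‖signRowErase d τ α i j‖ ^ 2 else 0)) := by
  have h1 : ‖α j • signRowErase d τ u i j + signRowErase d τ α i j • u j‖ ^ 2
      ≤ 2 * (α j ^ 2 * ‖signRowErase d τ u i j‖ ^ 2 + ‖u j‖ ^ 2 * ‖signRowErase d τ α i j‖ ^ 2) := by
    have h := norm_add_le (α j • signRowErase d τ u i j) (signRowErase d τ α i j • u j)
    have h2 := pow_le_pow_left₀ (norm_nonneg _) h 2
    rw [norm_smul, norm_smul] at h2
    have h3 : α j ^ 2 = ‖α j‖ ^ 2 := by simp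
    rw [h3]
    nlinarith [sq_nonneg (‖α j‖ * ‖signRowErase d τ u i j‖ - ‖signRowErase d τ α i j‖ * ‖u j‖)]
  rw [sketchChaos_sub_flipAt, norm_smul, mul_pow, Real.norm_eq_abs, sq_abs, mul_pow, signEntry_sq]
  split_ifs with h
  · calc _ ≤ (2 * s⁻¹) ^ 2 * 1 * (2 * (α j ^ 2 * ‖signRowErase d τ u i j‖ ^ 2
          + ‖u j‖ ^ 2 * ‖signRowErase d τ α i j‖ ^ 2)) := by gcongr
      _ = _ := by ring
  · simp

/-- A crude Young inequality, by comparing t / c with y. The free constant c fixes which share of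
the moment of y is to be absorbed later. -/
lemma mul_pow_le_young {t y c : ℝ} (ht : 0 ≤ t) (hy : 0 ≤ y) (hc : 0 < c) (q : ℕ) :
    t * y ^ q ≤ c * ((t / c) ^ (q + 1) + y ^ (q + 1)) := by
  have ht' : t = c * (t / c) := by field_simp
  have h0 : 0 ≤ t / c := by positivity
  generalize t / c = a at *
  subst ht'
  rw [mul_assoc]
  refine mul_le_mul_of_nonneg_left ?_ hc.le
  rcases le_total a y with h | h
  · have : a * y ^ q ≤ y * y ^ q := by gcongr
    have h1 : 0 ≤ a ^ (q + 1) := by positivity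
    rw [pow_succ' y]; linarith
  · have : a * y ^ q ≤ a * a ^ q := by gcongr
    have h1 : 0 ≤ y ^ (q + 1) := by positivity
    rw [pow_succ' a]; linarith

/-- Moment bound for the norm of the vector-valued chaos. -/
lemma sum_norm_sketchChaos_pow_le (d : J → Finset I) {s : ℕ} (hs : s ≠ 0)
    (hd : ∀ j, (d j).card = s) (α : J → ℝ) (u : J → K) (q : ℕ) :
    ∑ τ, ‖sketchChaos d s α u τ‖ ^ (2 * (q + 1))
      ≤ 2 * Fintype.card (I × J → ℤˣ)
        * (64 * (q + 1) ^ 2 * (∑ j, α j ^ 2 * overlap d u j) / s ^ 2) ^ (q + 1) := by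
  have hs' : (0 : ℝ) < s := by exact_mod_cast Nat.pos_of_ne_zero hs
  have hq : (0 : ℝ) ≤ q := q.cast_nonneg
  set p : ℝ := (q : ℝ) + 1 with hp
  have hp0 : p ≠ 0 := by positivity
  set S := ∑ j, α j ^ 2 * overlap d u j with hS
  set N : ℝ := (Fintype.card (I × J → ℤˣ) : ℝ)
  let T1 : (I × J → ℤˣ) → ℝ := fun τ =>
    ∑ j, ∑ i, if i ∈ d j then α j ^ 2 * ‖signRowErase d τ u i j‖ ^ 2 else 0
  let T2 : (I × J → ℤˣ) → ℝ := fun τ =>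
    ∑ j, ∑ i, if i ∈ d j then ‖u j‖ ^ 2 * ‖signRowErase d τ α i j‖ ^ 2 else 0
  have hT1 : ∀ τ, 0 ≤ T1 τ := fun τ => Finset.sum_nonneg fun j _ => Finset.sum_nonneg fun i _ => by
    split_ifs <;> positivity
  have hT2 : ∀ τ, 0 ≤ T2 τ := fun τ => Finset.sum_nonneg fun j _ => Finset.sum_nonneg fun i _ => by
    split_ifs <;> positivity
  have m1 : ∑ τ, T1 τ ^ (q + 1) ≤ 2 * N * (4 * p * S) ^ (q + 1) := by
    have := sum_pow_signRowErase_le d u α (Nat.succ_ne_zero q)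
    push_cast at this
    exact this
  have m2 : ∑ τ, T2 τ ^ (q + 1) ≤ 2 * N * (4 * p * S) ^ (q + 1) := by
    have := sum_pow_signRowErase_le d α (fun j => ‖u j‖) (Nat.succ_ne_zero q)
    push_cast at this
    rw [sum_mul_overlap_comm d α u] at this
    simp only [Real.norm_eq_abs, sq_abs] at this
    rw [hS]
    simpa only [T2, Real.norm_eq_abs, sq_abs] using this
  have h1 := sum_norm_pow_chaos_le (sketchChaos d s α u) (four_smul_sketchChaos d hs hd α u) q
  have hV : ∀ τ, ∑ e, ‖sketchChaos d s α u τ - sketchChaos d s α u (flipAt e τ)‖ ^ 2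
      ≤ 8 / s ^ 2 * (T1 τ + T2 τ) := by
    intro τ
    rw [Fintype.sum_prod_type, Finset.sum_comm]
    simp only [T1, T2, ← Finset.sum_add_distrib, Finset.mul_sum]
    exact Finset.sum_le_sum fun j _ => Finset.sum_le_sum fun i _ =>
      norm_sketchChaos_sub_flipAt_sq_le d s α u τ i j
  -- The Young constant is chosen so that 4p/s² · c = 1/4. The two halves of the increments together
  -- then cost 1/2 of the moment on the left.
  have hc : 0 < (s : ℝ) ^ 2 / (16 * p) := by positivity
  have h2 : ∀ τ, (2 * q + 1) / 4 * (‖sketchChaos d s α u τ‖ ^ (2 * q)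
        * ∑ e, ‖sketchChaos d s α u τ - sketchChaos d s α u (flipAt e τ)‖ ^ 2)
      ≤ 1 / 4 * (16 * p / s ^ 2) ^ (q + 1) * (T1 τ ^ (q + 1) + T2 τ ^ (q + 1))
        + 1 / 2 * ‖sketchChaos d s α u τ‖ ^ (2 * (q + 1)) := by
    intro τ
    set y := ‖sketchChaos d s α u τ‖
    have hy : 0 ≤ y := norm_nonneg _
    have a1 := mul_pow_le_young (hT1 τ) (sq_nonneg y) hc q
    have a2 := mul_pow_le_young (hT2 τ) (sq_nonneg y) hc q
    calc _ ≤ p / 2 * (y ^ (2 * q) * (8 / s ^ 2 * (T1 τ + T2 τ))) := by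
          have := hV τ
          gcongr ?_ * (_ * ?_)
          rw [hp]; linarith
      _ = 4 * p / s ^ 2 * (T1 τ * (y ^ 2) ^ q + T2 τ * (y ^ 2) ^ q) := by ring
      _ ≤ 4 * p / s ^ 2 * (s ^ 2 / (16 * p) * ((T1 τ / (s ^ 2 / (16 * p))) ^ (q + 1)
            + (y ^ 2) ^ (q + 1))
          + s ^ 2 / (16 * p) * ((T2 τ / (s ^ 2 / (16 * p))) ^ (q + 1) + (y ^ 2) ^ (q + 1))) := by
          gcongr
      _ = _ := by
          have e1 : ∀ t : ℝ, t / (s ^ 2 / (16 * p)) = 16 * p / s ^ 2 * t := by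
            intro t; field_simp
          have e2 : 4 * p / s ^ 2 * (s ^ 2 / (16 * p)) = 1 / 4 := by field_simp; norm_num
          rw [e1, e1, mul_add, ← mul_assoc, ← mul_assoc, e2, mul_pow, mul_pow, ← pow_mul]
          ring
  have h3 : ∑ τ, ‖sketchChaos d s α u τ‖ ^ (2 * (q + 1))
      ≤ 1 / 4 * (16 * p / s ^ 2) ^ (q + 1) * (∑ τ, T1 τ ^ (q + 1) + ∑ τ, T2 τ ^ (q + 1))
        + 1 / 2 * ∑ τ, ‖sketchChaos d s α u τ‖ ^ (2 * (q + 1)) := by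
    rw [← Finset.sum_add_distrib, Finset.mul_sum, Finset.mul_sum, ← Finset.sum_add_distrib]
    refine (h1.trans_eq (Finset.mul_sum _ _ _)).trans (Finset.sum_le_sum fun τ _ => h2 τ)
  have h4 : 1 / 4 * (16 * p / s ^ 2) ^ (q + 1) * (∑ τ, T1 τ ^ (q + 1) + ∑ τ, T2 τ ^ (q + 1))
      ≤ 1 / 4 * (16 * p / s ^ 2) ^ (q + 1) * (2 * N * (4 * p * S) ^ (q + 1)
        + 2 * N * (4 * p * S) ^ (q + 1)) := by
    gcongr
  have h5 : 1 / 4 * (16 * p / s ^ 2) ^ (q + 1) * (2 * N * (4 * p * S) ^ (q + 1)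
        + 2 * N * (4 * p * S) ^ (q + 1)) = N * (64 * p ^ 2 * S / s ^ 2) ^ (q + 1) := by
    have : 64 * p ^ 2 * S / s ^ 2 = (16 * p / s ^ 2) * (4 * p * S) := by ring
    rw [this]
    generalize 16 * p / (s : ℝ) ^ 2 = x
    generalize 4 * p * S = y
    rw [mul_pow]; ring
  linarith

end Pattern

/-! ### Trace moments of the embedding error. -/

section Operator

variable {I J : Type*} [Fintype I] [Fintype J] [DecidableEq I] [DecidableEq J]
  {H : Type*} [NormedAddCommGroup H] [InnerProductSpace ℝ H]

/-- The operator `s⁻¹ ∑ᵢ vᵢ ⊗ vᵢ - 1`, with `vᵢ` the rows of the signed pattern applied to `u`. -/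
noncomputable def sketchOp (d : J → Finset I) (s : ℝ) (u : J → H) (τ : I × J → ℤˣ) :
    Module.End ℝ H :=
  s⁻¹ • ∑ i, (innerₛₗ ℝ (signRow d τ u i)).smulRight (signRow d τ u i) - 1

lemma sketchOp_apply' (d : J → Finset I) (s : ℝ) (u : J → H) (τ : I × J → ℤˣ) (x : H) :
    sketchOp d s u τ x
      = s⁻¹ • ∑ i, inner ℝ (signRow d τ u i) x • signRow d τ u i - x := by
  simp [sketchOp]

/-- By the Parseval identity the operator at x is the vector chaos with coefficients ⟨u_j, x⟩, so
increments and homogeneity need to be computed only once. -/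
lemma sketchOp_apply (d : J → Finset I) (s : ℝ) {u : J → H}
    (hu : ∀ x, ∑ j, inner ℝ (u j) x • u j = x) (τ : I × J → ℤˣ) (x : H) :
    sketchOp d s u τ x = sketchChaos d s (fun j => inner ℝ (u j) x) u τ := by
  rw [sketchOp_apply', sketchChaos, hu]
  simp only [inner_signRow]

lemma sketchOp_isSymmetric (d : J → Finset I) (s : ℝ) (u : J → H) (τ : I × J → ℤˣ) :
    (sketchOp d s u τ).IsSymmetric := by
  intro x y
  simp only [sketchOp_apply', inner_sub_left, inner_sub_right, real_inner_smul_left,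
    real_inner_smul_right, sum_inner, inner_sum]
  congr 2
  refine Finset.sum_congr rfl fun i _ => ?_
  rw [real_inner_comm x]
  ring

lemma inner_sketchOp_self (d : J → Finset I) {s : ℝ} (hs : s ≠ 0) (u : J → H) (τ : I × J → ℤˣ)
    (x : H) :
    ∑ i, inner ℝ (signRow d τ u i) x ^ 2 = s * (‖x‖ ^ 2 + inner ℝ x (sketchOp d s u τ x)) := by
  rw [sketchOp_apply', inner_sub_right, real_inner_self_eq_norm_sq, real_inner_smul_right,
    inner_sum]
  simp only [real_inner_smul_right, real_inner_comm x, ← sq]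
  field_simp
  ring

variable {d : J → Finset I} {s : ℕ} {u : J → H} {R : ℝ}

lemma sum_inner_sq_of_frame (hu : ∀ x, ∑ j, inner ℝ (u j) x • u j = x) (x : H) :
    ∑ j, inner ℝ (u j) x ^ 2 = ‖x‖ ^ 2 := by
  have h := congrArg (fun y => inner ℝ y x) (hu x)
  simp only [sum_inner, real_inner_smul_left] at h
  rw [← real_inner_self_eq_norm_sq, ← h]
  exact Finset.sum_congr rfl fun j _ => sq _

/-- An increment pairs a coefficient with an erased row in two ways. When the row carries ⟨u_j, x⟩,
the weights ‖u_j‖² sum to at most `R` along each row, while the row energies sum to s(‖x‖² + ⟨x,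
Xx⟩): this half is bounded by the operator itself. The other half is kept, as a Rademacher sum to be
treated by its moments. -/
lemma sum_norm_sketchOp_sub_flipAt_sq_le (hs : s ≠ 0)
    (hd : ∀ j, (d j).card = s) (hu : ∀ x, ∑ j, inner ℝ (u j) x • u j = x)
    (hR : ∀ i, ∑ j, (if i ∈ d j then ‖u j‖ ^ 2 else 0) ≤ R) (τ : I × J → ℤˣ) (x : H) :
    ∑ e, ‖(sketchOp d s u τ - sketchOp d s u (flipAt e τ)) x‖ ^ 2
      ≤ 16 * R / s * (2 * ‖x‖ ^ 2 + inner ℝ x (sketchOp d s u τ x))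
        + 8 / s ^ 2 * ∑ j, inner ℝ (u j) x ^ 2
          * ∑ i, (if i ∈ d j then ‖signRowErase d τ u i j‖ ^ 2 else 0) := by
  have hs' : (0 : ℝ) < s := by exact_mod_cast Nat.pos_of_ne_zero hs
  have hx : ∑ j, inner ℝ (u j) x ^ 2 = ‖x‖ ^ 2 := sum_inner_sq_of_frame hu x
  set α : J → ℝ := fun j => inner ℝ (u j) x with hα
  have huR : ∀ i j, i ∈ d j → ‖u j‖ ^ 2 ≤ R := fun i j hij => by
    refine le_trans ?_ (hR i)
    have := Finset.single_le_sum (f := fun j => if i ∈ d j then ‖u j‖ ^ 2 else 0)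
      (fun j _ => by split_ifs <;> positivity) (Finset.mem_univ j)
    simpa [hij] using this
  have hrow : ∑ i, signRow d τ α i ^ 2 = s * (‖x‖ ^ 2 + inner ℝ x (sketchOp d s u τ x)) := by
    rw [← inner_sketchOp_self d hs'.ne' u τ x]
    simp only [inner_signRow, hα]
  -- Restoring the erased entry through (a - b)² ≤ 2a² + 2b² costs a second s R ‖x‖², whence the
  -- 2‖x‖².
  have key : ∑ i, ∑ j, (if i ∈ d j then ‖u j‖ ^ 2 * ‖signRowErase d τ α i j‖ ^ 2 else 0)
      ≤ 2 * s * R * (2 * ‖x‖ ^ 2 + inner ℝ x (sketchOp d s u τ x)) := by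
    have h1 : ∀ i j, (if i ∈ d j then ‖u j‖ ^ 2 * ‖signRowErase d τ α i j‖ ^ 2 else 0)
        ≤ (if i ∈ d j then ‖u j‖ ^ 2 else 0) * (2 * signRow d τ α i ^ 2)
          + 2 * R * (if i ∈ d j then α j ^ 2 else 0) := by
      intro i j
      split_ifs with hij
      · have h2 : ‖signRowErase d τ α i j‖ ^ 2 ≤ 2 * signRow d τ α i ^ 2 + 2 * α j ^ 2 := by
          rw [Real.norm_eq_abs, sq_abs, signRowErase, smul_eq_mul]
          have h3 : (signEntry d τ i j * α j) ^ 2 = α j ^ 2 := by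
            rw [mul_pow, signEntry_sq, if_pos hij, one_mul]
          nlinarith [sq_nonneg (signRow d τ α i + signEntry d τ i j * α j)]
        have h3 := huR i j hij
        have h4 := mul_le_mul_of_nonneg_left h2 (sq_nonneg ‖u j‖)
        have h5 := mul_le_mul_of_nonneg_right h3 (sq_nonneg (α j))
        linarith
      · simp
    have h2 : ∑ i, ∑ j, (if i ∈ d j then α j ^ 2 else 0) = s * ‖x‖ ^ 2 := by
      rw [Finset.sum_comm, ← hx, Finset.mul_sum]
      refine Finset.sum_congr rfl fun j _ => ?_
      rw [Finset.sum_ite_mem, Finset.univ_inter, Finset.sum_const, hd, nsmul_eq_mul]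
    calc _ ≤ ∑ i, ∑ j, ((if i ∈ d j then ‖u j‖ ^ 2 else 0) * (2 * signRow d τ α i ^ 2)
          + 2 * R * (if i ∈ d j then α j ^ 2 else 0)) :=
          Finset.sum_le_sum fun i _ => Finset.sum_le_sum fun j _ => h1 i j
      _ = ∑ i, (∑ j, (if i ∈ d j then ‖u j‖ ^ 2 else 0)) * (2 * signRow d τ α i ^ 2)
          + 2 * R * (s * ‖x‖ ^ 2) := by
          rw [← h2]
          simp only [Finset.sum_add_distrib, Finset.sum_mul, Finset.mul_sum]
      _ ≤ ∑ i, R * (2 * signRow d τ α i ^ 2) + 2 * R * (s * ‖x‖ ^ 2) := by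
          gcongr with i _; exact hR i
      _ = _ := by
          rw [← Finset.mul_sum, ← Finset.mul_sum, hrow]; ring
  rw [Fintype.sum_prod_type]
  calc _ ≤ ∑ i, ∑ j, 8 / (s : ℝ) ^ 2
        * ((if i ∈ d j then α j ^ 2 * ‖signRowErase d τ u i j‖ ^ 2 else 0)
        + (if i ∈ d j then ‖u j‖ ^ 2 * ‖signRowErase d τ α i j‖ ^ 2 else 0)) := by
        refine Finset.sum_le_sum fun i _ => Finset.sum_le_sum fun j _ => ?_
        rw [LinearMap.sub_apply, sketchOp_apply d _ hu, sketchOp_apply d _ hu]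
        exact norm_sketchChaos_sub_flipAt_sq_le d s α u τ i j
    _ = 8 / (s : ℝ) ^ 2
          * (∑ i, ∑ j, (if i ∈ d j then ‖u j‖ ^ 2 * ‖signRowErase d τ α i j‖ ^ 2 else 0))
        + 8 / s ^ 2 * ∑ j, α j ^ 2
          * ∑ i, (if i ∈ d j then ‖signRowErase d τ u i j‖ ^ 2 else 0) := by
        simp only [← Finset.mul_sum, Finset.sum_add_distrib, mul_add]
        rw [add_comm]
        congr 2
        rw [Finset.sum_comm]
        simp only [Finset.mul_sum, mul_ite, mul_zero]
    _ ≤ 8 / (s : ℝ) ^ 2 * (2 * s * R * (2 * ‖x‖ ^ 2 + inner ℝ x (sketchOp d s u τ x)))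
        + 8 / s ^ 2 * ∑ j, α j ^ 2
          * ∑ i, (if i ∈ d j then ‖signRowErase d τ u i j‖ ^ 2 else 0) := by
        gcongr
    _ = _ := by
        congr 1
        field_simp
        ring

/-- Split at |l| = 1/8, where 136 = 64(2 + 1/8) makes both cases meet. The level 1/8 lies below the
target 1/2 by a factor that Markov's inequality turns into 16⁻ᵖ. -/
lemma even_pow_mul_two_add_le (l : ℝ) (q : ℕ) :
    l ^ (2 * q) * (2 + l) ≤ 136 * (l ^ (2 * (q + 1)) + (1 / 8) ^ (2 * (q + 1))) := by
  have h0 : 0 ≤ l ^ (2 * q) := (even_two_mul q).pow_nonneg l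
  have e : l ^ (2 * (q + 1)) = l ^ (2 * q) * l ^ 2 := by ring
  have e' : ((1 : ℝ) / 8) ^ (2 * (q + 1)) = (1 / 8) ^ (2 * q) * (1 / 64) := by
    rw [mul_add, pow_add]; norm_num
  have h8 : (0 : ℝ) ≤ (1 / 8) ^ (2 * q) := by positivity
  rw [e, e']
  rcases le_total (1 / 8) |l| with h | h
  · have h1 : 2 + l ≤ 136 * l ^ 2 := by
      have := le_abs_self l
      rw [← sq_abs]; nlinarith
    nlinarith [mul_le_mul_of_nonneg_left h1 h0]
  · have h1 : l ^ (2 * q) ≤ (1 / 8) ^ (2 * q) := by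
      rw [← (even_two_mul q).pow_abs]
      exact pow_le_pow_left₀ (abs_nonneg _) h _
    have h2 : 2 + l ≤ 2 + 1 / 8 := by linarith [le_abs_self l]
    have h3 : l ^ (2 * q) * (2 + l) ≤ (1 / 8) ^ (2 * q) * (2 + 1 / 8) := by
      have : 0 ≤ 2 + l := by linarith [neg_abs_le l]
      gcongr
    have h4 : 0 ≤ l ^ (2 * q) * l ^ 2 := by positivity
    linarith

variable [FiniteDimensional ℝ H]

lemma sum_norm_sq_eq_finrank (hu : ∀ x, ∑ j, inner ℝ (u j) x • u j = x) :
    ∑ j, ‖u j‖ ^ 2 = Module.finrank ℝ H := by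
  have b := stdOrthonormalBasis ℝ H
  have h1 : ∀ x : H, ∑ j, inner ℝ (u j) x ^ 2 = ‖x‖ ^ 2 := sum_inner_sq_of_frame hu
  have h2 : ∀ j, ‖u j‖ ^ 2 = ∑ a, inner ℝ (u j) (b a) ^ 2 := by
    intro j
    rw [← real_inner_self_eq_norm_sq, ← b.sum_inner_mul_inner]
    refine Finset.sum_congr rfl fun a _ => ?_
    rw [real_inner_comm (u j) (b a), sq]
  simp only [h2]
  rw [Finset.sum_comm]
  simp [h1]

/-- Trace moment bound for the operator-valued chaos. -/
lemma sum_trace_sketchOp_pow_le (hs : s ≠ 0) (hd : ∀ j, (d j).card = s)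
    (hu : ∀ x, ∑ j, inner ℝ (u j) x • u j = x)
    (hR : ∀ i, ∑ j, (if i ∈ d j then ‖u j‖ ^ 2 else 0) ≤ R) (hR0 : 0 ≤ R) {q : ℕ}
    (hsmall : 5000 * ((q + 1) * R) ≤ s) :
    ∑ τ, LinearMap.trace ℝ H (sketchOp d s u τ ^ (2 * (q + 1)))
      ≤ Fintype.card (I × J → ℤˣ) * (Module.finrank ℝ H * (1 / 8) ^ (2 * (q + 1))
        + ∑ j, ‖u j‖ ^ 2 * (64 * (q + 1) ^ 2 * overlap d u j / s ^ 2) ^ (q + 1)) := by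
  have hs' : (0 : ℝ) < s := by exact_mod_cast Nat.pos_of_ne_zero hs
  have hq : (0 : ℝ) ≤ q := q.cast_nonneg
  set p : ℝ := (q : ℝ) + 1 with hp
  have hp0 : 0 < p := by positivity
  have hp0' : p ≠ 0 := hp0.ne'
  set N : ℝ := (Fintype.card (I × J → ℤˣ) : ℝ)
  let T : (I × J → ℤˣ) → J → ℝ := fun τ j =>
    ∑ i, if i ∈ d j then ‖signRowErase d τ u i j‖ ^ 2 else 0
  have hT : ∀ τ j, 0 ≤ T τ j := fun τ j => Finset.sum_nonneg fun i _ => by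
    split_ifs <;> positivity
  have hTm : ∀ j, ∑ τ, T τ j ^ (q + 1) ≤ 2 * N * (4 * p * overlap d u j) ^ (q + 1) := by
    intro j
    -- A weight concentrated at j isolates the contribution of one column.
    have := sum_pow_signRowErase_le d u (Pi.single j 1) (Nat.succ_ne_zero q)
    push_cast at this
    rw [Finset.sum_eq_single j (fun k _ hk => by simp [hk]) (by simp)] at this
    refine (le_of_eq ?_).trans (this.trans_eq (by simp [N, hp]))
    refine Finset.sum_congr rfl fun τ _ => ?_
    rw [Finset.sum_eq_single j (fun k _ hk => by simp [hk]) (by simp)]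
    simp [T]
  have hsym := sketchOp_isSymmetric d (s : ℝ) u
  have hhom : ∀ τ, (4 : ℝ) • sketchOp d s u τ
      = ∑ e, (sketchOp d s u τ - sketchOp d s u (flipAt e τ)) := by
    intro τ
    ext x
    rw [LinearMap.smul_apply, LinearMap.sum_apply]
    simp only [LinearMap.sub_apply, sketchOp_apply d _ hu]
    exact four_smul_sketchChaos d hs hd _ u τ
  have h1 := sum_trace_pow_chaos_le (sketchOp d s u) hsym hhom q
  have hbasis : ∀ τ, ∑ i, (hsym τ).eigenvalues rfl i ^ (2 * (q + 1))
      = LinearMap.trace ℝ H (sketchOp d s u τ ^ (2 * (q + 1))) := fun τ =>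
    ((hsym τ).trace_pow _).symm
  have hc : 0 < (s : ℝ) ^ 2 / (16 * p) := by positivity
  have h2 : ∀ τ i, (2 * q + 1) / 4 * ((hsym τ).eigenvalues rfl i ^ (2 * q)
        * ∑ e, ‖(sketchOp d s u τ - sketchOp d s u (flipAt e τ))
          ((hsym τ).eigenvectorBasis rfl i)‖ ^ 2)
      ≤ 1 / 4 * ((hsym τ).eigenvalues rfl i ^ (2 * (q + 1)) + (1 / 8) ^ (2 * (q + 1)))
        + 1 / 4 * (hsym τ).eigenvalues rfl i ^ (2 * (q + 1))
        + 1 / 4 * ∑ j, inner ℝ (u j) ((hsym τ).eigenvectorBasis rfl i) ^ 2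
          * ((16 * p / s ^ 2) ^ (q + 1) * T τ j ^ (q + 1)) := by
    intro τ i
    set l := (hsym τ).eigenvalues rfl i
    set x := (hsym τ).eigenvectorBasis rfl i with hx
    have hxn : ‖x‖ = 1 := (hsym τ).eigenvectorBasis rfl |>.norm_eq_one i
    have hxx : inner ℝ x (sketchOp d s u τ x) = l := by
      rw [hx, (hsym τ).apply_eigenvectorBasis, ← hx, real_inner_smul_right,
        real_inner_self_eq_norm_sq, hxn]
      simp [l]
    have hV := sum_norm_sketchOp_sub_flipAt_sq_le hs hd hu hR τ x
    rw [hxx, hxn] at hV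
    have hl0 : 0 ≤ l ^ (2 * q) := (even_two_mul q).pow_nonneg l
    -- On a unit eigenvector the frame coefficients form a probability weight, so applying Young's
    -- inequality to every j costs only one quarter of the moment in total.
    have hsum : ∑ j, inner ℝ (u j) x ^ 2 = 1 := by
      rw [sum_inner_sq_of_frame hu, hxn, one_pow]
    calc _ ≤ p / 2 * (l ^ (2 * q) * (16 * R / s * (2 * 1 ^ 2 + l)
          + 8 / s ^ 2 * ∑ j, inner ℝ (u j) x ^ 2 * T τ j)) := by
          gcongr ?_ * (_ * ?_)
          rw [hp]; linarith
      _ = 8 * (p * R) / s * (l ^ (2 * q) * (2 + l))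
          + 4 * p / s ^ 2 * ∑ j, inner ℝ (u j) x ^ 2 * (T τ j * (l ^ 2) ^ q) := by
          rw [← pow_mul]
          simp only [← mul_assoc (inner ℝ _ _ ^ 2), ← Finset.sum_mul]
          ring
      _ ≤ 8 * (p * R) / s * (136 * (l ^ (2 * (q + 1)) + (1 / 8) ^ (2 * (q + 1))))
          + 4 * p / s ^ 2 * ∑ j, inner ℝ (u j) x ^ 2 * (s ^ 2 / (16 * p)
            * ((T τ j / (s ^ 2 / (16 * p))) ^ (q + 1) + (l ^ 2) ^ (q + 1))) := by
          refine add_le_add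
            (mul_le_mul_of_nonneg_left (even_pow_mul_two_add_le l q) (by positivity))
            (mul_le_mul_of_nonneg_left (Finset.sum_le_sum fun j _ => ?_) (by positivity))
          exact mul_le_mul_of_nonneg_left (mul_pow_le_young (hT τ j) (sq_nonneg l) hc q)
            (sq_nonneg _)
      _ ≤ _ := by
          have e1 : ∀ t : ℝ, t / (s ^ 2 / (16 * p)) = 16 * p / s ^ 2 * t := by
            intro t; field_simp
          have e2 : 4 * p / s ^ 2 * (s ^ 2 / (16 * p)) = 1 / 4 := by field_simp; norm_num
          have e3 : 4 * p / s ^ 2 * ∑ j, inner ℝ (u j) x ^ 2 * (s ^ 2 / (16 * p)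
            * ((T τ j / (s ^ 2 / (16 * p))) ^ (q + 1) + (l ^ 2) ^ (q + 1)))
            = 1 / 4 * l ^ (2 * (q + 1)) + 1 / 4 * ∑ j, inner ℝ (u j) x ^ 2
              * ((16 * p / s ^ 2) ^ (q + 1) * T τ j ^ (q + 1)) := by
            have : ∀ j, inner ℝ (u j) x ^ 2 * (s ^ 2 / (16 * p)
              * ((T τ j / (s ^ 2 / (16 * p))) ^ (q + 1) + (l ^ 2) ^ (q + 1)))
              = s ^ 2 / (16 * p) * (inner ℝ (u j) x ^ 2
                * ((16 * p / s ^ 2) ^ (q + 1) * T τ j ^ (q + 1))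
                + inner ℝ (u j) x ^ 2 * l ^ (2 * (q + 1))) := by
              intro j
              rw [e1, mul_pow, ← pow_mul]; ring
            simp only [this]
            rw [← Finset.mul_sum, ← mul_assoc, e2, Finset.sum_add_distrib, ← Finset.sum_mul, hsum]
            ring
          -- Multiplied by 136 this is below 1/4, so at most half of the trace moment is absorbed
          -- altogether.
          have e4 : 8 * (p * R) / s ≤ 8 / 5000 := by
            rw [div_le_iff₀ hs']; linarith
          have e5 : 0 ≤ l ^ (2 * (q + 1)) + (1 / 8) ^ (2 * (q + 1)) := by
            have := (even_two_mul (q + 1)).pow_nonneg l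
            positivity
          have e6 := mul_le_mul_of_nonneg_right e4 (mul_nonneg (by norm_num : (0 : ℝ) ≤ 136) e5)
          rw [e3]
          linarith
  have h3 : ∑ τ, LinearMap.trace ℝ H (sketchOp d s u τ ^ (2 * (q + 1)))
      ≤ 1 / 2 * ∑ τ, LinearMap.trace ℝ H (sketchOp d s u τ ^ (2 * (q + 1)))
        + N * (1 / 4 * (Module.finrank ℝ H * (1 / 8) ^ (2 * (q + 1))))
        + 1 / 4 * ∑ j, ‖u j‖ ^ 2 * ((16 * p / s ^ 2) ^ (q + 1) * ∑ τ, T τ j ^ (q + 1)) := by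
    have e0 : ∀ τ, ∑ i, ∑ j, inner ℝ (u j) ((hsym τ).eigenvectorBasis rfl i) ^ 2
          * ((16 * p / s ^ 2) ^ (q + 1) * T τ j ^ (q + 1))
        = ∑ j, ‖u j‖ ^ 2 * ((16 * p / s ^ 2) ^ (q + 1) * T τ j ^ (q + 1)) := by
      intro τ
      rw [Finset.sum_comm]
      refine Finset.sum_congr rfl fun j _ => ?_
      rw [← Finset.sum_mul]
      congr 1
      rw [← real_inner_self_eq_norm_sq,
        ← ((hsym τ).eigenvectorBasis rfl).sum_inner_mul_inner (u j)]
      refine Finset.sum_congr rfl fun a _ => ?_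
      rw [real_inner_comm (u j) ((hsym τ).eigenvectorBasis rfl a), sq]
    rw [Finset.mul_sum] at h1
    refine h1.trans ?_
    calc _ ≤ ∑ τ, ∑ i, (1 / 4 * ((hsym τ).eigenvalues rfl i ^ (2 * (q + 1))
          + (1 / 8) ^ (2 * (q + 1)))
        + 1 / 4 * (hsym τ).eigenvalues rfl i ^ (2 * (q + 1))
        + 1 / 4 * ∑ j, inner ℝ (u j) ((hsym τ).eigenvectorBasis rfl i) ^ 2
          * ((16 * p / s ^ 2) ^ (q + 1) * T τ j ^ (q + 1))) := by
          refine Finset.sum_le_sum fun τ _ => ?_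
          rw [Finset.mul_sum]
          exact Finset.sum_le_sum fun i _ => h2 τ i
      _ = _ := by
          simp only [Finset.sum_add_distrib, ← Finset.mul_sum, hbasis, e0, Finset.sum_const,
            Finset.card_univ, Fintype.card_fin, nsmul_eq_mul, N]
          have : ∑ τ, ∑ j, ‖u j‖ ^ 2 * ((16 * p / s ^ 2) ^ (q + 1) * T τ j ^ (q + 1))
              = ∑ j, ‖u j‖ ^ 2 * ((16 * p / s ^ 2) ^ (q + 1) * ∑ τ, T τ j ^ (q + 1)) := by
            rw [Finset.sum_comm]; simp only [Finset.mul_sum]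
          rw [this]
          ring
  have h4 : ∑ j, ‖u j‖ ^ 2 * ((16 * p / s ^ 2) ^ (q + 1) * ∑ τ, T τ j ^ (q + 1))
      ≤ N * (2 * ∑ j, ‖u j‖ ^ 2 * (64 * p ^ 2 * overlap d u j / s ^ 2) ^ (q + 1)) := by
    rw [Finset.mul_sum, Finset.mul_sum]
    refine Finset.sum_le_sum fun j _ => ?_
    calc _ ≤ ‖u j‖ ^ 2 * ((16 * p / s ^ 2) ^ (q + 1)
          * (2 * N * (4 * p * overlap d u j) ^ (q + 1))) := by gcongr; exact hTm j
      _ = _ := by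
        have : 64 * p ^ 2 * overlap d u j / s ^ 2 = (16 * p / s ^ 2) * (4 * p * overlap d u j) := by
          ring
        rw [this]
        generalize 16 * p / (s : ℝ) ^ 2 = x
        generalize 4 * p * overlap d u j = y
        rw [mul_pow]; ring
  have h5 : 0 ≤ N * (Module.finrank ℝ H * (1 / 8) ^ (2 * (q + 1))) := by positivity
  linarith

end Operator

/-! ### Deterministic analysis of sketched least squares -/

section Regression

variable {m n d : ℕ}

lemma toLp_mulVec_mem_colSpace (A : Matrix (Fin n) (Fin d) ℝ) (x : Fin d → ℝ) :
    WithLp.toLp 2 (A *ᵥ x) ∈ colSpace A := by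
  have : (WithLp.toLp 2 (A *ᵥ x) : EuclideanSpace ℝ (Fin n))
      = ∑ k, x k • WithLp.toLp 2 (fun j => A j k) := by
    ext j
    simp [Matrix.mulVec, dotProduct, mul_comm]
  rw [this]
  exact Submodule.sum_mem _ fun k _ => Submodule.smul_mem _ _
    (Submodule.subset_span (Set.mem_range_self k))

lemma exists_mulVec_eq_of_mem_colSpace (A : Matrix (Fin n) (Fin d) ℝ)
    {y : EuclideanSpace ℝ (Fin n)} (hy : y ∈ colSpace A) :
    ∃ x : Fin d → ℝ, WithLp.toLp 2 (A *ᵥ x) = y := by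
  obtain ⟨c, rfl⟩ := (Submodule.mem_span_range_iff_exists_fun ℝ).1 hy
  refine ⟨c, ?_⟩
  ext j
  simp [Matrix.mulVec, dotProduct, mul_comm]

lemma finrank_colSpace (A : Matrix (Fin n) (Fin d) ℝ) :
    Module.finrank ℝ (colSpace A) = A.rank := by
  rw [Matrix.rank_eq_finrank_span_cols]
  have h : colSpace A = (Submodule.span ℝ (Set.range A.col)).map
      (WithLp.linearEquiv 2 ℝ (Fin n → ℝ)).symm.toLinearMap := by
    rw [Submodule.map_span, colSpace, ← Set.range_comp]
    rfl
  rw [h]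
  exact LinearEquiv.finrank_map_eq _ _

/-- The residual of a least squares minimizer is orthogonal to the column space. -/
lemma inner_residual_eq_zero {A : Matrix (Fin n) (Fin d) ℝ} {b : Fin n → ℝ} {xstar : Fin d → ℝ}
    (hmin : IsMinOn (lsObjective A b) Set.univ xstar)
    {y : EuclideanSpace ℝ (Fin n)} (hy : y ∈ colSpace A) :
    inner ℝ y (WithLp.toLp 2 (b - A *ᵥ xstar)) = 0 := by
  obtain ⟨h, rfl⟩ := exists_mulVec_eq_of_mem_colSpace A hy
  set y : EuclideanSpace ℝ (Fin n) := WithLp.toLp 2 (A *ᵥ h) with hy'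
  set z : EuclideanSpace ℝ (Fin n) := WithLp.toLp 2 (b - A *ᵥ xstar) with hz
  have h1 : ∀ t : ℝ, ‖z‖ ^ 2 ≤ ‖z - t • y‖ ^ 2 := by
    intro t
    have h2 := isMinOn_iff.1 hmin (xstar + t • h) (Set.mem_univ _)
    unfold lsObjective at h2
    have e1 : (WithLp.toLp 2 (A *ᵥ xstar - b) : EuclideanSpace ℝ (Fin n)) = -z := by
      rw [hz, ← WithLp.toLp_neg]; congr 1; abel
    have e2 : (WithLp.toLp 2 (A *ᵥ (xstar + t • h) - b) : EuclideanSpace ℝ (Fin n))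
        = -(z - t • y) := by
      rw [hz, hy', ← WithLp.toLp_smul, ← WithLp.toLp_sub, ← WithLp.toLp_neg, Matrix.mulVec_add,
        Matrix.mulVec_smul]
      congr 1; abel
    rwa [e1, e2, norm_neg, norm_neg] at h2
  have h2 : ∀ t : ℝ, 2 * t * inner ℝ y z ≤ t ^ 2 * ‖y‖ ^ 2 := by
    intro t
    have h3 := h1 t
    rw [norm_sub_sq_real, norm_smul, mul_pow, Real.norm_eq_abs, sq_abs, real_inner_smul_right,
      real_inner_comm] at h3
    linarith
  by_contra hne
  have hpos : 0 < inner ℝ y z ^ 2 := by positivity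
  -- The optimal step has denominator ‖y‖²; adding 1 avoids the case y = 0.
  have h3 := h2 (inner ℝ y z / (‖y‖ ^ 2 + 1))
  have hN : 0 < ‖y‖ ^ 2 + 1 := by positivity
  have e1 : 2 * (inner ℝ y z / (‖y‖ ^ 2 + 1)) * inner ℝ y z
      = inner ℝ y z ^ 2 * (2 / (‖y‖ ^ 2 + 1)) := by ring
  have e2 : (inner ℝ y z / (‖y‖ ^ 2 + 1)) ^ 2 * ‖y‖ ^ 2
      = inner ℝ y z ^ 2 * (‖y‖ ^ 2 / (‖y‖ ^ 2 + 1) ^ 2) := by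
    rw [div_pow]; ring
  rw [e1, e2] at h3
  have h4 := le_of_mul_le_mul_left h3 hpos
  rw [div_le_div_iff₀ hN (by positivity)] at h4
  nlinarith [sq_nonneg ‖y‖]

/-- If the sketch `S` is bounded below on the column space, and nearly preserves the orthogonality
of the residual to it, then the sketched minimizers are nearly optimal. -/
lemma lsObjective_le_of_sketch (S : Matrix (Fin m) (Fin n) ℝ) {A : Matrix (Fin n) (Fin d) ℝ}
    {b : Fin n → ℝ} {xstar : Fin d → ℝ} (hmin : IsMinOn (lsObjective A b) Set.univ xstar)
    {ε : ℝ} (hε : 0 < ε) (hε1 : ε < 1)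
    (hlow : ∀ y ∈ colSpace A, ‖y‖ ^ 2 / 2 ≤ ∑ i, (S *ᵥ y.ofLp) i ^ 2)
    (hcross : ∀ y ∈ colSpace A, ∑ i, (S *ᵥ y.ofLp) i * (S *ᵥ (b - A *ᵥ xstar)) i
      ≤ √ε / 4 * ‖(WithLp.toLp 2 (b - A *ᵥ xstar) : EuclideanSpace ℝ (Fin n))‖ * ‖y‖)
    {xhat : Fin d → ℝ} (hx : IsMinOn (sketchedObjective S A b) Set.univ xhat) :
    lsObjective A b xhat ≤ (1 - ε) ^ (-2 : ℤ) * lsObjective A b xstar := by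
  set z : EuclideanSpace ℝ (Fin n) := WithLp.toLp 2 (b - A *ᵥ xstar) with hz
  set y : EuclideanSpace ℝ (Fin n) := WithLp.toLp 2 (A *ᵥ (xhat - xstar)) with hy
  have hyA : y ∈ colSpace A := toLp_mulVec_mem_colSpace A _
  have hstar : lsObjective A b xstar = ‖z‖ ^ 2 := by
    rw [lsObjective, ← norm_neg, ← WithLp.toLp_neg, hz]
    congr 3; abel
  have hhat : lsObjective A b xhat = ‖y‖ ^ 2 + ‖z‖ ^ 2 := by
    have e : (WithLp.toLp 2 (A *ᵥ xhat - b) : EuclideanSpace ℝ (Fin n)) = y - z := by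
      rw [hy, hz, ← WithLp.toLp_sub, Matrix.mulVec_sub]; congr 1; abel
    rw [lsObjective, e, norm_sub_sq_real, inner_residual_eq_zero hmin hyA]
    ring
  have hsk : ∀ x, sketchedObjective S A b x = ∑ i, ((S *ᵥ (A *ᵥ x)) i - (S *ᵥ b) i) ^ 2 := by
    intro x
    rw [sketchedObjective, lsObjective, EuclideanSpace.real_norm_sq_eq]
    simp [Matrix.mulVec_mulVec]
  have h1 := isMinOn_iff.1 hx xstar (Set.mem_univ _)
  rw [hsk, hsk] at h1
  have h2 : ∑ i, ((S *ᵥ (A *ᵥ xhat)) i - (S *ᵥ b) i) ^ 2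
      = ∑ i, (S *ᵥ y.ofLp) i ^ 2 - 2 * ∑ i, (S *ᵥ y.ofLp) i * (S *ᵥ (b - A *ᵥ xstar)) i
        + ∑ i, ((S *ᵥ (A *ᵥ xstar)) i - (S *ᵥ b) i) ^ 2 := by
    rw [Finset.mul_sum, ← Finset.sum_sub_distrib, ← Finset.sum_add_distrib]
    refine Finset.sum_congr rfl fun i _ => ?_
    simp only [hy, Matrix.mulVec_sub, Pi.sub_apply]
    ring
  have h3 := hlow y hyA
  have h4 := hcross y hyA
  -- Minimality of x̂ for the sketched problem says ‖Sy‖² ≤ 2⟨Sy, Sz⟩; the two hypotheses bound its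
  -- sides.
  have h5 : ‖y‖ ^ 2 / 2 ≤ 2 * (√ε / 4 * ‖z‖ * ‖y‖) := by linarith
  have h6 : ‖y‖ ≤ √ε * ‖z‖ := by
    rcases (norm_nonneg y).eq_or_lt with h | h
    · rw [← h]; positivity
    · by_contra hlt
      push Not at hlt
      nlinarith
  have h7 : ‖y‖ ^ 2 ≤ ε * ‖z‖ ^ 2 := by
    have := pow_le_pow_left₀ (norm_nonneg y) h6 2
    rwa [mul_pow, Real.sq_sqrt hε.le] at this
  -- Indeed (1 + ε)(1 - ε)² = (1 - ε²)(1 - ε) ≤ 1.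
  have h8 : 1 + ε ≤ (1 - ε) ^ (-2 : ℤ) := by
    have h9 : (0 : ℝ) < (1 - ε) ^ 2 := by
      have : 0 < 1 - ε := by linarith
      positivity
    have : (1 - ε) ^ (-2 : ℤ) = 1 / (1 - ε) ^ 2 := by
      rw [_root_.zpow_neg, one_div]; rfl
    rw [this, le_div_iff₀ h9]
    nlinarith [mul_pos hε hε, mul_pos (mul_pos hε hε) (sub_pos.2 hε1)]
  rw [hhat, hstar]
  calc ‖y‖ ^ 2 + ‖z‖ ^ 2 ≤ (1 + ε) * ‖z‖ ^ 2 := by linarith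
    _ ≤ _ := by gcongr

end Regression

/-! ### The frame of projected coordinate vectors -/

section Frame

variable {m n d : ℕ}

/-- The projections of the coordinate vectors to the column space. -/
noncomputable def leverageFrame (A : Matrix (Fin n) (Fin d) ℝ) (j : Fin n) : colSpace A :=
  (colSpace A).orthogonalProjectionOnto (EuclideanSpace.single j (1 : ℝ))

lemma inner_leverageFrame (A : Matrix (Fin n) (Fin d) ℝ) (j : Fin n) (x : colSpace A) :
    inner ℝ (leverageFrame A j) x = (x : EuclideanSpace ℝ (Fin n)) j := by
  rw [leverageFrame, Submodule.inner_orthogonalProjectionOnto_eq_of_mem_right]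
  simp [EuclideanSpace.inner_single_left]

lemma sum_smul_leverageFrame (A : Matrix (Fin n) (Fin d) ℝ) (z : EuclideanSpace ℝ (Fin n)) :
    ∑ j, z j • leverageFrame A j = (colSpace A).orthogonalProjectionOnto z := by
  simp only [leverageFrame, ← map_smul, ← map_sum]
  congr 1
  ext k
  simp [Finset.sum_apply, Pi.single_apply]

lemma leverageFrame_parseval (A : Matrix (Fin n) (Fin d) ℝ) (x : colSpace A) :
    ∑ j, inner ℝ (leverageFrame A j) x • leverageFrame A j = x := by
  simp only [inner_leverageFrame]
  rw [sum_smul_leverageFrame]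
  simp

lemma norm_leverageFrame_le (A : Matrix (Fin n) (Fin d) ℝ) (j : Fin n) :
    ‖leverageFrame A j‖ ≤ maxLeverage A := by
  have := le_ciSup (f := fun j : Fin n =>
    ‖(colSpace A).starProjection (EuclideanSpace.single j (1 : ℝ))‖) (Set.finite_range _).bddAbove j
  rw [Submodule.starProjection_apply] at this
  exact this

lemma maxLeverage_nonneg (A : Matrix (Fin n) (Fin d) ℝ) : 0 ≤ maxLeverage A :=
  Real.iSup_nonneg fun _ => norm_nonneg _

/-- The sum is the projection of the residual. Its vanishing removes the centring term of the chaos,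
so that ⟨Sy, Sz⟩ is exactly the inner product of the chaos with y. -/
lemma sum_smul_leverageFrame_residual {A : Matrix (Fin n) (Fin d) ℝ} {b : Fin n → ℝ}
    {xstar : Fin d → ℝ} (hmin : IsMinOn (lsObjective A b) Set.univ xstar) :
    ∑ j, (b - A *ᵥ xstar) j • leverageFrame A j = 0 := by
  have h := sum_smul_leverageFrame A (WithLp.toLp 2 (b - A *ᵥ xstar))
  refine h.trans ?_
  rw [Submodule.orthogonalProjectionOnto_eq_zero_iff, Submodule.mem_orthogonal]
  exact fun y hy => inner_residual_eq_zero hmin hy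

/-- Conclusion of the regression analysis in terms of the sketch chaos. -/
lemma lsObjective_le_of_chaos {A : Matrix (Fin n) (Fin d) ℝ}
    {b : Fin n → ℝ} {xstar : Fin d → ℝ} (hmin : IsMinOn (lsObjective A b) Set.univ xstar)
    {ε : ℝ} (hε : 0 < ε) (hε1 : ε < 1) {S : Matrix (Fin m) (Fin n) ℝ} {D : Fin n → Finset (Fin m)}
    {τ : Fin m × Fin n → ℤˣ} {s : ℕ} (hs : s ≠ 0)
    (hS : ∀ i j, S i j = 1 / √(s : ℝ) * signEntry D τ i j)
    (hlow : ∀ y : colSpace A, |inner ℝ y (sketchOp D s (leverageFrame A) τ y)| ≤ ‖y‖ ^ 2 / 2)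
    (hcross : ‖sketchChaos D s (b - A *ᵥ xstar) (leverageFrame A) τ‖
      ≤ √ε / 4 * ‖(WithLp.toLp 2 (b - A *ᵥ xstar) : EuclideanSpace ℝ (Fin n))‖)
    {xhat : Fin d → ℝ} (hx : IsMinOn (sketchedObjective S A b) Set.univ xhat) :
    lsObjective A b xhat ≤ (1 - ε) ^ (-2 : ℤ) * lsObjective A b xstar := by
  have hs' : (0 : ℝ) < s := by exact_mod_cast Nat.pos_of_ne_zero hs
  have hSx : ∀ (x : Fin n → ℝ) i, (S *ᵥ x) i = 1 / √(s : ℝ) * signRow D τ x i := by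
    intro x i
    simp only [Matrix.mulVec, dotProduct, hS, signRow, smul_eq_mul, Finset.mul_sum, mul_assoc]
  have hsq : (1 / √(s : ℝ)) ^ 2 = (s : ℝ)⁻¹ := by
    rw [div_pow, Real.sq_sqrt hs'.le]; simp
  have hrow : ∀ (y : colSpace A) i, signRow D τ (y : EuclideanSpace ℝ (Fin n)).ofLp i
      = inner ℝ (signRow D τ (leverageFrame A) i) y := by
    intro y i
    rw [inner_signRow]
    simp only [inner_leverageFrame]
  refine lsObjective_le_of_sketch S hmin hε hε1 ?_ ?_ hx
  · intro y hy
    have h1 := inner_sketchOp_self D hs'.ne' (leverageFrame A) τ ⟨y, hy⟩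
    have h2 := neg_le_of_abs_le (hlow ⟨y, hy⟩)
    have h3 : ∑ i, (S *ᵥ y.ofLp) i ^ 2
        = ‖y‖ ^ 2 + inner ℝ (⟨y, hy⟩ : colSpace A)
          (sketchOp D s (leverageFrame A) τ ⟨y, hy⟩) := by
      simp only [hSx, mul_pow, hsq, ← Finset.mul_sum]
      have := hrow ⟨y, hy⟩
      simp only [this, h1]
      rw [← mul_assoc, inv_mul_cancel₀ hs'.ne', one_mul]
      rfl
    have h4 : ‖(⟨y, hy⟩ : colSpace A)‖ = ‖y‖ := rfl
    rw [h4] at h2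
    rw [h3]
    linarith
  · intro y hy
    have h1 : ∑ i, (S *ᵥ y.ofLp) i * (S *ᵥ (b - A *ᵥ xstar)) i
        = inner ℝ (sketchChaos D s (b - A *ᵥ xstar) (leverageFrame A) τ) (⟨y, hy⟩ : colSpace A) := by
      rw [sketchChaos, sum_smul_leverageFrame_residual hmin, sub_zero, real_inner_smul_left,
        sum_inner, Finset.mul_sum]
      refine Finset.sum_congr rfl fun i _ => ?_
      rw [hSx, hSx, real_inner_smul_left, ← hrow ⟨y, hy⟩, ← hsq]
      ring
    rw [h1]
    refine (real_inner_le_norm _ _).trans ?_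
    have h4 : ‖(⟨y, hy⟩ : colSpace A)‖ = ‖y‖ := rfl
    rw [h4]
    gcongr

end Frame

/-! ### Random sparsity patterns with independent, negatively correlated columns -/

section Selector

variable {I J : Type*} [Fintype I] [Fintype J] [DecidableEq I] [DecidableEq J]

/-- A product probability distribution on sparsity patterns: column `j` is the set `c` with
probability `q j c`, columns have `s` elements, and inclusion probabilities are at most those of
independent selection with probability `θ`. -/
structure IsPatternLaw (q : J → Finset I → ℝ) (s : ℕ) (θ : ℝ) : Prop where
  nonneg : ∀ j c, 0 ≤ q j c
  sum_eq_one : ∀ j, ∑ c, q j c = 1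
  card_eq : ∀ j c, q j c ≠ 0 → c.card = s
  sum_superset_le : ∀ j (S : Finset I), (∑ c, if S ⊆ c then q j c else 0) ≤ θ ^ S.card

variable {q : J → Finset I → ℝ} {s : ℕ} {θ : ℝ}

/-- Independence of the columns: expectations of products over columns factor. -/
lemma sum_prod_mul_prod (q h : J → Finset I → ℝ) :
    ∑ d : J → Finset I, (∏ j, q j (d j)) * ∏ j, h j (d j) = ∏ j, ∑ c, q j c * h j c := by
  rw [Finset.prod_univ_sum, Fintype.piFinset_univ]
  simp only [Finset.prod_mul_distrib]

lemma IsPatternLaw.prod_nonneg (hq : IsPatternLaw q s θ) (d : J → Finset I) :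
    0 ≤ ∏ j, q j (d j) := Finset.prod_nonneg fun j _ => hq.nonneg j _

lemma IsPatternLaw.sum_prod (hq : IsPatternLaw q s θ) :
    ∑ d : J → Finset I, ∏ j, q j (d j) = 1 := by
  have := sum_prod_mul_prod q (fun _ _ => 1)
  simpa [hq.sum_eq_one] using this

/-- Put x = exp t - 1 ≥ 0 and expand (1 + x)^|c ∩ c'| over the subsets S of c ∩ c'. The expectation
involves only the probabilities of S ⊆ c', which are at most θ^|S|, and the sum closes up to (1 +
θx)^|c|. The restriction t ≤ 1 gives x ≤ 2t. -/
lemma IsPatternLaw.sum_mul_exp_card_inter_le (hq : IsPatternLaw q s θ) (hθ : 0 ≤ θ) (j : J)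
    (c : Finset I) {t : ℝ} (ht : 0 ≤ t) (ht1 : t ≤ 1) :
    ∑ c', q j c' * Real.exp (t * (c ∩ c').card) ≤ Real.exp (2 * t * θ * c.card) := by
  set x := Real.exp t - 1 with hx
  have hx0 : 0 ≤ x := by linarith [Real.one_le_exp ht]
  have hx2 : x ≤ 2 * t := by
    have := Real.abs_exp_sub_one_le (x := t) (by rwa [abs_of_nonneg ht])
    rw [abs_of_nonneg ht] at this
    exact (le_abs_self _).trans this
  have h1 : ∀ c' : Finset I, Real.exp (t * (c ∩ c').card)
      = ∑ S ∈ c.powerset, if S ⊆ c' then x ^ S.card else 0 := by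
    intro c'
    have h2 : Real.exp (t * (c ∩ c').card) = (x + 1) ^ (c ∩ c').card := by
      rw [hx, sub_add_cancel, ← Real.exp_nat_mul, mul_comm]
    rw [h2, ← Finset.sum_pow_mul_eq_add_pow, ← Finset.sum_filter]
    refine Finset.sum_congr ?_ fun S _ => by simp
    ext S
    simp only [Finset.mem_powerset, Finset.mem_filter, Finset.subset_inter_iff]
  simp only [h1, Finset.mul_sum]
  rw [Finset.sum_comm]
  calc _ = ∑ S ∈ c.powerset, x ^ S.card * ∑ c', (if S ⊆ c' then q j c' else 0) := by
        refine Finset.sum_congr rfl fun S _ => ?_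
        rw [Finset.mul_sum]
        refine Finset.sum_congr rfl fun c' _ => ?_
        split_ifs <;> ring
    _ ≤ ∑ S ∈ c.powerset, x ^ S.card * θ ^ S.card := by
        gcongr with S _
        exact hq.sum_superset_le j S
    _ = (x * θ + 1) ^ c.card := by
        rw [← Finset.sum_pow_mul_eq_add_pow]
        refine Finset.sum_congr rfl fun S _ => by rw [mul_pow]; simp
    _ ≤ Real.exp (2 * t * θ) ^ c.card := by
        gcongr
        have := Real.add_one_le_exp (2 * t * θ)
        have : x * θ ≤ 2 * t * θ := by gcongr
        linarith
    _ = _ := by rw [← Real.exp_nat_mul, mul_comm]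

variable {K : Type*} [NormedAddCommGroup K] [InnerProductSpace ℝ K] {u : J → K}

lemma IsPatternLaw.sum_mul_exp_rowSum_le (hq : IsPatternLaw q s θ) (hθ : 0 ≤ θ) {l : ℝ}
    (hl : 0 ≤ l) (hlu : ∀ j, l * ‖u j‖ ^ 2 ≤ 1) (i : I) :
    ∑ d : J → Finset I, (∏ j, q j (d j))
        * Real.exp (l * ∑ j, if i ∈ d j then ‖u j‖ ^ 2 else 0)
      ≤ Real.exp (2 * l * (θ * ∑ j, ‖u j‖ ^ 2)) := by
  have h1 : ∀ d : J → Finset I, Real.exp (l * ∑ j, if i ∈ d j then ‖u j‖ ^ 2 else 0)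
      = ∏ j, Real.exp (l * ‖u j‖ ^ 2 * (({i} : Finset I) ∩ d j).card) := by
    intro d
    rw [← Real.exp_sum, Finset.mul_sum]
    congr 1
    refine Finset.sum_congr rfl fun j _ => ?_
    by_cases h : i ∈ d j
    · simp [h, Finset.singleton_inter_of_mem]
    · simp [h]
  simp only [h1]
  rw [sum_prod_mul_prod q fun j c => Real.exp (l * ‖u j‖ ^ 2 * (({i} : Finset I) ∩ c).card)]
  calc _ ≤ ∏ j, Real.exp (2 * (l * ‖u j‖ ^ 2) * θ * ({i} : Finset I).card) := by
        refine Finset.prod_le_prod (fun j _ => Finset.sum_nonneg fun c _ =>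
          mul_nonneg (hq.nonneg j c) (Real.exp_pos _).le) fun j _ => ?_
        exact hq.sum_mul_exp_card_inter_le hθ j {i} (by positivity) (hlu j)
    _ = _ := by
        rw [← Real.exp_sum]
        congr 1
        rw [Finset.mul_sum, Finset.mul_sum]
        refine Finset.sum_congr rfl fun j _ => ?_
        rw [Finset.card_singleton]; push_cast; ring

/-- Condition on the j-th column being c, which has s elements: the overlap is then a sum over the
other, independent columns. The factors `h c` encode this conditioning as a product over columns. -/
lemma IsPatternLaw.sum_mul_exp_overlap_le (hq : IsPatternLaw q s θ) (hθ : 0 ≤ θ) {l : ℝ}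
    (hl : 0 ≤ l) (hlu : ∀ j, l * ‖u j‖ ^ 2 ≤ 1) (j : J) :
    ∑ d : J → Finset I, (∏ k, q k (d k)) * Real.exp (l * overlap d u j)
      ≤ Real.exp (2 * l * (θ * s * ∑ k, ‖u k‖ ^ 2)) := by
  let h : Finset I → J → Finset I → ℝ := fun c k c' =>
    if k = j then (if c' = c then 1 else 0) else Real.exp (l * ‖u k‖ ^ 2 * (c ∩ c').card)
  have h1 : ∀ d : J → Finset I, Real.exp (l * overlap d u j) = ∑ c, ∏ k, h c k (d k) := by
    intro d
    rw [Finset.sum_eq_single (d j)]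
    · unfold overlap
      rw [Finset.mul_sum, Real.exp_sum]
      refine Finset.prod_congr rfl fun k _ => ?_
      by_cases hk : k = j
      · subst hk; simp [h]
      · simp [h, hk, mul_assoc]
    · intro c _ hc
      exact Finset.prod_eq_zero (Finset.mem_univ j) (by simp [h, hc.symm])
    · simp
  simp only [h1, Finset.mul_sum]
  rw [Finset.sum_comm]
  simp only [sum_prod_mul_prod q (h _)]
  calc _ ≤ ∑ c, q j c * Real.exp (2 * l * (θ * s * ∑ k, ‖u k‖ ^ 2)) := by
        refine Finset.sum_le_sum fun c _ => ?_
        rw [← Finset.mul_prod_erase _ _ (Finset.mem_univ j)]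
        have e1 : ∑ c', q j c' * h c j c' = q j c := by simp [h]
        rw [e1]
        by_cases hc : q j c = 0
        · simp [hc]
        refine mul_le_mul_of_nonneg_left ?_ (hq.nonneg j c)
        calc _ ≤ ∏ k ∈ Finset.univ.erase j, Real.exp (2 * (l * ‖u k‖ ^ 2) * θ * c.card) := by
              refine Finset.prod_le_prod (fun k hk => Finset.sum_nonneg fun c' _ =>
                mul_nonneg (hq.nonneg k c') ?_) fun k hk => ?_
              · simp only [h, if_neg (Finset.ne_of_mem_erase hk)]; positivity
              · simp only [h, if_neg (Finset.ne_of_mem_erase hk)]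
                exact hq.sum_mul_exp_card_inter_le hθ k c (by positivity) (hlu k)
          _ = Real.exp (∑ k ∈ Finset.univ.erase j, 2 * (l * ‖u k‖ ^ 2) * θ * c.card) :=
              (Real.exp_sum _ _).symm
          _ ≤ Real.exp (∑ k, 2 * (l * ‖u k‖ ^ 2) * θ * c.card) := by
              apply Real.exp_le_exp.2
              exact Finset.sum_le_sum_of_subset_of_nonneg (Finset.erase_subset _ _)
                fun k _ _ => by positivity
          _ = Real.exp (2 * l * (θ * s * ∑ k, ‖u k‖ ^ 2)) := by
              rw [hq.card_eq j c hc, Finset.mul_sum, Finset.mul_sum]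
              congr 1
              refine Finset.sum_congr rfl fun k _ => by ring
    _ = _ := by
        rw [← Finset.sum_mul, hq.sum_eq_one, one_mul]
        simp only [Finset.mul_sum]

/-- Moments from a one-sided Poisson-type exponential moment bound. -/
lemma sum_mul_pow_le_of_exp {D : Type*} [Fintype D] {W F : D → ℝ} (hW : ∀ d, 0 ≤ W d)
    (hF : ∀ d, 0 ≤ F d) {M b : ℝ} (hM : 0 < M) (hb : 0 ≤ b)
    (h : ∀ l, 0 ≤ l → l * M ≤ 1 → ∑ d, W d * Real.exp (l * F d) ≤ Real.exp (2 * l * b))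
    {p : ℕ} (hp : p ≠ 0) : ∑ d, W d * F d ^ p ≤ (9 * (p * M + b)) ^ p := by
  have hp' : (0 : ℝ) < p := by exact_mod_cast Nat.pos_of_ne_zero hp
  -- The exponent 1/L is admissible since L ≥ M. As pL = pM + b, the exponential moment is at most
  -- exp(2p) ≤ 9ᵖ.
  set L := M + b / p with hL
  have hL0 : 0 < L := by positivity
  have h1 : p * L = p * M + b := by rw [hL]; field_simp
  have h2 := h L⁻¹ (by positivity) (by
    rw [inv_mul_le_iff₀ hL0, hL, mul_one]
    have : 0 ≤ b / p := by positivity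
    linarith)
  have h3 : Real.exp (2 * L⁻¹ * b) ≤ 9 ^ p := by
    have e1 : 2 * L⁻¹ * b ≤ p * 2 := by
      have : b ≤ p * L := by rw [h1]; nlinarith
      calc 2 * L⁻¹ * b ≤ 2 * L⁻¹ * (p * L) := by gcongr
        _ = p * 2 := by field_simp
    refine (Real.exp_le_exp.2 e1).trans ?_
    rw [Real.exp_nat_mul]
    have e2 : Real.exp 2 ≤ 9 := by
      have : Real.exp 2 = Real.exp 1 ^ 2 := by rw [← Real.exp_nat_mul]; norm_num
      rw [this]
      nlinarith [Real.exp_one_lt_d9, Real.exp_pos 1]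
    gcongr
  calc _ ≤ ∑ d, W d * ((p * L) ^ p * Real.exp (L⁻¹ * F d)) := by
        gcongr with d _
        · exact hW d
        · have := pow_le_mul_exp_div (hF d) hL0 p
          rwa [div_eq_inv_mul] at this
    _ = (p * L) ^ p * ∑ d, W d * Real.exp (L⁻¹ * F d) := by
        rw [Finset.mul_sum]
        exact Finset.sum_congr rfl fun d _ => by ring
    _ ≤ (p * L) ^ p * 9 ^ p := by gcongr; exact h2.trans h3
    _ = _ := by rw [h1, mul_pow 9, mul_comm]

lemma sum_filter_lt_le {D : Type*} [Fintype D] {W F : D → ℝ} (hW : ∀ d, 0 ≤ W d)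
    (hF : ∀ d, 0 ≤ F d) {a b : ℝ} (ha : 0 < a) (h : ∑ d, W d * F d ≤ a * b)
    [DecidablePred fun d => a < F d] : ∑ d with a < F d, W d ≤ b := by
  have h1 : a * ∑ d with a < F d, W d ≤ ∑ d, W d * F d := by
    rw [Finset.mul_sum]
    calc _ ≤ ∑ d with a < F d, W d * F d := by
          refine Finset.sum_le_sum fun d hd => ?_
          rw [mul_comm]
          exact mul_le_mul_of_nonneg_left (Finset.mem_filter.1 hd).2.le (hW d)
      _ ≤ _ := Finset.sum_le_sum_of_subset_of_nonneg (Finset.filter_subset _ _)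
          fun d _ _ => mul_nonneg (hW d) (hF d)
  exact le_of_mul_le_mul_left (h1.trans h) ha

/-- The regularity of a sparsity pattern that makes the sketch work: light rows, and small
moments of the weighted overlaps. -/
structure IsGoodPattern (d : J → Finset I) (u : J → K) (α : J → ℝ) (s p : ℕ) (B B' : ℝ) :
    Prop where
  card_eq : ∀ j, (d j).card = s
  row_le : ∀ i, (∑ j, if i ∈ d j then ‖u j‖ ^ 2 else 0) ≤ B
  overlap_frame : ∑ j, ‖u j‖ ^ 2 * overlap d u j ^ p ≤ (∑ j, ‖u j‖ ^ 2) * B' ^ p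
  overlap_vec : ∑ j, α j ^ 2 * overlap d u j ^ p ≤ (∑ j, α j ^ 2) * B' ^ p

open Classical in
-- The thresholds are 36 = 4 · 9 times the moment scale, so Markov's inequality for p-th powers
-- costs 4⁻ᵖ per event. There is one event for each row and one for each weighted overlap average.
-- Averaging over columns, instead of taking a maximum, keeps their number out of the bound.
lemma IsPatternLaw.sum_not_isGoodPattern_le (hq : IsPatternLaw q s θ) (hθ : 0 ≤ θ)
    (α : J → ℝ) {M : ℝ} (hM : 0 < M) (hu : ∀ j, ‖u j‖ ^ 2 ≤ M) {p : ℕ} (hp : p ≠ 0) :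
    ∑ d with ¬ IsGoodPattern d u α s p (36 * (p * M + θ * ∑ j, ‖u j‖ ^ 2))
        (36 * (p * M + θ * s * ∑ j, ‖u j‖ ^ 2)), ∏ j, q j (d j)
      ≤ (Fintype.card I + 2) * (1 / 4) ^ p := by
  have hp' : (0 : ℝ) < p := by exact_mod_cast Nat.pos_of_ne_zero hp
  set r := ∑ j, ‖u j‖ ^ 2 with hr
  have hr0 : 0 ≤ r := Finset.sum_nonneg fun j _ => by positivity
  set B := p * M + θ * r with hB
  set B' := p * M + θ * s * r with hB'
  have hB0 : 0 < B := by positivity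
  have hB'0 : 0 < B' := by positivity
  set W : (J → Finset I) → ℝ := fun d => ∏ j, q j (d j) with hW
  have hW0 : ∀ d, 0 ≤ W d := hq.prod_nonneg
  have hlu : ∀ l : ℝ, 0 ≤ l → l * M ≤ 1 → ∀ j, l * ‖u j‖ ^ 2 ≤ 1 := fun l hl hl1 j =>
    (mul_le_mul_of_nonneg_left (hu j) hl).trans hl1
  let F : I → (J → Finset I) → ℝ := fun i d => ∑ j, if i ∈ d j then ‖u j‖ ^ 2 else 0
  have hF0 : ∀ i d, 0 ≤ F i d := fun i d => Finset.sum_nonneg fun j _ => by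
    split_ifs <;> positivity
  have hrow : ∀ i, ∑ d, W d * F i d ^ p ≤ (9 * B) ^ p := fun i =>
    sum_mul_pow_le_of_exp hW0 (hF0 i) hM (by positivity)
      (fun l hl hl1 => hq.sum_mul_exp_rowSum_le hθ hl (hlu l hl hl1) i) hp
  have hov : ∀ j, ∑ d, W d * overlap d u j ^ p ≤ (9 * B') ^ p := fun j =>
    sum_mul_pow_le_of_exp hW0 (fun d => overlap_nonneg d u j) hM (by positivity)
      (fun l hl hl1 => hq.sum_mul_exp_overlap_le hθ hl (hlu l hl hl1) j) hp
  have h36 : ∀ b : ℝ, (9 * b) ^ p = (36 * b) ^ p * (1 / 4) ^ p := fun b => by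
    rw [← mul_pow]; congr 1; ring
  have hw : ∀ w : J → ℝ, (∀ j, 0 ≤ w j) →
      ∑ d with (∑ j, w j) * (36 * B') ^ p < ∑ j, w j * overlap d u j ^ p, W d ≤ (1 / 4) ^ p := by
    intro w hw
    rcases (Finset.sum_nonneg fun j (_ : j ∈ Finset.univ) => hw j).eq_or_lt with h0 | h0
    · have h1 : ∀ j, w j = 0 := fun j =>
        (Finset.sum_eq_zero_iff_of_nonneg fun j _ => hw j).1 h0.symm j (Finset.mem_univ j)
      simp only [h1, Finset.sum_const_zero, zero_mul, lt_irrefl, Finset.filter_false,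
        Finset.sum_empty]
      positivity
    · refine sum_filter_lt_le hW0
        (fun d => Finset.sum_nonneg fun j _ => mul_nonneg (hw j)
          (pow_nonneg (overlap_nonneg d u j) p)) (by positivity) ?_
      calc _ = ∑ j, w j * ∑ d, W d * overlap d u j ^ p := by
            simp only [Finset.mul_sum]
            rw [Finset.sum_comm]
            exact Finset.sum_congr rfl fun j _ => Finset.sum_congr rfl fun d _ => by ring
        _ ≤ ∑ j, w j * (9 * B') ^ p := by
            gcongr with j _
            · exact hw j
            · exact hov j
        _ = _ := by rw [← Finset.sum_mul, h36]; ring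
  have hrow' : ∀ i, ∑ d with (36 * B) ^ p < F i d ^ p, W d ≤ (1 / 4) ^ p := fun i =>
    sum_filter_lt_le hW0 (fun d => pow_nonneg (hF0 i d) p) (by positivity)
      ((hrow i).trans_eq (h36 B))
  have h1 := hw (fun j => ‖u j‖ ^ 2) (fun j => by positivity)
  have h2 := hw (fun j => α j ^ 2) (fun j => by positivity)
  have hpt : ∀ d, (if ¬ IsGoodPattern d u α s p (36 * B) (36 * B') then W d else 0)
      ≤ ∑ i, (if (36 * B) ^ p < F i d ^ p then W d else 0)
        + (if (∑ j, ‖u j‖ ^ 2) * (36 * B') ^ p < ∑ j, ‖u j‖ ^ 2 * overlap d u j ^ p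
          then W d else 0)
        + (if (∑ j, α j ^ 2) * (36 * B') ^ p < ∑ j, α j ^ 2 * overlap d u j ^ p
          then W d else 0) := by
    intro d
    have n1 : ∀ i, 0 ≤ (if (36 * B) ^ p < F i d ^ p then W d else 0) := fun i => by
      split_ifs; exacts [hW0 d, le_rfl]
    have n2 := Finset.sum_nonneg fun i (_ : i ∈ Finset.univ) => n1 i
    -- The column sizes are known only on patterns of positive probability.
    by_cases hWd : W d = 0
    · simp [hWd]
    by_cases c2 : (∑ j, ‖u j‖ ^ 2) * (36 * B') ^ p < ∑ j, ‖u j‖ ^ 2 * overlap d u j ^ p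
    · rw [if_pos c2]
      have := hW0 d
      split_ifs <;> linarith
    by_cases c3 : (∑ j, α j ^ 2) * (36 * B') ^ p < ∑ j, α j ^ 2 * overlap d u j ^ p
    · rw [if_pos c3]
      have := hW0 d
      split_ifs <;> linarith
    rw [if_neg c2, if_neg c3, add_zero, add_zero]
    by_cases c1 : ∃ i, (36 * B) ^ p < F i d ^ p
    · obtain ⟨i, hi⟩ := c1
      have := Finset.single_le_sum (fun i _ => n1 i) (Finset.mem_univ i)
      rw [if_pos hi] at this
      refine le_trans ?_ this
      have := hW0 d
      split_ifs <;> linarith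
    · push Not at c1 c2 c3
      have hg : IsGoodPattern d u α s p (36 * B) (36 * B') := by
        refine ⟨fun j => hq.card_eq j _ fun h => hWd ?_, fun i => ?_, c2, c3⟩
        · exact Finset.prod_eq_zero (Finset.mem_univ j) h
        · exact (pow_le_pow_iff_left₀ (hF0 i d) (by positivity) hp).1 (c1 i)
      rw [if_neg (not_not.2 hg)]
      exact n2
  rw [Finset.sum_filter] at h1 h2 ⊢
  refine (Finset.sum_le_sum fun d _ => hpt d).trans ?_
  rw [Finset.sum_add_distrib, Finset.sum_add_distrib, Finset.sum_comm]
  have h3 : ∑ i, ∑ d, (if (36 * B) ^ p < F i d ^ p then W d else 0)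
      ≤ ∑ i : I, (1 / 4 : ℝ) ^ p := Finset.sum_le_sum fun i _ => by
    rw [← Finset.sum_filter]; exact hrow' i
  rw [Finset.sum_const, Finset.card_univ, nsmul_eq_mul] at h3
  linarith

end Selector

/-! ### From moments to the failure probability of the sparse sketch. -/

section SparseSketch

variable {I J : Type*} [Fintype I] [Fintype J] [DecidableEq I] [DecidableEq J]
  {H : Type*} [NormedAddCommGroup H] [InnerProductSpace ℝ H]
  {d : J → Finset I} {u : J → H} {α : J → ℝ} {s : ℕ} {B B' : ℝ}

lemma card_filter_lt_mul_le {D : Type*} [Fintype D] {F : D → ℝ} (hF : ∀ x, 0 ≤ F x) (a : ℝ)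
    [DecidablePred fun x => a < F x] :
    ((Finset.univ.filter fun x => a < F x).card : ℝ) * a ≤ ∑ x, F x := by
  rw [← nsmul_eq_mul]
  refine (Finset.card_nsmul_le_sum _ F a fun x hx => (Finset.mem_filter.1 hx).2.le).trans ?_
  exact Finset.sum_le_sum_of_subset_of_nonneg (Finset.filter_subset _ _) fun x _ _ => hF x

/-- The trace of an even power dominates that power of each eigenvalue. -/
lemma abs_inner_le_of_trace_pow_le [FiniteDimensional ℝ H] {X : Module.End ℝ H}
    (hX : X.IsSymmetric) {p : ℕ} (hp : p ≠ 0)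
    (h : LinearMap.trace ℝ H (X ^ (2 * p)) ≤ (1 / 2) ^ (2 * p)) (y : H) :
    |inner ℝ y (X y)| ≤ ‖y‖ ^ 2 / 2 := by
  have h1 : ∀ i, |hX.eigenvalues rfl i| ≤ 1 / 2 := by
    intro i
    rw [hX.trace_pow] at h
    have h2 := (Finset.single_le_sum (f := fun i => hX.eigenvalues rfl i ^ (2 * p))
      (fun j _ => (even_two_mul p).pow_nonneg _) (Finset.mem_univ i)).trans h
    rw [← (even_two_mul p).pow_abs] at h2
    exact (pow_le_pow_iff_left₀ (abs_nonneg _) (by norm_num) (by positivity)).1 h2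
  have h2 := hX.inner_pow_apply_self 1 y
  have h3 := hX.inner_pow_apply_self 0 y
  simp only [pow_one, pow_zero, one_mul, Module.End.one_apply, real_inner_self_eq_norm_sq] at h2 h3
  rw [h2, h3, Finset.sum_div]
  refine (Finset.abs_sum_le_sum_abs _ _).trans (Finset.sum_le_sum fun i _ => ?_)
  rw [abs_mul, abs_of_nonneg (sq_nonneg (inner ℝ _ y))]
  nlinarith [h1 i, sq_nonneg (inner ℝ (hX.eigenvectorBasis rfl i) y)]

/-- The event on which the sketch with pattern `d` and signs `τ` is accurate. -/
def IsGoodSketch (d : J → Finset I) (s : ℕ) (u : J → H) (α : J → ℝ) (t : ℝ)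
    (τ : I × J → ℤˣ) : Prop :=
  (∀ y, |inner ℝ y (sketchOp d s u τ y)| ≤ ‖y‖ ^ 2 / 2) ∧ ‖sketchChaos d s α u τ‖ ≤ t

open Classical in
-- Markov's inequality is applied twice, to the trace moment at level (1/2)^(2p) and to the norm
-- moment of the chaos. The smallness assumptions put both moment bounds a factor 16⁻ᵖ below their
-- thresholds, up to the constants and the rank.
lemma card_not_isGoodSketch_le [FiniteDimensional ℝ H] (hs : s ≠ 0)
    (hu : ∀ x, ∑ j, inner ℝ (u j) x • u j = x) {p : ℕ} (hp : p ≠ 0)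
    (hd : IsGoodPattern d u α s p B B') (hB : 0 ≤ B) (hB' : 0 ≤ B')
    (hsmall : 5000 * (p * B) ≤ s) {t : ℝ} (ht0 : 0 < t) (ht1 : t ≤ 1 / 2)
    (hsmall' : 64 * p ^ 2 * B' / s ^ 2 ≤ t ^ 2 / 16) :
    ((Finset.univ.filter fun τ => ¬ IsGoodSketch d s u α (t * √(∑ j, α j ^ 2)) τ).card : ℝ)
      ≤ Fintype.card (I × J → ℤˣ) * ((2 * Module.finrank ℝ H + 2) * (1 / 16) ^ p) := by
  obtain ⟨q, rfl⟩ := Nat.exists_eq_succ_of_ne_zero hp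
  have hs' : (0 : ℝ) < s := by exact_mod_cast Nat.pos_of_ne_zero hs
  have hpc : ((q.succ : ℕ) : ℝ) = (q : ℝ) + 1 := by push_cast; ring
  rw [hpc] at hsmall hsmall'
  rw [Nat.succ_eq_add_one] at *
  set N : ℝ := (Fintype.card (I × J → ℤˣ) : ℝ) with hN
  set r : ℝ := (Module.finrank ℝ H : ℝ) with hr
  have hr' : ∑ j, ‖u j‖ ^ 2 = r := sum_norm_sq_eq_finrank hu
  have hov : ∀ j, 0 ≤ overlap d u j := overlap_nonneg d u
  set E1 := Finset.univ.filter fun τ : I × J → ℤˣ =>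
    ((1 : ℝ) / 2) ^ (2 * (q + 1)) < LinearMap.trace ℝ H (sketchOp d s u τ ^ (2 * (q + 1)))
  set E2 := Finset.univ.filter fun τ : I × J → ℤˣ => t * √(∑ j, α j ^ 2) < ‖sketchChaos d s α u τ‖
  have hsub : (Finset.univ.filter fun τ => ¬ IsGoodSketch d s u α (t * √(∑ j, α j ^ 2)) τ)
      ⊆ E1 ∪ E2 := by
    intro τ hτ
    have h1 := (Finset.mem_filter.1 hτ).2
    rw [Finset.mem_union, Finset.mem_filter, Finset.mem_filter]
    by_contra hcon
    push Not at hcon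
    exact h1 ⟨abs_inner_le_of_trace_pow_le (sketchOp_isSymmetric d s u τ) (Nat.succ_ne_zero q)
      (hcon.1 (Finset.mem_univ _)), hcon.2 (Finset.mem_univ _)⟩
  have hE1 : (E1.card : ℝ) ≤ N * (2 * r * (1 / 16) ^ (q + 1)) := by
    have h1 := card_filter_lt_mul_le (F := fun τ =>
      LinearMap.trace ℝ H (sketchOp d s u τ ^ (2 * (q + 1)))) (fun τ => by
        rw [(sketchOp_isSymmetric d s u τ).trace_pow]
        exact Finset.sum_nonneg fun i _ => (even_two_mul (q + 1)).pow_nonneg _)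
      (((1 : ℝ) / 2) ^ (2 * (q + 1)))
    have h2 := sum_trace_sketchOp_pow_le hs hd.card_eq hu hd.row_le hB hsmall
    have h3 : ∑ j, ‖u j‖ ^ 2 * (64 * ((q : ℝ) + 1) ^ 2 * overlap d u j / s ^ 2) ^ (q + 1)
        ≤ r * (1 / 64) ^ (q + 1) := by
      have e1 : ∀ j, ‖u j‖ ^ 2 * (64 * ((q : ℝ) + 1) ^ 2 * overlap d u j / s ^ 2) ^ (q + 1)
          = (64 * ((q : ℝ) + 1) ^ 2 / s ^ 2) ^ (q + 1) * (‖u j‖ ^ 2 * overlap d u j ^ (q + 1)) := by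
        intro j
        rw [mul_left_comm, ← mul_pow]; congr 2; ring
      simp only [e1]
      rw [← Finset.mul_sum]
      calc _ ≤ (64 * ((q : ℝ) + 1) ^ 2 / s ^ 2) ^ (q + 1) * (r * B' ^ (q + 1)) := by
            rw [← hr']
            exact mul_le_mul_of_nonneg_left hd.overlap_frame (by positivity)
        _ = r * (64 * ((q : ℝ) + 1) ^ 2 * B' / s ^ 2) ^ (q + 1) := by
            rw [mul_left_comm, ← mul_pow]; congr 2; ring
        _ ≤ _ := by
            refine mul_le_mul_of_nonneg_left (pow_le_pow_left₀ (by positivity)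
              (hsmall'.trans ?_) _) (by positivity)
            nlinarith
    have h4 : ((1 : ℝ) / 8) ^ (2 * (q + 1)) = (1 / 64) ^ (q + 1) := by
      rw [pow_mul]; norm_num
    have h5 : ((1 : ℝ) / 2) ^ (2 * (q + 1)) = (1 / 4) ^ (q + 1) := by
      rw [pow_mul]; norm_num
    rw [h4] at h2
    have h6 : ((1 : ℝ) / 64) ^ (q + 1) = (1 / 16) ^ (q + 1) * (1 / 4) ^ (q + 1) := by
      rw [← mul_pow]; norm_num
    have h7 : (E1.card : ℝ) * (1 / 4) ^ (q + 1)
        ≤ N * (2 * r * (1 / 16) ^ (q + 1)) * (1 / 4) ^ (q + 1) := by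
      rw [← h5]
      refine (h1.trans h2).trans ?_
      rw [h5]
      calc _ ≤ N * (r * (1 / 64) ^ (q + 1) + r * (1 / 64) ^ (q + 1)) := by gcongr
        _ = _ := by rw [h6]; ring
    exact le_of_mul_le_mul_right h7 (by positivity)
  have hE2 : (E2.card : ℝ) ≤ N * (2 * (1 / 16) ^ (q + 1)) := by
    set a := ∑ j, α j ^ 2 with ha
    have ha0 : 0 ≤ a := Finset.sum_nonneg fun j _ => sq_nonneg _
    rcases ha0.eq_or_lt with h0 | h0
    · have hα : ∀ j, α j = 0 := fun j => by
        have := (Finset.sum_eq_zero_iff_of_nonneg fun j _ => sq_nonneg (α j)).1 (ha ▸ h0.symm) j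
          (Finset.mem_univ j)
        simpa using this
      have : E2 = ∅ := by
        refine Finset.filter_eq_empty_iff.2 fun τ _ => ?_
        simp [sketchChaos, signRow, hα]
      rw [this]
      simp only [Finset.card_empty, Nat.cast_zero]
      positivity
    -- Good patterns control the weighted p-th moment of the overlaps, whereas the chaos bound needs
    -- their mean; Jensen's inequality passes from one to the other.
    · have hS : ∑ j, α j ^ 2 * overlap d u j ≤ a * B' := by
        have h1 := Real.pow_arith_mean_le_arith_mean_pow Finset.univ (fun j => α j ^ 2 / a)
          (overlap d u) (fun j _ => by positivity) (by rw [← Finset.sum_div, ← ha, div_self h0.ne'])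
          (fun j _ => hov j) (q + 1)
        have e1 : ∀ F : J → ℝ, ∑ j, α j ^ 2 / a * F j = (∑ j, α j ^ 2 * F j) / a := fun F => by
          rw [Finset.sum_div]; exact Finset.sum_congr rfl fun j _ => by ring
        rw [e1, e1] at h1
        have h2 : (∑ j, α j ^ 2 * overlap d u j ^ (q + 1)) / a ≤ B' ^ (q + 1) := by
          rw [div_le_iff₀ h0, mul_comm]; exact hd.overlap_vec
        have h3 := (pow_le_pow_iff_left₀ (div_nonneg (Finset.sum_nonneg fun j _ =>
          mul_nonneg (sq_nonneg _) (hov j)) ha0) hB' (Nat.succ_ne_zero q)).1 (h1.trans h2)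
        rwa [div_le_iff₀ h0, mul_comm] at h3
      have hE : E2 = Finset.univ.filter fun τ : I × J → ℤˣ =>
          (t ^ 2 * a) ^ (q + 1) < ‖sketchChaos d s α u τ‖ ^ (2 * (q + 1)) := by
        refine Finset.filter_congr fun τ _ => ?_
        have e1 : (t ^ 2 * a) ^ (q + 1) = (t * √a) ^ (2 * (q + 1)) := by
          rw [pow_mul, mul_pow t, Real.sq_sqrt ha0]
        rw [e1]
        exact (pow_lt_pow_iff_left₀ (by positivity) (norm_nonneg _) (by positivity)).symm
      have h1 := card_filter_lt_mul_le (F := fun τ => ‖sketchChaos d s α u τ‖ ^ (2 * (q + 1)))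
        (fun τ => by positivity) ((t ^ 2 * a) ^ (q + 1))
      rw [← hE] at h1
      have h2 := sum_norm_sketchChaos_pow_le d hs hd.card_eq α u q
      have h3 : (64 * ((q : ℝ) + 1) ^ 2 * (∑ j, α j ^ 2 * overlap d u j) / s ^ 2) ^ (q + 1)
          ≤ (1 / 16) ^ (q + 1) * (t ^ 2 * a) ^ (q + 1) := by
        rw [← mul_pow]
        have h4 : 0 ≤ ∑ j, α j ^ 2 * overlap d u j := Finset.sum_nonneg fun j _ =>
          mul_nonneg (sq_nonneg _) (hov j)
        refine pow_le_pow_left₀ (by positivity) ?_ _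
        calc _ ≤ 64 * ((q : ℝ) + 1) ^ 2 * (a * B') / s ^ 2 := by gcongr
          _ = a * (64 * ((q : ℝ) + 1) ^ 2 * B' / s ^ 2) := by ring
          _ ≤ a * (t ^ 2 / 16) := by gcongr
          _ = _ := by ring
      have h7 : (E2.card : ℝ) * (t ^ 2 * a) ^ (q + 1)
          ≤ N * (2 * (1 / 16) ^ (q + 1)) * (t ^ 2 * a) ^ (q + 1) := by
        refine (h1.trans h2).trans ?_
        calc _ ≤ 2 * N * ((1 / 16) ^ (q + 1) * (t ^ 2 * a) ^ (q + 1)) := by gcongr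
          _ = _ := by ring
      exact le_of_mul_le_mul_right h7 (by positivity)
  have h1 : ((Finset.univ.filter fun τ => ¬ IsGoodSketch d s u α (t * √(∑ j, α j ^ 2)) τ).card : ℝ)
      ≤ E1.card + E2.card := by
    exact_mod_cast (Finset.card_le_card hsub).trans (Finset.card_union_le _ _)
  refine h1.trans ((add_le_add hE1 hE2).trans (le_of_eq ?_))
  ring

open Classical in
/-- The probability that a random sparse sign sketch is inaccurate. -/
lemma IsPatternLaw.sum_card_not_isGoodSketch_le [FiniteDimensional ℝ H]
    {q : J → Finset I → ℝ} {θ : ℝ} (hq : IsPatternLaw q s θ) (hθ : 0 ≤ θ) (hs : s ≠ 0)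
    (hu : ∀ x, ∑ j, inner ℝ (u j) x • u j = x) (α : J → ℝ) {M : ℝ} (hM : 0 < M)
    (huM : ∀ j, ‖u j‖ ^ 2 ≤ M) {p : ℕ} (hp : p ≠ 0)
    (hsmall : 5000 * (p * (36 * (p * M + θ * Module.finrank ℝ H))) ≤ s)
    {t : ℝ} (ht0 : 0 < t) (ht1 : t ≤ 1 / 2)
    (hsmall' : 64 * p ^ 2 * (36 * (p * M + θ * s * Module.finrank ℝ H)) / s ^ 2 ≤ t ^ 2 / 16) :
    ∑ d : J → Finset I, (∏ j, q j (d j)) *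
        ((Finset.univ.filter fun τ => ¬ IsGoodSketch d s u α (t * √(∑ j, α j ^ 2)) τ).card : ℝ)
      ≤ Fintype.card (I × J → ℤˣ) * ((Fintype.card I + 2) * (1 / 4) ^ p
        + (2 * Module.finrank ℝ H + 2) * (1 / 16) ^ p) := by
  set N : ℝ := (Fintype.card (I × J → ℤˣ) : ℝ) with hN
  set c : (J → Finset I) → ℝ := fun d =>
    ((Finset.univ.filter fun τ => ¬ IsGoodSketch d s u α (t * √(∑ j, α j ^ 2)) τ).card : ℝ) with hc
  have hW0 := hq.prod_nonneg
  have hbad := hq.sum_not_isGoodPattern_le hθ α hM huM hp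
  rw [sum_norm_sq_eq_finrank hu] at hbad
  set r : ℝ := (Module.finrank ℝ H : ℝ) with hr
  have hcN : ∀ d, c d ≤ N := fun d => by
    simp only [hc, hN]
    exact_mod_cast Finset.card_filter_le _ _
  set G : (J → Finset I) → Prop := fun d =>
    IsGoodPattern d u α s p (36 * (p * M + θ * r)) (36 * (p * M + θ * s * r))
  have hgood : ∀ d, G d → c d ≤ N * ((2 * r + 2) * (1 / 16) ^ p) := fun d hd =>
    card_not_isGoodSketch_le hs hu hp hd (by positivity) (by positivity) hsmall ht0 ht1 hsmall'
  have hpt : ∀ d, (∏ j, q j (d j)) * c d ≤ N * (if ¬ G d then ∏ j, q j (d j) else 0)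
      + N * ((2 * r + 2) * (1 / 16) ^ p) * ∏ j, q j (d j) := by
    intro d
    have h0 : 0 ≤ N * ((2 * r + 2) * (1 / 16) ^ p) * ∏ j, q j (d j) :=
      mul_nonneg (by positivity) (hW0 d)
    by_cases hd : G d
    · rw [if_neg (not_not.2 hd)]
      have := mul_le_mul_of_nonneg_left (hgood d hd) (hW0 d)
      linarith
    · rw [if_pos hd]
      have := mul_le_mul_of_nonneg_left (hcN d) (hW0 d)
      linarith
  refine (Finset.sum_le_sum fun d _ => hpt d).trans ?_
  rw [Finset.sum_add_distrib, ← Finset.mul_sum, ← Finset.mul_sum, hq.sum_prod, ← Finset.sum_filter]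
  have := mul_le_mul_of_nonneg_left hbad (by positivity : 0 ≤ N)
  linarith

end SparseSketch

/-! ### Reduction of the random matrix models to finite averages -/

section Reduction

variable {Ω : Type*} [MeasurableSpace Ω] {P : Measure Ω} [IsProbabilityMeasure P] {m n : ℕ}
  {σ δ : Fin m → Fin n → Ω → ℝ} {s : ℕ}

/-- Subadditivity alone is used, so the event may be nonmeasurable. -/
lemma one_sub_le_measureReal_of_compl {E : Set Ω} {η : ℝ} (h : P.real Eᶜ ≤ η) :
    1 - η ≤ P.real E := by
  have h1 := measureReal_union_le (μ := P) E Eᶜ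
  rw [Set.union_compl_self, probReal_univ] at h1
  linarith

lemma IsRademacherMatrix.measure_eq (hσ : IsRademacherMatrix P σ) (τ : Fin m × Fin n → ℤˣ) :
    P {ω | ∀ i j, σ i j ω = signVal (τ (i, j))} = (1 / 2) ^ (m * n) := by
  have h := hσ.indep.measure_inter_preimage_eq_mul Finset.univ
    (sets := fun e => {signVal (τ e)}) fun e _ => measurableSet_singleton _
  have e1 : {ω | ∀ i j, σ i j ω = signVal (τ (i, j))}
      = ⋂ e ∈ (Finset.univ : Finset (Fin m × Fin n)), (σ e.1 e.2) ⁻¹' {signVal (τ e)} := by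
    ext ω; simp
  rw [e1, h]
  have e2 : ∀ e : Fin m × Fin n, P ((σ e.1 e.2) ⁻¹' {signVal (τ e)}) = 1 / 2 := by
    intro e
    rcases signVal_eq_one_or (τ e) with h | h <;> rw [h]
    · exact hσ.prob_one e.1 e.2
    · exact hσ.prob_neg_one e.1 e.2
  simp [e2]

lemma IsRademacherMatrix.measureReal_eq (hσ : IsRademacherMatrix P σ)
    (τ : Fin m × Fin n → ℤˣ) :
    P.real {ω | ∀ i j, σ i j ω = signVal (τ (i, j))}
      = 1 / (Fintype.card (Fin m × Fin n → ℤˣ) : ℝ) := by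
  rw [measureReal_def, hσ.measure_eq]
  simp

lemma IsRademacherMatrix.ae_exists_sign (hσ : IsRademacherMatrix P σ) :
    ∀ᵐ ω ∂P, ∃ τ : Fin m × Fin n → ℤˣ, ∀ i j, σ i j ω = signVal (τ (i, j)) := by
  have h : ∀ i j, ∀ᵐ ω ∂P, σ i j ω = 1 ∨ σ i j ω = -1 := by
    intro i j
    have hm1 : MeasurableSet {ω | σ i j ω = 1} := hσ.measurable i j (measurableSet_singleton _)
    have hm2 : MeasurableSet {ω | σ i j ω = -1} := hσ.measurable i j (measurableSet_singleton _)
    have hd : Disjoint {ω | σ i j ω = 1} {ω | σ i j ω = -1} := by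
      rw [Set.disjoint_left]
      intro ω h1 h2
      rw [Set.mem_ofPred_eq] at h1 h2
      linarith
    have : P ({ω | σ i j ω = 1} ∪ {ω | σ i j ω = -1}) = 1 := by
      rw [measure_union hd hm2, hσ.prob_one, hσ.prob_neg_one, one_div, ENNReal.inv_two_add_inv_two]
    exact (prob_compl_eq_zero_iff (hm1.union hm2)).2 this
  have h2 : ∀ᵐ ω ∂P, ∀ i j, σ i j ω = 1 ∨ σ i j ω = -1 := by
    rw [ae_all_iff]; intro i
    rw [ae_all_iff]; exact h i
  filter_upwards [h2] with ω hω
  refine ⟨fun e => if σ e.1 e.2 ω = 1 then 1 else -1, fun i j => ?_⟩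
  rcases hω i j with h | h
  · simp [h, signVal]
  · have : ¬ ((-1 : ℝ) = 1) := by norm_num
    simp [h, signVal, this]

open Classical in
-- Up to a null set the complement of E is covered by the atoms of the bad sign vectors, each of the
-- same mass; the union bound asks no measurability of E.
lemma IsRademacherMatrix.measureReal_compl_le (hσ : IsRademacherMatrix P σ)
    (Good : (Fin m × Fin n → ℤˣ) → Prop) {E : Set Ω}
    (h : ∀ ω τ, (∀ i j, σ i j ω = signVal (τ (i, j))) → Good τ → ω ∈ E) :
    P.real Eᶜ ≤ (Finset.univ.filter fun τ => ¬ Good τ).card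
      / (Fintype.card (Fin m × Fin n → ℤˣ) : ℝ) := by
  set U : Set Ω := ⋃ τ ∈ Finset.univ.filter fun τ => ¬ Good τ,
    {ω | ∀ i j, σ i j ω = signVal (τ (i, j))} with hU
  have h1 : P.real Eᶜ ≤ P.real U := by
    refine ENNReal.toReal_mono (measure_ne_top _ _) (measure_mono_ae ?_)
    filter_upwards [hσ.ae_exists_sign] with ω ⟨τ, hτ⟩ hω
    refine Set.mem_biUnion (x := τ) ?_ hτ
    simpa using fun hg => hω (h ω τ hτ hg)
  refine h1.trans ((measureReal_biUnion_finset_le _ _).trans (le_of_eq ?_))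
  simp only [hσ.measureReal_eq, Finset.sum_const, nsmul_eq_mul]
  ring

/-- The law of the `j`-th column support of a sparse selector. -/
noncomputable def columnLaw (P : Measure Ω) (δ : Fin m → Fin n → Ω → ℝ) (j : Fin n)
    (c : Finset (Fin m)) : ℝ :=
  P.real {ω | ∀ i, δ i j ω = if i ∈ c then 1 else 0}

lemma IsSparseSelector.measurableSet_col (hδ : IsSparseSelector P s δ) (j : Fin n)
    (c : Finset (Fin m)) : MeasurableSet {ω | ∀ i, δ i j ω = if i ∈ c then 1 else 0} := by
  have : {ω | ∀ i, δ i j ω = if i ∈ c then 1 else 0}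
      = ⋂ i, (δ i j) ⁻¹' {if i ∈ c then 1 else 0} := by
    ext ω; simp
  rw [this]
  exact MeasurableSet.iInter fun i => hδ.measurable i j (measurableSet_singleton _)

/-- Almost surely the column is a 0/1 vector, so the space splits into finitely many events on which
g is constant. -/
lemma IsSparseSelector.sum_columnLaw_mul (hδ : IsSparseSelector P s δ) (j : Fin n)
    (f : Finset (Fin m) → ℝ) (g : Ω → ℝ)
    (h : ∀ ω c, (∀ i, δ i j ω = if i ∈ c then 1 else 0) → g ω = f c) :
    ∑ c, columnLaw P δ j c * f c = ∫ ω, g ω ∂P := by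
  have h1 : ∀ᵐ ω ∂P, g ω
      = ∑ c, Set.indicator {ω | ∀ i, δ i j ω = if i ∈ c then 1 else 0} (fun _ => f c) ω := by
    filter_upwards [hδ.zero_or_one] with ω hω
    set c := Finset.univ.filter fun i => δ i j ω = 1 with hc
    have hcω : ∀ i, δ i j ω = if i ∈ c then 1 else 0 := by
      intro i
      rcases hω i j with h | h <;> simp [hc, h]
    rw [Finset.sum_eq_single c, Set.indicator_of_mem (by exact hcω), h ω c hcω]
    · intro c' _ hc'
      refine Set.indicator_of_notMem (fun hmem => hc' ?_) _
      ext i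
      have h2 := (hmem i).symm.trans (hcω i)
      by_cases h3 : i ∈ c' <;> by_cases h4 : i ∈ c <;> simp_all
    · simp
  rw [integral_congr_ae h1, integral_finsetSum]
  · refine Finset.sum_congr rfl fun c _ => ?_
    rw [integral_indicator_const _ (hδ.measurableSet_col j c), columnLaw, smul_eq_mul]
  · intro c _
    exact (integrable_const _).indicator (hδ.measurableSet_col j c)

lemma IsSparseSelector.isPatternLaw (hδ : IsSparseSelector P s δ) :
    IsPatternLaw (columnLaw P δ) s ((s : ℝ) / m) where
  nonneg j c := measureReal_nonneg
  sum_eq_one j := by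
    have := hδ.sum_columnLaw_mul j (fun _ => 1) (fun _ => 1) fun _ _ _ => rfl
    simpa using this
  card_eq j c hc := by
    by_contra hne
    refine hc ?_
    rw [columnLaw, measureReal_def]
    have : P {ω | ∀ i, δ i j ω = if i ∈ c then 1 else 0} = 0 := by
      rw [measure_eq_zero_iff_ae_notMem]
      filter_upwards [hδ.col_sum] with ω hω hmem
      have h1 := hω j
      simp only [hmem, Finset.sum_ite_mem, Finset.univ_inter, Finset.sum_const, nsmul_eq_mul,
        mul_one] at h1
      exact hne (by exact_mod_cast h1)
    rw [this, ENNReal.toReal_zero]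
  sum_superset_le j S := by
    have h1 := hδ.sum_columnLaw_mul j (fun c => if S ⊆ c then 1 else 0)
      (fun ω => ∏ i ∈ S, δ i j ω) fun ω c hc => by
        simp only [hc]
        split_ifs with h
        · exact Finset.prod_eq_one fun i hi => if_pos (h hi)
        · obtain ⟨i, hi, hic⟩ := Finset.not_subset.1 h
          exact Finset.prod_eq_zero hi (if_neg hic)
    have h2 := hδ.neg_correlated j S
    simp only [hδ.mean, Finset.prod_const] at h2
    rw [← h1] at h2
    simpa using h2

lemma IsSparseSelector.measureReal_eq (hδ : IsSparseSelector P s δ) (d : Fin n → Finset (Fin m)) :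
    P.real {ω | ∀ i j, δ i j ω = if i ∈ d j then 1 else 0} = ∏ j, columnLaw P δ j (d j) := by
  have h := hδ.indep_columns.measure_inter_preimage_eq_mul Finset.univ
    (sets := fun j => {fun i => if i ∈ d j then (1 : ℝ) else 0}) fun e _ => measurableSet_singleton _
  have e1 : {ω | ∀ i j, δ i j ω = if i ∈ d j then 1 else 0}
      = ⋂ j ∈ (Finset.univ : Finset (Fin n)),
        (fun ω i => δ i j ω) ⁻¹' {fun i => if i ∈ d j then (1 : ℝ) else 0} := by
    ext ω
    simp only [Set.mem_ofPred_eq, Finset.mem_univ, Set.iInter_true, Set.mem_iInter,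
      Set.mem_preimage, Set.mem_singleton_iff, funext_iff]
    exact forall_comm
  rw [measureReal_def, e1, h, ENNReal.toReal_prod]
  refine Finset.prod_congr rfl fun j _ => ?_
  rw [columnLaw, measureReal_def]
  congr 2
  ext ω
  simp [funext_iff]

open Classical in
-- The atoms are now pairs of a pattern and a sign vector; by independence their masses are
-- products.
lemma measureReal_compl_le_of_sparse (hσ : IsRademacherMatrix P σ) (hδ : IsSparseSelector P s δ)
    (hind : IndepFun (fun (ω : Ω) (i : Fin m) (j : Fin n) => σ i j ω)
      (fun (ω : Ω) (i : Fin m) (j : Fin n) => δ i j ω) P)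
    (Good : (Fin n → Finset (Fin m)) → (Fin m × Fin n → ℤˣ) → Prop) {E : Set Ω}
    (h : ∀ ω d τ, (∀ i j, σ i j ω = signVal (τ (i, j))) →
      (∀ i j, δ i j ω = if i ∈ d j then 1 else 0) → Good d τ → ω ∈ E) :
    P.real Eᶜ ≤ (∑ d : Fin n → Finset (Fin m), (∏ j, columnLaw P δ j (d j))
      * ((Finset.univ.filter fun τ => ¬ Good d τ).card : ℝ))
      / (Fintype.card (Fin m × Fin n → ℤˣ) : ℝ) := by
  set V : (Fin n → Finset (Fin m)) → (Fin m × Fin n → ℤˣ) → Set Ω := fun d τ =>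
    {ω | ∀ i j, σ i j ω = signVal (τ (i, j))} ∩ {ω | ∀ i j, δ i j ω = if i ∈ d j then 1 else 0}
  set U : Set Ω := ⋃ d ∈ (Finset.univ : Finset (Fin n → Finset (Fin m))),
    ⋃ τ ∈ Finset.univ.filter fun τ => ¬ Good d τ, V d τ with hU
  have h1 : P.real Eᶜ ≤ P.real U := by
    refine ENNReal.toReal_mono (measure_ne_top _ _) (measure_mono_ae ?_)
    filter_upwards [hσ.ae_exists_sign, hδ.zero_or_one] with ω ⟨τ, hτ⟩ hω hωE
    have hd : ∀ i j, δ i j ω = if i ∈ Finset.univ.filter (fun i => δ i j ω = 1) then 1 else 0 := by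
      intro i j
      rcases hω i j with h | h <;> simp [h]
    refine Set.mem_biUnion (x := fun j => Finset.univ.filter fun i => δ i j ω = 1)
      (Finset.mem_coe.2 (Finset.mem_univ _)) (Set.mem_biUnion (x := τ) ?_ ⟨hτ, hd⟩)
    simpa using fun hg => hωE (h ω _ τ hτ hd (by simpa using hg))
  have hV : ∀ d τ, P.real (V d τ)
      = (∏ j, columnLaw P δ j (d j)) / (Fintype.card (Fin m × Fin n → ℤˣ) : ℝ) := by
    intro d τ
    have h2 := hind.measure_inter_preimage_eq_mul {fun i j => signVal (τ (i, j))}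
      {fun i j => if i ∈ d j then (1 : ℝ) else 0} (measurableSet_singleton _)
      (measurableSet_singleton _)
    have e1 : {ω | ∀ i j, σ i j ω = signVal (τ (i, j))}
        = (fun (ω : Ω) (i : Fin m) (j : Fin n) => σ i j ω) ⁻¹' {fun i j => signVal (τ (i, j))} := by
      ext ω; simp [funext_iff]
    have e2 : {ω | ∀ i j, δ i j ω = if i ∈ d j then 1 else 0}
        = (fun (ω : Ω) (i : Fin m) (j : Fin n) => δ i j ω) ⁻¹'
          {fun i j => if i ∈ d j then (1 : ℝ) else 0} := by
      ext ω; simp [funext_iff]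
    rw [measureReal_def]
    simp only [V]
    rw [e1, e2, h2, ENNReal.toReal_mul, ← e1, ← e2, ← measureReal_def, ← measureReal_def,
      hσ.measureReal_eq, hδ.measureReal_eq]
    ring
  refine h1.trans ((measureReal_biUnion_finset_le _ _).trans ?_)
  rw [Finset.sum_div]
  refine Finset.sum_le_sum fun d _ => (measureReal_biUnion_finset_le _ _).trans (le_of_eq ?_)
  simp only [hV, Finset.sum_const, nsmul_eq_mul]
  ring

end Reduction

/-! ### Sketched regression with a sparse sign matrix -/

section Sparse

variable {m n d : ℕ}

/-- The column space is trivial, so both sketch conditions hold for every S. Treated apart, since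
the other cases use a positive leverage or r ≥ 1. -/
lemma lsObjective_le_of_rank_eq_zero (S : Matrix (Fin m) (Fin n) ℝ) {A : Matrix (Fin n) (Fin d) ℝ}
    (hA : A.rank = 0) {b : Fin n → ℝ} {xstar : Fin d → ℝ}
    (hmin : IsMinOn (lsObjective A b) Set.univ xstar) {ε : ℝ} (hε : 0 < ε) (hε1 : ε < 1)
    {xhat : Fin d → ℝ} (hx : IsMinOn (sketchedObjective S A b) Set.univ xhat) :
    lsObjective A b xhat ≤ (1 - ε) ^ (-2 : ℤ) * lsObjective A b xstar := by
  rw [← finrank_colSpace, Submodule.finrank_eq_zero] at hA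
  refine lsObjective_le_of_sketch S hmin hε hε1 ?_ ?_ hx <;> intro y hy <;>
    · rw [hA, Submodule.mem_bot] at hy
      simp [hy]

lemma maxLeverage_pos {A : Matrix (Fin n) (Fin d) ℝ} (hA : A.rank ≠ 0) : 0 < maxLeverage A := by
  refine (maxLeverage_nonneg A).lt_of_ne fun h => hA ?_
  have h1 := sum_norm_sq_eq_finrank (leverageFrame_parseval A)
  have h2 : ∀ j, ‖leverageFrame A j‖ = 0 := fun j =>
    le_antisymm ((norm_leverageFrame_le A j).trans_eq h.symm) (norm_nonneg _)
  simp only [h2, finrank_colSpace] at h1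
  have h3 : (A.rank : ℝ) = 0 := by rw [← h1]; simp
  exact_mod_cast h3

/-- The sparsity and dimension requirements, in the form used by the moment bounds. -/
lemma sparse_parameters {m s r μ ε L p : ℝ} (hm : 0 < m) (hs : 0 < s)
    (hr : 0 ≤ r) (hμ : 0 ≤ μ) (hε : 0 < ε) (hε1 : ε < 1) (hL : 0 < L) (hp1 : 1 ≤ p)
    (hp : p ≤ 12 * L) (h1 : 10 ^ 9 * (ε⁻¹ * (L ^ 2 * r)) ≤ m)
    (h2 : 10 ^ 9 * (ε⁻¹ * μ ^ 2 * L ^ 2) ≤ s)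
    (h3 : 10 ^ 9 * (ε ^ (-(1 / 2) : ℝ) * μ * L ^ (3 / 2 : ℝ)) ≤ s) :
    5000 * (p * (36 * (p * μ ^ 2 + s / m * r))) ≤ s ∧
    64 * p ^ 2 * (36 * (p * μ ^ 2 + s / m * s * r)) / s ^ 2 ≤ (√ε / 4) ^ 2 / 16 := by
  have hp0 : 0 < p := by linarith
  have a1 : p ^ 2 ≤ 144 * L ^ 2 := by nlinarith
  have a2 : p ^ 3 ≤ 1728 * L ^ 3 := by
    calc p ^ 3 ≤ (12 * L) ^ 3 := by gcongr
      _ = _ := by ring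
  have k1 : 10 ^ 9 * (L ^ 2 * r) ≤ ε * m := by
    have := mul_le_mul_of_nonneg_left h1 hε.le
    calc _ = ε * (10 ^ 9 * (ε⁻¹ * (L ^ 2 * r))) := by field_simp
      _ ≤ _ := this
  have k2 : 10 ^ 9 * (μ ^ 2 * L ^ 2) ≤ ε * s := by
    have := mul_le_mul_of_nonneg_left h2 hε.le
    calc _ = ε * (10 ^ 9 * (ε⁻¹ * μ ^ 2 * L ^ 2)) := by field_simp
      _ ≤ _ := this
  -- The half-integer powers are cleared by squaring; p³μ² over s² is the term of the chaos bound
  -- that needs this.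
  have k3 : 10 ^ 18 * (μ ^ 2 * L ^ 3) ≤ ε * s ^ 2 := by
    have h4 := pow_le_pow_left₀ (by positivity) h3 2
    have e1 : (ε ^ (-(1 / 2) : ℝ)) ^ 2 = ε⁻¹ := by
      rw [← Real.rpow_natCast, ← Real.rpow_mul hε.le, ← Real.rpow_neg_one]; norm_num
    have e2 : (L ^ (3 / 2 : ℝ)) ^ 2 = L ^ 3 := by
      rw [← Real.rpow_natCast, ← Real.rpow_mul hL.le, ← Real.rpow_natCast]; norm_num
    rw [mul_pow, mul_pow, mul_pow, e1, e2] at h4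
    have := mul_le_mul_of_nonneg_left h4 hε.le
    calc _ = ε * ((10 ^ 9) ^ 2 * (ε⁻¹ * μ ^ 2 * L ^ 3)) := by field_simp
      _ ≤ _ := this
  have b1 : p ^ 2 * r / m ≤ 144 / 10 ^ 9 * ε := by
    rw [div_le_iff₀ hm]
    have : p ^ 2 * r ≤ 144 * L ^ 2 * r := by gcongr
    linarith
  have b2 : p ^ 2 * μ ^ 2 ≤ 144 / 10 ^ 9 * (ε * s) := by
    have : p ^ 2 * μ ^ 2 ≤ 144 * L ^ 2 * μ ^ 2 := by gcongr
    linarith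
  have b3 : p ^ 3 * μ ^ 2 ≤ 1728 / 10 ^ 18 * (ε * s ^ 2) := by
    have : p ^ 3 * μ ^ 2 ≤ 1728 * L ^ 3 * μ ^ 2 := by gcongr
    linarith
  constructor
  · have c1 : p * r / m ≤ p ^ 2 * r / m := by
      gcongr; nlinarith
    have c2 : p * r / m * s ≤ 144 / 10 ^ 9 * s := by
      refine mul_le_mul_of_nonneg_right ?_ hs.le
      linarith
    have c3 : ε * s ≤ s := by nlinarith
    have e : 5000 * (p * (36 * (p * μ ^ 2 + s / m * r)))
        = 180000 * (p ^ 2 * μ ^ 2) + 180000 * (p * r / m * s) := by ring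
    rw [e]
    linarith
  · have e : 64 * p ^ 2 * (36 * (p * μ ^ 2 + s / m * s * r)) / s ^ 2
        = 2304 * (p ^ 3 * μ ^ 2 / s ^ 2) + 2304 * (p ^ 2 * r / m) := by
      field_simp; ring
    have c1 : p ^ 3 * μ ^ 2 / s ^ 2 ≤ 1728 / 10 ^ 18 * ε := by
      rw [div_le_iff₀ (by positivity)]; linarith
    rw [e, div_pow, Real.sq_sqrt hε.le]
    linarith

/-- Since 1/4 ≤ 1/e, 4⁻ᵖ is at most η¹⁰. The union factor 3m + 4 is paid for by m ≤ 1/η, and 5 · 2⁻⁸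
< 1 settles the constants. -/
lemma failure_prob_le {η m r : ℝ} {p : ℕ} (hη : 0 < η) (hη2 : η ≤ 1 / 2)
    (hm : m ≤ 1 / η) (hr : r ≤ m) (hr0 : 0 ≤ r) (hp : 10 * Real.log η⁻¹ ≤ p) :
    (m + 2) * (1 / 4) ^ p + (2 * r + 2) * (1 / 16) ^ p ≤ η := by
  have h1 : ((1 : ℝ) / 4) ^ p ≤ η ^ 10 := by
    have e1 : (1 : ℝ) / 4 ≤ Real.exp (-1) := by
      rw [Real.exp_neg, one_div]
      gcongr
      linarith [Real.exp_one_lt_d9]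
    calc ((1 : ℝ) / 4) ^ p ≤ Real.exp (-1) ^ p := by gcongr
      _ = Real.exp (-p) := by rw [← Real.exp_nat_mul]; ring_nf
      _ ≤ Real.exp (10 * Real.log η) := by
          apply Real.exp_le_exp.2
          rw [Real.log_inv] at hp
          linarith
      _ = η ^ 10 := by
          have := Real.exp_nat_mul (Real.log η) 10
          rw [Real.exp_log hη] at this
          exact_mod_cast this
  have h2 : ((1 : ℝ) / 16) ^ p ≤ (1 / 4) ^ p := by gcongr; norm_num
  have hm0 : 0 ≤ m := hr0.trans hr
  have h3 : (m + 2) * (1 / 4) ^ p + (2 * r + 2) * (1 / 16) ^ p ≤ (3 * m + 4) * η ^ 10 := by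
    calc _ ≤ (m + 2) * η ^ 10 + (2 * m + 2) * η ^ 10 := by
          gcongr; exact h2.trans h1
      _ = _ := by ring
  have h4 : (3 * m + 4) * η ^ 10 ≤ (3 * (1 / η) + 4) * η ^ 10 := by gcongr
  have h5 : (3 * (1 / η) + 4) * η ^ 10 = (3 + 4 * η) * η ^ 9 := by field_simp
  have h6 : η ^ 8 ≤ (1 / 2) ^ 8 := by gcongr
  have h7 : η ^ 9 = η * η ^ 8 := by ring
  have h8 : (3 + 4 * η) * η ^ 9 ≤ 5 * (η * (1 / 2) ^ 8) := by
    rw [h7]; gcongr; linarith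
  refine h3.trans (h4.trans (h5.le.trans (h8.trans ?_)))
  norm_num
  linarith

theorem sparse_sketched_regression {Ω : Type*} [MeasurableSpace Ω] (P : Measure Ω)
    [IsProbabilityMeasure P] (m n d s : ℕ) (Φ : Ω → Matrix (Fin m) (Fin n) ℝ)
    (A : Matrix (Fin n) (Fin d) ℝ) (b : Fin n → ℝ) (xstar : Fin d → ℝ) (ε η : ℝ)
    (hΦ : IsSJLT P s Φ) (hmin : IsMinOn (lsObjective A b) Set.univ xstar)
    (hε : 0 < ε) (hε1 : ε < 1) (hη : 0 < η) (hη2 : η ≤ 1 / 2) (hηm : η ≤ 1 / (m : ℝ))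
    (hm : 10 ^ 9 * (ε⁻¹ * (Real.log η⁻¹ * ((A.rank : ℝ) + Real.log m) * Real.log m ^ 2
      + Real.log η⁻¹ ^ 2 * (A.rank : ℝ))) ≤ (m : ℝ))
    (hsb : 10 ^ 9 * (ε⁻¹ * maxLeverage A ^ 2
        * (Real.log η⁻¹ ^ 2 + Real.log η⁻¹ * Real.log m ^ 3)
      + ε ^ (-(1 / 2) : ℝ) * maxLeverage A
        * (Real.log η⁻¹ ^ (3 / 2 : ℝ) + Real.log η⁻¹ * Real.log m ^ (3 / 2 : ℝ))) ≤ (s : ℝ)) :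
    1 - η ≤ P.real {ω | ∀ xhat : Fin d → ℝ,
      IsMinOn (sketchedObjective (Φ ω) A b) Set.univ xhat →
      lsObjective A b xhat ≤ (1 - ε) ^ (-2 : ℤ) * lsObjective A b xstar} := by
  obtain ⟨hs1, σ, δ, hσ, hδ, hind, hΦe⟩ := hΦ
  by_cases hA : A.rank = 0
  · have : {ω | ∀ xhat : Fin d → ℝ, IsMinOn (sketchedObjective (Φ ω) A b) Set.univ xhat →
        lsObjective A b xhat ≤ (1 - ε) ^ (-2 : ℤ) * lsObjective A b xstar} = Set.univ :=
      Set.eq_univ_of_forall fun ω xhat hx =>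
        lsObjective_le_of_rank_eq_zero (Φ ω) hA hmin hε hε1 hx
    rw [this, probReal_univ]
    linarith
  set μ := maxLeverage A with hμ
  set L := Real.log η⁻¹ with hL
  set l := Real.log m with hl
  have hμ0 : 0 < μ := maxLeverage_pos hA
  have hr1 : (1 : ℝ) ≤ A.rank := by exact_mod_cast Nat.one_le_iff_ne_zero.2 hA
  have hl0 : 0 ≤ l := Real.log_natCast_nonneg m
  have hL2 : 0.69 < L := by
    have h1 : Real.log 2 ≤ L := by
      apply Real.log_le_log (by norm_num)
      rw [le_inv_comm₀ (by norm_num) hη]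
      linarith
    linarith [Real.log_two_gt_d9]
  have hL0 : 0 < L := by linarith
  have hε' : 1 ≤ ε⁻¹ := (one_le_inv₀ hε).2 hε1.le
  have hs0 : s ≠ 0 := by omega
  have hs' : (0 : ℝ) < s := by exact_mod_cast hs1
  have hm1 : 10 ^ 9 * (ε⁻¹ * (L ^ 2 * A.rank)) ≤ (m : ℝ) := by
    refine le_trans ?_ hm
    gcongr
    have : 0 ≤ L * ((A.rank : ℝ) + l) * l ^ 2 := by positivity
    linarith
  have hpos : 0 ≤ ε ^ (-(1 / 2) : ℝ) := Real.rpow_nonneg hε.le _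
  have hlr : 0 ≤ l ^ (3 / 2 : ℝ) := Real.rpow_nonneg hl0 _
  have hLr : 0 ≤ L ^ (3 / 2 : ℝ) := Real.rpow_nonneg hL0.le _
  have hs2 : 10 ^ 9 * (ε⁻¹ * μ ^ 2 * L ^ 2) ≤ (s : ℝ) := by
    refine le_trans ?_ hsb
    gcongr
    have h1 : 0 ≤ ε⁻¹ * μ ^ 2 * (L * l ^ 3) := by positivity
    have h2 : 0 ≤ ε ^ (-(1 / 2) : ℝ) * μ * (L ^ (3 / 2 : ℝ) + L * l ^ (3 / 2 : ℝ)) := by positivity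
    linarith
  have hs3 : 10 ^ 9 * (ε ^ (-(1 / 2) : ℝ) * μ * L ^ (3 / 2 : ℝ)) ≤ (s : ℝ) := by
    refine le_trans ?_ hsb
    gcongr
    have h1 : 0 ≤ ε⁻¹ * μ ^ 2 * (L ^ 2 + L * l ^ 3) := by positivity
    have h2 : 0 ≤ ε ^ (-(1 / 2) : ℝ) * μ * (L * l ^ (3 / 2 : ℝ)) := by positivity
    linarith
  have hrm : (A.rank : ℝ) ≤ m := by
    refine le_trans ?_ hm1
    have h1 : 1 ≤ 10 ^ 9 * (ε⁻¹ * L ^ 2) := by nlinarith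
    nlinarith
  have hm0 : (0 : ℝ) < m := by linarith
  have hmη : (m : ℝ) ≤ 1 / η := by rwa [le_div_comm₀ hm0 hη]
  -- Rounding up keeps p ≤ 12 L, because L ≥ log 2 exceeds 1/2.
  set p : ℕ := ⌈10 * L⌉₊ with hp
  have hp1 : 10 * L ≤ p := Nat.le_ceil _
  have hp2 : (p : ℝ) ≤ 12 * L := by
    have := Nat.ceil_lt_add_one (by positivity : 0 ≤ 10 * L)
    linarith
  have hp0 : p ≠ 0 := by
    intro h
    rw [h, Nat.cast_zero] at hp1
    linarith
  have hp1' : (1 : ℝ) ≤ p := by exact_mod_cast Nat.one_le_iff_ne_zero.2 hp0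
  obtain ⟨hc1, hc2⟩ := sparse_parameters hm0 hs' (by positivity : (0 : ℝ) ≤ A.rank) hμ0.le hε hε1
    hL0 hp1' hp2 hm1 hs2 hs3
  have hsε : √ε < 1 := by
    rw [Real.sqrt_lt' one_pos]; linarith
  have hsε0 : 0 < √ε := Real.sqrt_pos.2 hε
  -- The frame vectors have squared norm at most M = μ², and t = √ε / 4 is the precision wanted for
  -- the cross term.
  have hfin := hδ.isPatternLaw.sum_card_not_isGoodSketch_le (u := leverageFrame A)
    (by positivity) hs0 (leverageFrame_parseval A) (b - A *ᵥ xstar) (M := μ ^ 2) (by positivity)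
    (fun j => pow_le_pow_left₀ (norm_nonneg _) (norm_leverageFrame_le A j) 2) hp0
    (by rw [finrank_colSpace]; exact hc1) (t := √ε / 4) (by positivity) (by linarith)
    (by rw [finrank_colSpace]; exact hc2)
  rw [finrank_colSpace, Fintype.card_fin] at hfin
  refine one_sub_le_measureReal_of_compl ((measureReal_compl_le_of_sparse hσ hδ hind
    (fun D τ => IsGoodSketch D s (leverageFrame A) (b - A *ᵥ xstar)
      (√ε / 4 * √(∑ j, (b - A *ᵥ xstar) j ^ 2)) τ) ?_).trans ?_)
  · intro ω D τ hτ hD hgood xhat hx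
    refine lsObjective_le_of_chaos hmin hε hε1 hs0 (S := Φ ω) (D := D) (τ := τ) ?_ hgood.1 ?_ hx
    · intro i j
      rw [hΦe, hτ, hD, signEntry]
      split_ifs <;> simp
    · refine hgood.2.trans (le_of_eq ?_)
      rw [EuclideanSpace.norm_eq]
      simp
  · rw [div_le_iff₀ (by positivity)]
    refine hfin.trans ?_
    rw [mul_comm]
    exact mul_le_mul_of_nonneg_right
      (failure_prob_le hη hη2 hmη hrm (by positivity) hp1) (by positivity)

end Sparse

/-! ### Sketched regression with a dense sign matrix -/

section Bernstein

variable {I J : Type*} [Fintype I] [Fintype J] [DecidableEq I] [DecidableEq J]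

lemma exp_le_one_add_add_sq_mul_exp (x : ℝ) : Real.exp x ≤ 1 + x + x ^ 2 * Real.exp |x| := by
  rcases le_total |x| 1 with h | h
  · have h1 := (abs_le.1 (Real.abs_exp_sub_one_sub_id_le h)).2
    have h2 : 1 ≤ Real.exp |x| := Real.one_le_exp (abs_nonneg x)
    nlinarith [sq_nonneg x]
  · have h2 : Real.exp x ≤ Real.exp |x| := Real.exp_le_exp.2 (le_abs_self x)
    have h3 : 1 ≤ x ^ 2 := by rw [← sq_abs]; nlinarith
    rcases le_abs.1 h with h4 | h4
    · nlinarith [Real.exp_pos |x|]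
    · have h5 : Real.exp x ≤ 1 := Real.exp_le_one_iff.2 (by linarith)
      have h6 : 1 ≤ Real.exp |x| := Real.one_le_exp (abs_nonneg x)
      nlinarith

lemma sum_signVal_mul_signVal (j k : J) :
    ∑ τ : J → ℤˣ, signVal (τ j) * signVal (τ k)
      = if j = k then (Fintype.card (J → ℤˣ) : ℝ) else 0 := by
  split_ifs with h
  · subst h; simp
  · rw [sum_eq_half_sum_add_flipAt j]
    refine Finset.sum_eq_zero fun τ _ => ?_
    rw [flipAt_same, flipAt_of_ne (Ne.symm h), signVal_neg]
    ring

lemma sum_rademacher_mul_rademacher (a b : J → ℝ) :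
    ∑ τ : J → ℤˣ, (∑ j, signVal (τ j) * a j) * (∑ j, signVal (τ j) * b j)
      = Fintype.card (J → ℤˣ) * ∑ j, a j * b j := by
  simp only [Finset.sum_mul_sum]
  rw [Finset.sum_comm, Finset.mul_sum]
  refine Finset.sum_congr rfl fun j _ => ?_
  rw [Finset.sum_comm, Finset.sum_eq_single j]
  · have := sum_signVal_mul_signVal j j
    rw [if_pos rfl] at this
    rw [← this, Finset.sum_mul]
    exact Finset.sum_congr rfl fun τ _ => by ring
  · intro k _ hk
    have := sum_signVal_mul_signVal j k
    rw [if_neg hk.symm] at this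
    rw [← zero_mul (a j * b k), ← this, Finset.sum_mul]
    exact Finset.sum_congr rfl fun τ _ => by ring
  · simp

lemma sum_exp_rademacher_sq_div_eight_le {a : J → ℝ} (ha : ∑ j, a j ^ 2 ≤ 1) :
    ∑ τ : J → ℤˣ, Real.exp ((∑ j, signVal (τ j) * a j) ^ 2 / 8)
      ≤ Fintype.card (J → ℤˣ) * Real.exp (1 / 6) := by
  have h := sum_exp_norm_sq_rademacher_le (0 : ℝ) a Finset.univ (K := 8) (by
    simp only [Real.norm_eq_abs, sq_abs]; linarith)
  simp only [Real.norm_eq_abs, sq_abs, smul_eq_mul, zero_add] at h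
  refine h.trans (mul_le_mul_of_nonneg_left (Real.exp_le_exp.2 ?_) (by positivity))
  have h0 : 0 ≤ ∑ j, a j ^ 2 := by positivity
  rw [div_le_div_iff₀ (by linarith) (by norm_num)]
  linarith

/-- Moment generating function of a product of two Rademacher sums. -/
lemma sum_exp_rademacher_mul_le {a b : J → ℝ} (ha : ∑ j, a j ^ 2 ≤ 1) (hb : ∑ j, b j ^ 2 ≤ 1)
    {l : ℝ} (hl : |l| ≤ 1 / 16) :
    ∑ τ : J → ℤˣ, Real.exp (l * ((∑ j, signVal (τ j) * a j) * (∑ j, signVal (τ j) * b j)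
        - ∑ j, a j * b j))
      ≤ Fintype.card (J → ℤˣ) * Real.exp (2048 * l ^ 2) := by
  set N : ℝ := (Fintype.card (J → ℤˣ) : ℝ) with hN
  set c := ∑ j, a j * b j with hc
  let A : (J → ℤˣ) → ℝ := fun τ => ∑ j, signVal (τ j) * a j
  let B : (J → ℤˣ) → ℝ := fun τ => ∑ j, signVal (τ j) * b j
  have hc1 : |c| ≤ 1 := by
    rw [← sq_le_one_iff_abs_le_one]
    refine (Finset.sum_mul_sq_le_sq_mul_sq _ _ _).trans ?_
    have : 0 ≤ ∑ j, a j ^ 2 := by positivity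
    have : 0 ≤ ∑ j, b j ^ 2 := by positivity
    nlinarith
  -- With Y = (A² + B²)/2 + 1 ≥ |AB - c| and |l| ≤ 1/16, the second-order remainder is at most l²Y²
  -- exp(Y/16). Since Y² ≤ (2 · 16)² exp(Y/16), what remains is exp(Y/8), which the
  -- arithmetic-geometric mean splits into square-exponential moments of A and of B.
  have hpt : ∀ τ, Real.exp (l * (A τ * B τ - c)) ≤ 1 + l * (A τ * B τ - c)
      + 512 * l ^ 2 * Real.exp (1 / 8) * (Real.exp (A τ ^ 2 / 8) + Real.exp (B τ ^ 2 / 8)) := by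
    intro τ
    refine (exp_le_one_add_add_sq_mul_exp _).trans (add_le_add le_rfl ?_)
    set Y := (A τ ^ 2 + B τ ^ 2) / 2 + 1 with hY
    have hY0 : 0 ≤ Y := by positivity
    have hW : |A τ * B τ - c| ≤ Y := by
      refine (abs_sub _ _).trans (add_le_add ?_ hc1)
      rw [abs_mul, ← sq_abs (A τ), ← sq_abs (B τ)]
      nlinarith [sq_nonneg (|A τ| - |B τ|)]
    have h1 : |l * (A τ * B τ - c)| ≤ Y / 16 := by
      rw [abs_mul]
      calc _ ≤ 1 / 16 * Y := by gcongr
        _ = _ := by ring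
    have h2 : (l * (A τ * B τ - c)) ^ 2 ≤ l ^ 2 * Y ^ 2 := by
      rw [mul_pow, ← sq_abs (A τ * B τ - c)]
      gcongr
    have h3 : Y ^ 2 ≤ 1024 * Real.exp (Y / 16) := by
      have := pow_le_mul_exp_div hY0 (by norm_num : (0 : ℝ) < 16) 2
      norm_num at this
      exact this
    have h4 : Real.exp (Y / 16) * Real.exp (Y / 16)
        = Real.exp (1 / 8) * (Real.exp (A τ ^ 2 / 16) * Real.exp (B τ ^ 2 / 16)) := by
      rw [← Real.exp_add, ← Real.exp_add, ← Real.exp_add]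
      congr 1
      rw [hY]; ring
    have h5 : Real.exp (A τ ^ 2 / 16) * Real.exp (B τ ^ 2 / 16)
        ≤ (Real.exp (A τ ^ 2 / 8) + Real.exp (B τ ^ 2 / 8)) / 2 := by
      have e : ∀ x : ℝ, Real.exp (x / 8) = Real.exp (x / 16) ^ 2 := fun x => by
        rw [← Real.exp_nat_mul]; congr 1; push_cast; ring
      rw [e, e]
      nlinarith [sq_nonneg (Real.exp (A τ ^ 2 / 16) - Real.exp (B τ ^ 2 / 16))]
    calc _ ≤ (l ^ 2 * (1024 * Real.exp (Y / 16))) * Real.exp (Y / 16) := by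
          exact mul_le_mul (h2.trans (by gcongr)) (Real.exp_le_exp.2 h1) (Real.exp_pos _).le
            (by positivity)
      _ = 1024 * l ^ 2 * (Real.exp (Y / 16) * Real.exp (Y / 16)) := by ring
      _ ≤ 1024 * l ^ 2 * (Real.exp (1 / 8)
          * ((Real.exp (A τ ^ 2 / 8) + Real.exp (B τ ^ 2 / 8)) / 2)) := by
          rw [h4]; gcongr
      _ = _ := by ring
  have hmean : ∑ τ, (A τ * B τ - c) = 0 := by
    rw [Finset.sum_sub_distrib, sum_rademacher_mul_rademacher, Finset.sum_const, Finset.card_univ,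
      nsmul_eq_mul]
    ring
  have h1 : ∑ τ, Real.exp (l * (A τ * B τ - c)) ≤ N + 512 * l ^ 2 * Real.exp (1 / 8)
      * (∑ τ, Real.exp (A τ ^ 2 / 8) + ∑ τ, Real.exp (B τ ^ 2 / 8)) := by
    refine (Finset.sum_le_sum fun τ _ => hpt τ).trans (le_of_eq ?_)
    rw [Finset.sum_add_distrib, Finset.sum_add_distrib, ← Finset.mul_sum, hmean, ← Finset.mul_sum,
      Finset.sum_add_distrib]
    simp [hN]
  have h2 := sum_exp_rademacher_sq_div_eight_le ha
  have h3 := sum_exp_rademacher_sq_div_eight_le hb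
  have h4 : Real.exp (1 / 8) * Real.exp (1 / 6) ≤ 2 := by
    rw [← Real.exp_add]
    have h5 : Real.exp (1 / 8 + 1 / 6) ≤ Real.exp (1 / 2) := Real.exp_le_exp.2 (by norm_num)
    have h6 : Real.exp (1 / 2) ^ 2 ≤ 2 ^ 2 := by
      rw [← Real.exp_nat_mul]
      have := Real.exp_one_lt_d9
      norm_num at this ⊢; linarith
    exact h5.trans ((pow_le_pow_iff_left₀ (Real.exp_pos _).le (by norm_num) (by norm_num)).1 h6)
  calc _ ≤ N + 512 * l ^ 2 * Real.exp (1 / 8) * (N * Real.exp (1 / 6) + N * Real.exp (1 / 6)) := by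
        refine h1.trans ?_
        gcongr
    _ = N * (1 + 1024 * l ^ 2 * (Real.exp (1 / 8) * Real.exp (1 / 6))) := by ring
    _ ≤ N * (1 + 1024 * l ^ 2 * 2) := by gcongr
    _ ≤ _ := by
        gcongr
        have := Real.add_one_le_exp (2048 * l ^ 2)
        linarith

lemma sum_prod_rows (g : (J → ℤˣ) → ℝ) :
    ∑ τ : I × J → ℤˣ, ∏ i, g (fun j => τ (i, j)) = (∑ τ, g τ) ^ Fintype.card I := by
  rw [← Equiv.sum_comp (Equiv.curry I J ℤˣ).symm]
  have := Finset.prod_univ_sum (fun _ : I => (Finset.univ : Finset (J → ℤˣ))) (fun _ τ => g τ)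
  rw [Fintype.piFinset_univ, Finset.prod_const, Finset.card_univ] at this
  rw [this]
  rfl

variable {H : Type*} [NormedAddCommGroup H] [InnerProductSpace ℝ H] {u : J → H}

open Classical in
-- After normalizing α, the inner product is a mean over independent rows of centred products of two
-- Rademacher sums, to which Chernoff's method applies.
lemma card_inner_sketchChaos_univ_le [Nonempty I] (hu : ∀ x, ∑ j, inner ℝ (u j) x • u j = x)
    (α : J → ℝ) {x : H} (hx : ‖x‖ ≤ 1) {t : ℝ} (ht : 0 < t) (ht1 : t ≤ 1) :
    ((Finset.univ.filter fun τ : I × J → ℤˣ => t * √(∑ j, α j ^ 2)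
        < inner ℝ (sketchChaos (fun _ => Finset.univ) (Fintype.card I) α u τ) x).card : ℝ)
      ≤ Fintype.card (I × J → ℤˣ) * Real.exp (-(Fintype.card I * t ^ 2 / 8192)) := by
  set M : ℝ := (Fintype.card I : ℝ) with hM
  have hM0 : 0 < M := by rw [hM]; exact_mod_cast Fintype.card_pos
  set D : J → Finset I := fun _ => Finset.univ
  set v := ∑ j, α j ^ 2 with hv
  have hv0 : 0 ≤ v := by positivity
  rcases hv0.eq_or_lt with h0 | h0
  · have hα : ∀ j, α j = 0 := fun j => by
      have := (Finset.sum_eq_zero_iff_of_nonneg fun j _ => sq_nonneg (α j)).1 (hv ▸ h0.symm) j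
        (Finset.mem_univ j)
      simpa using this
    have : (Finset.univ.filter fun τ : I × J → ℤˣ => t * √v
        < inner ℝ (sketchChaos D M α u τ) x) = ∅ := by
      refine Finset.filter_eq_empty_iff.2 fun τ _ => ?_
      simp [sketchChaos, signRow, hα, ← h0]
    rw [this]
    simp only [Finset.card_empty, Nat.cast_zero]
    positivity
  set w := √v with hw
  have hw0 : 0 < w := Real.sqrt_pos.2 h0
  let a : J → ℝ := fun j => α j / w
  let b : J → ℝ := fun j => inner ℝ (u j) x
  have ha : ∑ j, a j ^ 2 ≤ 1 := by
    simp only [a, div_pow]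
    rw [← Finset.sum_div, hw, Real.sq_sqrt hv0, ← hv, div_self h0.ne']
  have hb : ∑ j, b j ^ 2 ≤ 1 := by
    rw [sum_inner_sq_of_frame hu]
    nlinarith [norm_nonneg x]
  let f : (J → ℤˣ) → ℝ := fun τ =>
    (∑ j, signVal (τ j) * a j) * (∑ j, signVal (τ j) * b j) - ∑ j, a j * b j
  have hin : ∀ τ : I × J → ℤˣ, inner ℝ (sketchChaos D M α u τ) x
      = w * (M⁻¹ * ∑ i, f fun j => τ (i, j)) := by
    intro τ
    have e1 : ∀ j, α j = w * a j := fun j => by simp only [a]; field_simp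
    have e2 : ∀ i, inner ℝ (signRow D τ u i) x = ∑ j, signVal (τ (i, j)) * b j := fun i => by
      rw [inner_signRow]; simp [signRow, signEntry, D, b]
    have e3 : ∀ i, signRow D τ α i = w * ∑ j, signVal (τ (i, j)) * a j := fun i => by
      simp only [signRow, signEntry, D, Finset.mem_univ, if_true, smul_eq_mul, Finset.mul_sum]
      exact Finset.sum_congr rfl fun j _ => by rw [e1 j]; ring
    rw [sketchChaos, inner_sub_left, real_inner_smul_left, sum_inner, sum_inner]
    simp only [real_inner_smul_left, e2, e3, f, Finset.sum_sub_distrib, Finset.sum_const,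
      Finset.card_univ, nsmul_eq_mul]
    have e4 : ∑ j, α j * inner ℝ (u j) x = w * ∑ j, a j * b j := by
      rw [Finset.mul_sum]
      exact Finset.sum_congr rfl fun j _ => by rw [e1 j]; ring
    rw [e4, ← hM, mul_sub M⁻¹, inv_mul_cancel_left₀ hM0.ne']
    simp only [mul_assoc w, ← Finset.mul_sum]
    ring
  -- This minimizes 2048 l² - l t, with value -t²/8192, and is below the admissible 1/16.
  set l := t / 4096 with hl
  have hl0 : 0 < l := by positivity
  have hsub : (Finset.univ.filter fun τ : I × J → ℤˣ => t * w
      < inner ℝ (sketchChaos D M α u τ) x)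
      ⊆ Finset.univ.filter fun τ : I × J → ℤˣ =>
        Real.exp (l * (M * t)) < Real.exp (l * ∑ i, f fun j => τ (i, j)) := by
    intro τ hτ
    have h1 := (Finset.mem_filter.1 hτ).2
    refine Finset.mem_filter.2 ⟨Finset.mem_univ _, Real.exp_lt_exp.2 ?_⟩
    rw [hin, mul_comm t] at h1
    have h2 := lt_of_mul_lt_mul_left h1 hw0.le
    rw [lt_inv_mul_iff₀ hM0] at h2
    gcongr
  have h1 := card_filter_lt_mul_le (F := fun τ : I × J → ℤˣ =>
    Real.exp (l * ∑ i, f fun j => τ (i, j))) (fun τ => (Real.exp_pos _).le)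
    (Real.exp (l * (M * t)))
  have h2 : ∑ τ : I × J → ℤˣ, Real.exp (l * ∑ i, f fun j => τ (i, j))
      ≤ Fintype.card (I × J → ℤˣ) * Real.exp (M * (2048 * l ^ 2)) := by
    have e1 : ∀ τ : I × J → ℤˣ, Real.exp (l * ∑ i, f fun j => τ (i, j))
        = ∏ i, Real.exp (l * f fun j => τ (i, j)) := fun τ => by
      rw [← Real.exp_sum, Finset.mul_sum]
    simp only [e1]
    rw [sum_prod_rows (I := I) fun τ => Real.exp (l * f τ)]
    have h3 := sum_exp_rademacher_mul_le ha hb (l := l) (by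
      rw [abs_of_pos hl0, hl]; linarith)
    refine (pow_le_pow_left₀ (Finset.sum_nonneg fun τ _ => (Real.exp_pos _).le) h3 _).trans
      (le_of_eq ?_)
    rw [mul_pow, ← Real.exp_nat_mul]
    congr 1
    have : Fintype.card (I × J → ℤˣ) = Fintype.card (J → ℤˣ) ^ Fintype.card I := by
      rw [Fintype.card_congr (Equiv.curry I J ℤˣ), Fintype.card_fun]
    rw [this]; push_cast; rfl
  have h3 : ((Finset.univ.filter fun τ : I × J → ℤˣ => t * w
      < inner ℝ (sketchChaos D M α u τ) x).card : ℝ) * Real.exp (l * (M * t))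
      ≤ Fintype.card (I × J → ℤˣ) * Real.exp (-(M * t ^ 2 / 8192)) * Real.exp (l * (M * t)) := by
    calc _ ≤ _ := mul_le_mul_of_nonneg_right (Nat.cast_le.2 (Finset.card_le_card hsub))
          (Real.exp_pos _).le
      _ ≤ _ := h1.trans h2
      _ = _ := by
        rw [mul_assoc, ← Real.exp_add]
        congr 2
        rw [hl]; ring
  exact le_of_mul_le_mul_right h3 (Real.exp_pos _)

end Bernstein

/-! ### Nets of the unit ball. -/

section Net

variable {H : Type*} [NormedAddCommGroup H] [InnerProductSpace ℝ H] [FiniteDimensional ℝ H]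

/-- The unit ball has a `1/2`-net of cardinality at most `5 ^ dim`. -/
lemma exists_half_net_unitBall (H : Type*) [NormedAddCommGroup H] [InnerProductSpace ℝ H]
    [FiniteDimensional ℝ H] :
    ∃ T : Finset H, T.card ≤ 5 ^ Module.finrank ℝ H ∧ (∀ x ∈ T, ‖x‖ ≤ 1) ∧
      ∀ x : H, ‖x‖ ≤ 1 → ∃ y ∈ T, ‖x - y‖ ≤ 1 / 2 := by
  classical
  have hcard : ∀ T : Finset H, (∀ x ∈ T, ‖x‖ ≤ 1) →
      (∀ x ∈ T, ∀ y ∈ T, x ≠ y → 1 / 2 ≤ ‖x - y‖) → T.card ≤ 5 ^ Module.finrank ℝ H := by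
    intro T hT hsep
    -- Doubling gives a 1-separated subset of the ball of radius 2, to which the Besicovitch count
    -- 5^dim applies.
    have hinj : Function.Injective fun x : H => (2 : ℝ) • x := fun x y h =>
      smul_right_injective H (two_ne_zero' ℝ) h
    rw [← Finset.card_image_of_injective T hinj]
    refine Besicovitch.card_le_of_separated _ ?_ ?_
    · simp only [Finset.mem_image, forall_exists_index, and_imp, forall_apply_eq_imp_iff₂]
      intro x hx
      rw [norm_smul, Real.norm_two]
      linarith [hT x hx]
    · simp only [Finset.mem_image, forall_exists_index, and_imp, forall_apply_eq_imp_iff₂]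
      intro x hx y hy hne
      rw [← smul_sub, norm_smul, Real.norm_two]
      have := hsep x hx y hy fun h => hne (by rw [h])
      linarith
  by_contra! hcon
  -- If no net existed, separated sets could be enlarged for ever, contradicting the cardinality
  -- bound.
  have hall : ∀ k : ℕ, ∃ T : Finset H, T.card = k ∧ (∀ x ∈ T, ‖x‖ ≤ 1) ∧
      ∀ x ∈ T, ∀ y ∈ T, x ≠ y → 1 / 2 ≤ ‖x - y‖ := by
    intro k
    induction k with
    | zero => exact ⟨∅, by simp⟩
    | succ k ih =>
      obtain ⟨T, hk, hT, hsep⟩ := ih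
      obtain ⟨x, hx, hxT⟩ := hcon T (hcard T hT hsep) hT
      have hxn : x ∉ T := fun h => by
        have := hxT x h
        rw [sub_self, norm_zero] at this
        linarith
      refine ⟨insert x T, by rw [Finset.card_insert_of_notMem hxn, hk], ?_, ?_⟩
      · intro y hy
        rcases Finset.mem_insert.1 hy with rfl | hy
        exacts [hx, hT y hy]
      · intro y hy z hz hne
        rcases Finset.mem_insert.1 hy with rfl | hy' <;>
          rcases Finset.mem_insert.1 hz with rfl | hz'
        · exact absurd rfl hne
        · exact (hxT z hz').le
        · rw [norm_sub_rev]; exact (hxT y hy').le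
        · exact hsep y hy' z hz' hne
  obtain ⟨T, hk, hT, hsep⟩ := hall (5 ^ Module.finrank ℝ H + 1)
  have := hcard T hT hsep
  omega

variable {T : Finset H}

/-- Replacing the direction of v by a nearby net point loses at most ‖v‖/2, which is absorbed. -/
lemma norm_le_of_inner_net_le (hnet : ∀ x : H, ‖x‖ ≤ 1 → ∃ y ∈ T, ‖x - y‖ ≤ 1 / 2) {v : H} {t : ℝ}
    (h : ∀ y ∈ T, inner ℝ v y ≤ t) : ‖v‖ ≤ 2 * t := by
  rcases eq_or_ne v 0 with rfl | hv
  · obtain ⟨y, hy, -⟩ := hnet 0 (by simp)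
    have := h y hy
    rw [inner_zero_left] at this
    simpa using this
  have hv' : 0 < ‖v‖ := norm_pos_iff.2 hv
  obtain ⟨y, hy, hxy⟩ := hnet (‖v‖⁻¹ • v) (by
    rw [norm_smul, norm_inv, norm_norm, inv_mul_cancel₀ hv'.ne'])
  have h1 : inner ℝ v (‖v‖⁻¹ • v) = ‖v‖ := by
    rw [real_inner_smul_right, real_inner_self_eq_norm_sq]
    field_simp
  have h2 : inner ℝ v (‖v‖⁻¹ • v - y) ≤ ‖v‖ * (1 / 2) :=
    (real_inner_le_norm _ _).trans (by gcongr)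
  rw [inner_sub_right, h1] at h2
  linarith [h y hy]

/-- The net bound is used twice: first ‖Xy‖ ≤ 1/4 at net points y, then, moving X across by
symmetry, ‖Xx‖ ≤ ‖x‖/2 for every x. -/
lemma abs_inner_le_of_net (hnet : ∀ x : H, ‖x‖ ≤ 1 → ∃ y ∈ T, ‖x - y‖ ≤ 1 / 2)
    {X : Module.End ℝ H} (hX : X.IsSymmetric)
    (h : ∀ x ∈ T, ∀ y ∈ T, inner ℝ (X x) y ≤ 1 / 8) (x : H) :
    |inner ℝ x (X x)| ≤ ‖x‖ ^ 2 / 2 := by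
  have h1 : ∀ y ∈ T, ‖X y‖ ≤ 2 * (1 / 8) := fun y hy => norm_le_of_inner_net_le hnet (h y hy)
  have h2 : ‖X x‖ ≤ 2 * (‖x‖ * (1 / 4)) := by
    refine norm_le_of_inner_net_le hnet fun y hy => ?_
    rw [hX]
    refine (real_inner_le_norm _ _).trans ?_
    have := h1 y hy
    gcongr
    linarith
  refine (abs_real_inner_le_norm _ _).trans ?_
  nlinarith [norm_nonneg x]

end Net

/-! ### The dense sketch. -/

section Dense

variable {I J : Type*} [Fintype I] [Fintype J] [DecidableEq I] [DecidableEq J]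
  {H : Type*} [NormedAddCommGroup H] [InnerProductSpace ℝ H] [FiniteDimensional ℝ H] {u : J → H}

open Classical in
/-- The proportion of sign matrices that give an inaccurate dense sketch. -/
lemma card_not_isGoodSketch_univ_le [Nonempty I] (hu : ∀ x, ∑ j, inner ℝ (u j) x • u j = x)
    (α : J → ℝ) {t : ℝ} (ht : 0 < t) (ht1 : t ≤ 1 / 8) :
    ((Finset.univ.filter fun τ : I × J → ℤˣ => ¬ IsGoodSketch (fun _ => Finset.univ)
        (Fintype.card I) u α (2 * t * √(∑ j, α j ^ 2)) τ).card : ℝ)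
      ≤ Fintype.card (I × J → ℤˣ) * (2 * 25 ^ Module.finrank ℝ H
        * Real.exp (-(Fintype.card I * t ^ 2 / 8192))) := by
  obtain ⟨T, hT, hT1, hnet⟩ := exists_half_net_unitBall H
  set N : ℝ := (Fintype.card (I × J → ℤˣ) : ℝ)
  set M : ℝ := (Fintype.card I : ℝ) with hM
  set D : J → Finset I := fun _ => Finset.univ
  set r := Module.finrank ℝ H
  set w := √(∑ j, α j ^ 2)
  let bad : (J → ℝ) → ℝ → H → Finset (I × J → ℤˣ) := fun β t y => Finset.univ.filter fun τ =>
    t * √(∑ j, β j ^ 2) < inner ℝ (sketchChaos D M β u τ) y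
  have hsub : (Finset.univ.filter fun τ => ¬ IsGoodSketch D (Fintype.card I) u α (2 * t * w) τ)
      ⊆ ((T ×ˢ T).biUnion fun e => bad (fun j => inner ℝ (u j) e.1) (1 / 8) e.2)
        ∪ T.biUnion fun y => bad α t y := by
    intro τ hτ
    by_contra hcon
    rw [Finset.mem_union, Finset.mem_biUnion, Finset.mem_biUnion] at hcon
    push Not at hcon
    obtain ⟨h1, h2⟩ := hcon
    refine (Finset.mem_filter.1 hτ).2 ⟨fun y => ?_, ?_⟩
    · refine abs_inner_le_of_net hnet (sketchOp_isSymmetric D M u τ) (fun x hx y hy => ?_) y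
      have h3 := h1 (x, y) (Finset.mk_mem_product hx hy)
      simp only [bad, Finset.mem_filter, Finset.mem_univ, true_and, not_lt,
        sum_inner_sq_of_frame hu, Real.sqrt_sq (norm_nonneg _)] at h3
      rw [sketchOp_apply D M hu]
      refine h3.trans ?_
      linarith [hT1 x hx]
    · rw [mul_assoc]
      refine norm_le_of_inner_net_le hnet fun y hy => ?_
      have h3 := h2 y hy
      simpa [bad] using h3
  -- The embedding only needs the constant level 1/8; as t ≤ 1/8, its exponential bound is at least
  -- as good as the one at level t.
  have hbad1 : ∀ e ∈ T ×ˢ T, ((bad (fun j => inner ℝ (u j) e.1) (1 / 8) e.2).card : ℝ)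
      ≤ N * Real.exp (-(M * t ^ 2 / 8192)) := by
    intro e he
    refine (card_inner_sketchChaos_univ_le hu _ (hT1 _ (Finset.mem_product.1 he).2)
      (by norm_num) (by norm_num)).trans ?_
    gcongr
  have hbad2 : ∀ y ∈ T, ((bad α t y).card : ℝ) ≤ N * Real.exp (-(M * t ^ 2 / 8192)) :=
    fun y hy => card_inner_sketchChaos_univ_le hu α (hT1 y hy) ht (by linarith)
  have hT' : (T.card : ℝ) ≤ 5 ^ r := by exact_mod_cast hT
  set E := Real.exp (-(M * t ^ 2 / 8192))
  calc _ ≤ (∑ e ∈ T ×ˢ T, ((bad (fun j => inner ℝ (u j) e.1) (1 / 8) e.2).card : ℝ))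
        + ∑ y ∈ T, ((bad α t y).card : ℝ) := by
        exact_mod_cast (Finset.card_le_card hsub).trans ((Finset.card_union_le _ _).trans
          (add_le_add Finset.card_biUnion_le Finset.card_biUnion_le))
    _ ≤ (∑ e ∈ T ×ˢ T, N * E) + ∑ y ∈ T, N * E :=
        add_le_add (Finset.sum_le_sum hbad1) (Finset.sum_le_sum hbad2)
    _ = N * ((T.card * T.card + T.card) * E) := by
        rw [Finset.sum_const, Finset.sum_const, Finset.card_product, nsmul_eq_mul, nsmul_eq_mul]
        push_cast; ring
    _ ≤ N * ((5 ^ r * 5 ^ r + 5 ^ r * 5 ^ r) * E) := by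
        have h1 : (1 : ℝ) ≤ 5 ^ r := one_le_pow₀ (by norm_num)
        have h2 : (T.card : ℝ) ≤ 5 ^ r * 5 ^ r := by nlinarith
        gcongr
    _ = _ := by
        rw [← mul_pow]; norm_num; ring_nf; simp

theorem dense_sketched_regression {Ω : Type*} [MeasurableSpace Ω] (P : Measure Ω)
    [IsProbabilityMeasure P] (m n d : ℕ) (Φ : Ω → Matrix (Fin m) (Fin n) ℝ)
    (A : Matrix (Fin n) (Fin d) ℝ) (b : Fin n → ℝ) (xstar : Fin d → ℝ) (ε η : ℝ)
    (hΦ : IsSignMatrix P Φ) (hmin : IsMinOn (lsObjective A b) Set.univ xstar)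
    (hε : 0 < ε) (hε1 : ε < 1) (hη : 0 < η) (hη1 : η < 1)
    (hm : 10 ^ 7 * (ε⁻¹ * ((A.rank : ℝ) + Real.log η⁻¹)) ≤ (m : ℝ)) :
    1 - η ≤ P.real {ω | ∀ xhat : Fin d → ℝ,
      IsMinOn (sketchedObjective (Φ ω) A b) Set.univ xhat →
      lsObjective A b xhat ≤ (1 - ε) ^ (-2 : ℤ) * lsObjective A b xstar} := by
  obtain ⟨σ, hσ, hΦe⟩ := hΦ
  by_cases hA : A.rank = 0
  · have : {ω | ∀ xhat : Fin d → ℝ, IsMinOn (sketchedObjective (Φ ω) A b) Set.univ xhat →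
        lsObjective A b xhat ≤ (1 - ε) ^ (-2 : ℤ) * lsObjective A b xstar} = Set.univ :=
      Set.eq_univ_of_forall fun ω xhat hx =>
        lsObjective_le_of_rank_eq_zero (Φ ω) hA hmin hε hε1 hx
    rw [this, probReal_univ]
    linarith
  set L := Real.log η⁻¹ with hL
  have hL0 : 0 < L := Real.log_pos ((one_lt_inv₀ hη).2 hη1)
  set r := A.rank with hr
  have hr1 : (1 : ℝ) ≤ r := by exact_mod_cast Nat.one_le_iff_ne_zero.2 hA
  have hmε : 10 ^ 7 * ((r : ℝ) + L) ≤ m * ε := by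
    have := mul_le_mul_of_nonneg_right hm hε.le
    calc _ = 10 ^ 7 * (ε⁻¹ * ((r : ℝ) + L)) * ε := by field_simp
      _ ≤ _ := this
  have hm0 : m ≠ 0 := by
    rintro rfl
    rw [Nat.cast_zero, zero_mul] at hmε
    linarith
  have : Nonempty (Fin m) := ⟨⟨0, Nat.pos_of_ne_zero hm0⟩⟩
  have hsε : √ε < 1 := by
    rw [Real.sqrt_lt' one_pos]; linarith
  have hsε0 : 0 < √ε := Real.sqrt_pos.2 hε
  -- Passing through the net doubles t, so √ε / 8 yields the required √ε / 4.
  have hfin := card_not_isGoodSketch_univ_le (I := Fin m) (u := leverageFrame A)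
    (leverageFrame_parseval A) (b - A *ᵥ xstar) (t := √ε / 8) (by positivity) (by linarith)
  rw [finrank_colSpace, Fintype.card_fin, ← hr, div_pow, Real.sq_sqrt hε.le] at hfin
  -- The prefactor is at most exp(5r) because r ≥ 1. Since mε ≥ 10⁷(r + L) and 64 · 8192 is about
  -- 5.2 · 10⁵, the exponent exceeds 5r + L.
  have hexp : 2 * 25 ^ r * Real.exp (-(m * (ε / 8 ^ 2) / 8192)) ≤ η := by
    have e1 : (2 : ℝ) ≤ Real.exp r := by
      have := Real.add_one_le_exp (r : ℝ)
      linarith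
    have e2 : (25 : ℝ) ^ r ≤ Real.exp (4 * r) := by
      have h3 : (25 : ℝ) ≤ Real.exp 4 := by
        have : Real.exp 4 = Real.exp 1 ^ 4 := by rw [← Real.exp_nat_mul]; norm_num
        rw [this]
        have h4 := Real.exp_one_gt_d9
        calc (25 : ℝ) ≤ 2.7 ^ 4 := by norm_num
          _ ≤ _ := by gcongr; linarith
      rw [mul_comm, Real.exp_nat_mul]
      gcongr
    calc _ ≤ Real.exp r * Real.exp (4 * r) * Real.exp (-(m * (ε / 8 ^ 2) / 8192)) := by gcongr
      _ = Real.exp (r + 4 * r + -(m * (ε / 8 ^ 2) / 8192)) := by rw [Real.exp_add, Real.exp_add]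
      _ ≤ Real.exp (-L) := by
          apply Real.exp_le_exp.2
          linarith
      _ = η := by rw [hL, Real.log_inv, neg_neg, Real.exp_log hη]
  refine one_sub_le_measureReal_of_compl ((hσ.measureReal_compl_le
    (fun τ => IsGoodSketch (fun _ => Finset.univ) m (leverageFrame A) (b - A *ᵥ xstar)
      (2 * (√ε / 8) * √(∑ j, (b - A *ᵥ xstar) j ^ 2)) τ) ?_).trans ?_)
  · intro ω τ hτ hgood xhat hx
    refine lsObjective_le_of_chaos hmin hε hε1 hm0 (S := Φ ω) (D := fun _ => Finset.univ)
      (τ := τ) ?_ hgood.1 ?_ hx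
    · intro i j
      rw [hΦe, hτ, signEntry, if_pos (Finset.mem_univ _)]
    · refine hgood.2.trans (le_of_eq ?_)
      rw [EuclideanSpace.norm_eq]
      simp only [Real.norm_eq_abs, sq_abs]
      ring
  · rw [div_le_iff₀ (by positivity)]
    refine hfin.trans ?_
    rw [mul_comm]
    gcongr

end Dense

/-! ### The two regression guarantees with explicit constants. -/

theorem mainTheorem7 :
    (∃ C : ℝ, 0 < C ∧
      ∀ (Ω : Type*) [MeasurableSpace Ω] (P : Measure Ω) [IsProbabilityMeasure P]
        (m n d s : ℕ) (Φ : Ω → Matrix (Fin m) (Fin n) ℝ)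
        (A : Matrix (Fin n) (Fin d) ℝ) (b : Fin n → ℝ) (xstar : Fin d → ℝ) (ε η : ℝ),
        IsSJLT P s Φ →
        IsMinOn (lsObjective A b) Set.univ xstar →
        0 < ε → ε < 1 → 0 < η → η ≤ 1 / 2 → η ≤ 1 / (m : ℝ) →
        C * (ε⁻¹ * (Real.log η⁻¹ * ((A.rank : ℝ) + Real.log m) * Real.log m ^ 2
            + Real.log η⁻¹ ^ 2 * (A.rank : ℝ))) ≤ (m : ℝ) →
        C * (ε⁻¹ * maxLeverage A ^ 2
              * (Real.log η⁻¹ ^ 2 + Real.log η⁻¹ * Real.log m ^ 3)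
            + ε ^ (-(1 / 2) : ℝ) * maxLeverage A
              * (Real.log η⁻¹ ^ (3 / 2 : ℝ) + Real.log η⁻¹ * Real.log m ^ (3 / 2 : ℝ)))
          ≤ (s : ℝ) →
        1 - η ≤ P.real {ω | ∀ xhat : Fin d → ℝ,
          IsMinOn (sketchedObjective (Φ ω) A b) Set.univ xhat →
          lsObjective A b xhat ≤ (1 - ε) ^ (-2 : ℤ) * lsObjective A b xstar}) ∧
    (∃ C : ℝ, 0 < C ∧
      ∀ (Ω : Type*) [MeasurableSpace Ω] (P : Measure Ω) [IsProbabilityMeasure P]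
        (m n d : ℕ) (Φ : Ω → Matrix (Fin m) (Fin n) ℝ)
        (A : Matrix (Fin n) (Fin d) ℝ) (b : Fin n → ℝ) (xstar : Fin d → ℝ) (ε η : ℝ),
        IsSignMatrix P Φ →
        IsMinOn (lsObjective A b) Set.univ xstar →
        0 < ε → ε < 1 → 0 < η → η < 1 →
        C * (ε⁻¹ * ((A.rank : ℝ) + Real.log η⁻¹)) ≤ (m : ℝ) →
        1 - η ≤ P.real {ω | ∀ xhat : Fin d → ℝ,
          IsMinOn (sketchedObjective (Φ ω) A b) Set.univ xhat →
          lsObjective A b xhat ≤ (1 - ε) ^ (-2 : ℤ) * lsObjective A b xstar}) := by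
  refine ⟨⟨10 ^ 9, by norm_num, ?_⟩, ⟨10 ^ 7, by norm_num, ?_⟩⟩
  · intro Ω _ P _ m n d s Φ A b xstar ε η hΦ hmin hε hε1 hη hη2 hηm hm hs
    exact sparse_sketched_regression P m n d s Φ A b xstar ε η hΦ hmin hε hε1 hη hη2 hηm hm hs
  · intro Ω _ P _ m n d Φ A b xstar ε η hΦ hmin hε hε1 hη hη1 hm
    exact dense_sketched_regression P m n d Φ A b xstar ε η hΦ hmin hε hε1 hη hη1 hm
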